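/- Let $k$ be an algebraically closed field of characteristic $0$, let $X$ be a nonsingular variety over $k$ (a smooth separated $k$-scheme of finite type; irreducibility is not needed), and let $\Lambda_0$ be a Poisson structure on $X$ over $k$, i.e. a structure of a sheaf of Poisson $k$-algebras on $\mathcal{O}_X$ with bracket $\{F,G\}=\Lambda_0(dF\wedge dG)$, equivalently a bivector field $\Lambda_0\in\Gamma(X,\wedge^2T_X)$ with $[\Lambda_0,\Lambda_0]=0$, where $[-,-]$ is the Schouten bracket. For a local Artinian $k$-algebra $A$ with residue field $k$, an infinitesimal Poisson deformation of $(X,\Lambda_0)$ over $A$ is a flat $A$-scheme $\pi:\mathcal{X}\to\operatorname{Spec}A$ with a Poisson structure $\Lambda$ over $A$ and a morphism $i:X\to\mathcal{X}$ that makes the square with $\operatorname{Spec}k\to\operatorname{Spec}A$ cartesian and satisfies $i^*\{F,G\}_{\Lambda}=\{i^*F,i^*G\}_{\Lambda_0}$. Two deformations are isomorphic if there is a Poisson isomorphism between them over $\operatorname{Spec}A$ compatible with the morphisms from $X$. A deformation is trivial if it is isomorphic to $(X\times_{\operatorname{Spec}k}\operatorname{Spec}A,\Lambda_0)$, where $\Lambda_0$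 is extended $A$-bilinearly. The pair $(X,\Lambda_0)$ is rigid if for every local Artinian $k$-algebra $A$ with residue field $k$, every infinitesimal Poisson deformation of $(X,\Lambda_0)$ over $A$ is trivial. Let $T_X^\bullet$ be the complex of sheaves $$T_X\xrightarrow{[\Lambda_0,-]}\wedge^2T_X\xrightarrow{[\Lambda_0,-]}\wedge^3T_X\xrightarrow{[\Lambda_0,-]}\cdots$$ with $T_X$ in degree $0$ and $\wedge^nT_X=\mathcal{H}om_{\mathcal{O}_X}(\wedge^n\Omega^1_{X/k},\mathcal{O}_X)$, and let $\mathbb{H}^1(X,\Lambda_0,T_X^\bullet)$ be its first hypercohomology group. Then $(X,\Lambda_0)$ is rigid if and only if $\mathbb{H}^1(X,\Lambda_0,T_X^\bullet)=0$. -/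

import Mathlib

universe u
noncomputable section
open CategoryTheory Opposite TopologicalSpace AlgebraicGeometry

namespace PoissonDeformation

section Algebra

/-- A Poisson bracket on the commutative `R`-algebra `A`. -/
structure PoissonBracket (R A : Type*) [CommRing R] [CommRing A] [Algebra R A] where
  bracket : A →ₗ[R] A →ₗ[R] A
  skew : ∀ F G, bracket F G = -bracket G F
  leibniz : ∀ F G H, bracket (F * G) H = F * bracket G H + G * bracket F H
  jacobi : ∀ F G H,
    bracket F (bracket G H) + bracket G (bracket H F) + bracket H (bracket F G) = 0

/-- The skew-symmetric `n`-derivations of `A` over `R`, i.e. the alternating `R`-multilinear maps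
`Aⁿ → A` that are derivations in each argument. By the universal property of Kähler differentials
this is `Hom_A(⋀ⁿ Ω_{A/R}, A)`, with `Q (F₁, …, Fₙ) = Q (dF₁ ∧ ⋯ ∧ dFₙ)`. -/
def skewDerivations (R A : Type*) [CommRing R] [CommRing A] [Algebra R A] (n : ℕ) :
    Submodule R (A [⋀^Fin n]→ₗ[R] A) where
  carrier := {Q | ∀ (v : Fin n → A) (i : Fin n) (x y : A),
    Q (Function.update v i (x * y)) =
      x * Q (Function.update v i y) + y * Q (Function.update v i x)}
  zero_mem' := by intro v i x y; simp
  add_mem' := by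
    intro P Q hP hQ v i x y
    simp only [AlternatingMap.add_apply, hP v i x y, hQ v i x y]
    ring
  smul_mem' := by
    intro c Q hQ v i x y
    simp only [AlternatingMap.smul_apply, hQ v i x y, smul_add, mul_smul_comm]

variable {k A : Type*} [Field k] [CommRing A] [Algebra k A]

/-- `(v₁, …, vₙ) ↦ ∑ᵢ Q (v₁, …, φ vᵢ, …, vₙ)`. -/
def insertSum {n : ℕ} (φ : A →ₗ[k] A) (Q : A [⋀^Fin n]→ₗ[k] A) : A [⋀^Fin n]→ₗ[k] A where
  toMultilinearMap := ∑ i : Fin n,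
    Q.toMultilinearMap.compLinearMap (fun j => if j = i then φ else LinearMap.id)
  map_eq_zero_of_eq' := by
    intro v a b hab hne
    have key : ∀ i : Fin n, Q.toMultilinearMap.compLinearMap
        (fun j => if j = i then φ else LinearMap.id) v = Q (Function.update v i (φ (v i))) := by
      intro i
      simp only [MultilinearMap.compLinearMap_apply, AlternatingMap.coe_multilinearMap]
      congr 1; ext j
      by_cases h : j = i
      · subst h; simp
      · simp [h]
    simp only [MultilinearMap.toFun_eq_coe, sum_apply, key]
    rw [Fintype.sum_eq_add a b hne]
    · have : Function.update v b (φ (v b)) =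
          (Function.update v a (φ (v a))) ∘ Equiv.swap a b := by
        ext j
        simp only [Function.comp_apply]
        by_cases h1 : j = a
        · subst h1; simp [Function.update_of_ne hne, Function.update_of_ne hne.symm, hab]
        · by_cases h2 : j = b
          · subst h2; simp [hab]
          · rw [Equiv.swap_apply_of_ne_of_ne h1 h2, Function.update_of_ne h2,
              Function.update_of_ne h1]
      rw [this, AlternatingMap.map_swap _ _ hne]; simp
    · rintro i ⟨hia, hib⟩
      exact Q.map_eq_zero_of_eq _ (by
        rw [Function.update_of_ne hia.symm, Function.update_of_ne hib.symm, hab]) hne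

lemma insertSum_apply {n : ℕ} (φ : A →ₗ[k] A) (Q : A [⋀^Fin n]→ₗ[k] A) (v : Fin n → A) :
    insertSum φ Q v = ∑ i, Q (Function.update v i (φ (v i))) := by
  change (∑ i : Fin n, Q.toMultilinearMap.compLinearMap
    (fun j => if j = i then φ else LinearMap.id)) v = _
  simp only [sum_apply, MultilinearMap.compLinearMap_apply,
    AlternatingMap.coe_multilinearMap]
  refine Finset.sum_congr rfl fun i _ => ?_
  congr 1; ext j
  by_cases h : j = i
  · subst h; simp
  · simp [h]

namespace PoissonBracket

variable (Λ : PoissonBracket k A)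

/-- The linear map sending `x` to the alternating map
`v ↦ {x, Q v} - ½ ∑ᵢ Q (v₁, …, {x, vᵢ}, …, vₙ)`. -/
def schoutenAux {n : ℕ} (Q : A [⋀^Fin n]→ₗ[k] A) : A →ₗ[k] A [⋀^Fin n]→ₗ[k] A where
  toFun x := (Λ.bracket x).compAlternatingMap Q - (2⁻¹ : k) • insertSum (Λ.bracket x) Q
  map_add' x y := by
    ext v
    simp [insertSum_apply, Finset.sum_add_distrib]
    ring
  map_smul' c x := by
    ext v
    simp [insertSum_apply, smul_sub, Finset.smul_sum, smul_comm c]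


/-- The Chevalley-Eilenberg differential of the Lie bracket. -/
def ce {n : ℕ} (Q : A [⋀^Fin n]→ₗ[k] A) : A [⋀^Fin (n + 1)]→ₗ[k] A :=
  AlternatingMap.alternatizeUncurryFin (Λ.schoutenAux Q)

/-- The Lie derivative along the Hamiltonian derivation `{x, -}`. -/
def lie {n : ℕ} (x : A) (Q : A [⋀^Fin n]→ₗ[k] A) : A [⋀^Fin n]→ₗ[k] A :=
  (Λ.bracket x).compAlternatingMap Q - insertSum (Λ.bracket x) Q

lemma ce_apply {n : ℕ} (Q : A [⋀^Fin n]→ₗ[k] A) (v : Fin (n + 1) → A) :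
    Λ.ce Q v = ∑ i : Fin (n + 1), (-1) ^ (i : ℕ) • (Λ.bracket (v i) (Q (i.removeNth v)) -
      (2⁻¹ : k) • insertSum (Λ.bracket (v i)) Q (i.removeNth v)) := by
  simp [ce, AlternatingMap.alternatizeUncurryFin_apply, schoutenAux]

lemma lie_apply {n : ℕ} (x : A) (Q : A [⋀^Fin n]→ₗ[k] A) (v : Fin n → A) :
    Λ.lie x Q v = Λ.bracket x (Q v) - ∑ i, Q (Function.update v i (Λ.bracket x (v i))) := by
  simp [lie, insertSum_apply]

lemma ce_add {n : ℕ} (P Q : A [⋀^Fin n]→ₗ[k] A) : Λ.ce (P + Q) = Λ.ce P + Λ.ce Q := by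
  ext v
  simp only [ce_apply, insertSum_apply, AlternatingMap.add_apply, map_add,
    Finset.sum_add_distrib, smul_add, smul_sub, Finset.sum_sub_distrib]
  ring

lemma ce_smul {n : ℕ} (c : k) (Q : A [⋀^Fin n]→ₗ[k] A) : Λ.ce (c • Q) = c • Λ.ce Q := by
  ext v
  simp only [ce_apply, insertSum_apply, AlternatingMap.smul_apply, map_smul, Finset.smul_sum,
    smul_sub, Finset.sum_sub_distrib, smul_comm c]

lemma lie_add {n : ℕ} (x : A) (P Q : A [⋀^Fin n]→ₗ[k] A) :
    Λ.lie x (P + Q) = Λ.lie x P + Λ.lie x Q := by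
  ext v
  simp only [lie_apply, AlternatingMap.add_apply, map_add, Finset.sum_add_distrib]
  ring

lemma ce_sub {n : ℕ} (P Q : A [⋀^Fin n]→ₗ[k] A) : Λ.ce (P - Q) = Λ.ce P - Λ.ce Q := by
  rw [eq_sub_iff_add_eq, ← ce_add, sub_add_cancel]

lemma lie_sub {n : ℕ} (x : A) (P Q : A [⋀^Fin n]→ₗ[k] A) :
    Λ.lie x (P - Q) = Λ.lie x P - Λ.lie x Q := by
  rw [eq_sub_iff_add_eq, ← lie_add, sub_add_cancel]

lemma insertSum_cons {n : ℕ} (φ : A →ₗ[k] A) (Q : A [⋀^Fin (n + 1)]→ₗ[k] A) (x : A)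
    (v : Fin n → A) : insertSum φ Q (Fin.cons x v) =
      Q (Fin.cons (φ x) v) + insertSum φ (Q.curryLeft x) v := by
  rw [insertSum_apply, Fin.sum_univ_succ, insertSum_apply]
  simp only [Fin.cons_zero, Fin.update_cons_zero, Fin.cons_succ, AlternatingMap.curryLeft_apply_apply,
    Matrix.vecCons, Fin.cons_update]

lemma map_cons_removeNth {n : ℕ} (Q : A [⋀^Fin (n + 1)]→ₗ[k] A) (i : Fin (n + 1)) (y : A)
    (v : Fin (n + 1) → A) :
    (-1) ^ (i : ℕ) • Q (Fin.cons y (i.removeNth v)) = Q (Function.update v i y) := by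
  have h := Q.map_insertNth i y (i.removeNth v)
  rw [Fin.insertNth_removeNth] at h
  exact h.symm

/-- Cartan's formula. -/
lemma curryLeft_ce [CharZero k] {n : ℕ} (x : A) (Q : A [⋀^Fin (n + 1)]→ₗ[k] A) :
    (Λ.ce Q).curryLeft x = Λ.lie x Q - Λ.ce (Q.curryLeft x) := by
  ext v
  have h2 : ∀ i : Fin (n + 1),
      (i.succ.removeNth (Fin.cons x v : Fin (n + 2) → A) : Fin (n + 1) → A) =
        Fin.cons x (i.removeNth v) := by
    intro i
    ext j
    refine Fin.cases ?_ (fun j => ?_) j <;> simp [Fin.removeNth]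
  have h0 : ((0 : Fin (n + 2)).removeNth (Fin.cons x v : Fin (n + 2) → A) : Fin (n + 1) → A)
      = v := by
    ext j; simp [Fin.removeNth]
  have h3 : ∀ i : Fin (n + 1), (-1 : ℤ) ^ (i : ℕ) •
      Q (Fin.cons (Λ.bracket (v i) x) (i.removeNth v)) =
      - Q (Function.update v i (Λ.bracket x (v i))) := by
    intro i
    rw [map_cons_removeNth, Λ.skew, AlternatingMap.map_update_neg]
  have h5 : ∀ a : A, a = (2⁻¹ : k) • a + (2⁻¹ : k) • a := by
    intro a
    rw [← add_smul, ← two_mul, mul_inv_cancel₀ two_ne_zero, one_smul]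
  rw [AlternatingMap.curryLeft_apply_apply, AlternatingMap.sub_apply, lie_apply, ce_apply,
    ce_apply, Fin.sum_univ_succ]
  simp only [Matrix.vecCons, Fin.cons_zero, Fin.cons_succ, h0, h2, insertSum_cons, Fin.val_zero,
    pow_zero, one_smul, Fin.val_succ, pow_succ, mul_neg, mul_one, neg_smul,
    AlternatingMap.curryLeft_apply_apply, smul_sub, smul_add, Finset.sum_neg_distrib,
    Finset.sum_sub_distrib, Finset.sum_add_distrib, smul_comm _ (2⁻¹ : k), ← Finset.smul_sum, h3]
  rw [insertSum_apply]
  conv_rhs => rw [h5 (∑ i, Q (Function.update v i (Λ.bracket x (v i))))]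
  simp only [smul_neg]
  ring

lemma curryLeft_ce_zero (x : A) (Q : A [⋀^Fin 0]→ₗ[k] A) :
    (Λ.ce Q).curryLeft x = Λ.lie x Q := by
  ext v
  rw [AlternatingMap.curryLeft_apply_apply, lie_apply, ce_apply]
  simp [insertSum_apply, Matrix.vecCons]

lemma curryLeft_lie {n : ℕ} (x y : A) (Q : A [⋀^Fin (n + 1)]→ₗ[k] A) :
    (Λ.lie x Q).curryLeft y =
      Λ.lie x (Q.curryLeft y) - Q.curryLeft (Λ.bracket x y) := by
  ext v
  have := insertSum_cons (Λ.bracket x) Q y v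
  simp only [lie, AlternatingMap.curryLeft_apply_apply, AlternatingMap.sub_apply,
    LinearMap.compAlternatingMap_apply, Matrix.vecCons, this]
  ring

lemma alt_ext {n : ℕ} {P Q : A [⋀^Fin (n + 1)]→ₗ[k] A}
    (h : ∀ x, P.curryLeft x = Q.curryLeft x) : P = Q := by
  ext v
  have := congr($(h (v 0)) (Fin.tail v))
  simpa [Matrix.vecCons, Fin.cons_self_tail] using this

lemma jacobi' (x y z : A) : Λ.bracket x (Λ.bracket y z) - Λ.bracket y (Λ.bracket x z) =
    Λ.bracket (Λ.bracket x y) z := by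
  have h := Λ.jacobi x y z
  rw [Λ.skew z (Λ.bracket x y), Λ.skew z x, map_neg] at h
  linear_combination h

lemma lie_lie {n : ℕ} (x y : A) (Q : A [⋀^Fin n]→ₗ[k] A) :
    Λ.lie x (Λ.lie y Q) - Λ.lie y (Λ.lie x Q) = Λ.lie (Λ.bracket x y) Q := by
  induction n with
  | zero =>
    ext v
    simp [lie_apply, ← Λ.jacobi']
  | succ n ih =>
    refine alt_ext fun z => ?_
    have e := ih (Q.curryLeft z)
    have hs : ∀ P P' : A [⋀^Fin (n + 1)]→ₗ[k] A,
      (P - P').curryLeft z = P.curryLeft z - P'.curryLeft z := fun P P' => rfl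
    rw [hs]
    simp only [curryLeft_lie, lie_sub]
    rw [← e, ← Λ.jacobi', map_sub]
    abel

lemma lie_ce [CharZero k] {n : ℕ} (x : A) (Q : A [⋀^Fin n]→ₗ[k] A) :
    Λ.lie x (Λ.ce Q) = Λ.ce (Λ.lie x Q) := by
  induction n with
  | zero =>
    refine alt_ext fun y => ?_
    rw [curryLeft_lie, curryLeft_ce_zero, curryLeft_ce_zero, curryLeft_ce_zero, ← lie_lie]
    abel
  | succ n ih =>
    refine alt_ext fun y => ?_
    rw [curryLeft_lie, curryLeft_ce, curryLeft_ce, curryLeft_ce, curryLeft_lie, ← lie_lie,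
      lie_sub, ce_sub, ih]
    abel

lemma ce_ce [CharZero k] {n : ℕ} (Q : A [⋀^Fin n]→ₗ[k] A) : Λ.ce (Λ.ce Q) = 0 := by
  induction n with
  | zero =>
    refine alt_ext fun y => ?_
    rw [curryLeft_ce, curryLeft_ce_zero, lie_ce, sub_self]; rfl
  | succ n ih =>
    refine alt_ext fun y => ?_
    rw [curryLeft_ce, curryLeft_ce, ce_sub, ih, lie_ce, sub_zero, sub_self]; rfl


lemma mem_skewDerivations_iff {n : ℕ} (Q : A [⋀^Fin (n + 1)]→ₗ[k] A) :
    Q ∈ skewDerivations k A (n + 1) ↔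
      ∀ x y, Q.curryLeft (x * y) = x • Q.curryLeft y + y • Q.curryLeft x := by
  constructor
  · intro h x y
    ext v
    have := h (Fin.cons 0 v) 0 x y
    simpa [Matrix.vecCons] using this
  · intro h v i x y
    have := congr($(h x y) (i.removeNth v))
    simp only [AlternatingMap.curryLeft_apply_apply, AlternatingMap.add_apply,
      AlternatingMap.smul_apply, Matrix.vecCons, smul_eq_mul] at this
    simp only [← map_cons_removeNth, this, smul_add, mul_smul_comm]

lemma ce_mem [CharZero k] {n : ℕ} {Q : A [⋀^Fin (n + 1)]→ₗ[k] A}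
    (hQ : Q ∈ skewDerivations k A (n + 1)) : Λ.ce Q ∈ skewDerivations k A (n + 2) := by
  rw [mem_skewDerivations_iff]
  intro x y
  have hlie : ∀ v, Λ.lie (x * y) Q v = x * Λ.lie y Q v + y * Λ.lie x Q v -
      (∑ i, Λ.bracket y (v i) * Q (Function.update v i x) +
        ∑ i, Λ.bracket x (v i) * Q (Function.update v i y)) := by
    intro v
    simp only [lie_apply, Λ.leibniz, AlternatingMap.map_update_add, hQ v, mul_sub, Finset.mul_sum,
      Finset.sum_add_distrib]
    ring
  have hce : ∀ (a b : A) (v : Fin (n + 1) → A), Λ.ce (a • Q.curryLeft b) v =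
      a * Λ.ce (Q.curryLeft b) v - ∑ i, Λ.bracket a (v i) * Q (Function.update v i b) := by
    intro a b v
    have h1 : ∀ (i : Fin (n + 1)) (w : A), Λ.bracket w (a * Q (Fin.cons b (i.removeNth v))) =
        a * Λ.bracket w (Q (Fin.cons b (i.removeNth v))) -
          Q (Fin.cons b (i.removeNth v)) * Λ.bracket a w := by
      intro i w
      rw [Λ.skew, Λ.leibniz, Λ.skew _ w]; ring
    simp only [ce_apply, insertSum_apply, AlternatingMap.smul_apply, smul_eq_mul,
      AlternatingMap.curryLeft_apply_apply, Matrix.vecCons, h1, ← map_cons_removeNth,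
      Finset.mul_sum, ← Finset.sum_sub_distrib]
    refine Finset.sum_congr rfl fun i _ => ?_
    rw [← Finset.mul_sum]
    simp only [Algebra.smul_def]
    push_cast
    ring
  ext v
  rw [curryLeft_ce, curryLeft_ce, curryLeft_ce, (mem_skewDerivations_iff Q).1 hQ x y, ce_add]
  simp only [AlternatingMap.sub_apply, AlternatingMap.add_apply, AlternatingMap.smul_apply,
    smul_eq_mul, hlie, hce]
  ring

/-- The Schouten bracket `[Λ, Q]` of the Poisson bivector `Λ` with a skew-symmetric map `Q` in
`n` arguments; see `schouten_apply` for the formula. -/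
def schouten {n : ℕ} (Q : A [⋀^Fin n]→ₗ[k] A) : A [⋀^Fin (n + 1)]→ₗ[k] A :=
  (-1 : k) ^ (n + 1) • Λ.ce Q

/-- The Schouten bracket written as a sum over shuffles; the pair `i ≤ j` in `Fin (n + 1)` stands
for the pair of positions `i < j + 1` in `Fin (n + 2)`, both of which are removed from `v`. -/
lemma schouten_apply [CharZero k] {n : ℕ} (Q : A [⋀^Fin (n + 1)]→ₗ[k] A) (v : Fin (n + 2) → A) :
    Λ.schouten Q v = (-1) ^ (n + 1) *
      (∑ i : Fin (n + 2), (-1) ^ (i : ℕ) * Λ.bracket (Q (i.removeNth v)) (v i) +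
        ∑ i : Fin (n + 1), ∑ j ≥ i, (-1) ^ (i + j : ℕ) *
          Q (Fin.cons (Λ.bracket (v i.castSucc) (v j.succ))
            (j.removeNth (i.castSucc.removeNth v)))) := by
  have h1 : ∀ (x : A) (w : Fin (n + 1) → A), insertSum (Λ.bracket x) Q w =
      AlternatingMap.alternatizeUncurryFin (Λ.bracket.compr₂ Q.curryLeft x) w := by
    intro x w
    simp [insertSum_apply, AlternatingMap.alternatizeUncurryFin_apply, ← map_cons_removeNth,
      Matrix.vecCons]
  have h2 := AlternatingMap.alternatizeUncurryFin_alternatizeUncurryFinLM_comp_apply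
    (Λ.bracket.compr₂ Q.curryLeft) v
  have h3 : ∀ (x y : A) (w : Fin n → A), Q (Fin.cons (Λ.bracket x y) w) -
      Q (Fin.cons (Λ.bracket y x) w) = (2 : k) • Q (Fin.cons (Λ.bracket x y) w) := by
    intro x y w
    have := congr($(Q.curryLeft.map_neg (Λ.bracket x y)) w)
    rw [Λ.skew y x]
    simp only [AlternatingMap.curryLeft_apply_apply, Matrix.vecCons,
      AlternatingMap.neg_apply] at this
    rw [this, two_smul]; ring
  rw [AlternatingMap.alternatizeUncurryFin_apply] at h2
  simp only [LinearMap.coe_comp, Function.comp_apply, AlternatingMap.alternatizeUncurryFinLM_apply,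
    ← h1, LinearMap.compr₂_apply, AlternatingMap.curryLeft_apply_apply, Matrix.vecCons, h3] at h2
  simp only [schouten, AlternatingMap.smul_apply, ce_apply, smul_sub, Finset.sum_sub_distrib,
    smul_comm _ (2⁻¹ : k)]
  rw [← Finset.smul_sum, h2]
  simp only [smul_comm _ (2 : k), ← Finset.smul_sum]
  rw [smul_smul, smul_smul, show (2 : k) * (-1) ^ (n + 1 + 1) * 2⁻¹ = (-1) ^ (n + 1 + 1) by field_simp]
  simp only [fun i : Fin (n + 2) => Λ.skew (v i) (Q (i.removeNth v)), Algebra.smul_def, mul_neg,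
    Finset.sum_neg_distrib]
  push_cast
  ring

lemma schouten_mem [CharZero k] {n : ℕ} {Q : A [⋀^Fin (n + 1)]→ₗ[k] A}
    (hQ : Q ∈ skewDerivations k A (n + 1)) : Λ.schouten Q ∈ skewDerivations k A (n + 2) :=
  Submodule.smul_mem _ _ (Λ.ce_mem hQ)

lemma schouten_schouten [CharZero k] {n : ℕ} (Q : A [⋀^Fin n]→ₗ[k] A) :
    Λ.schouten (Λ.schouten Q) = 0 := by
  simp [schouten, ce_smul, ce_ce]

lemma schouten_add {n : ℕ} (P Q : A [⋀^Fin n]→ₗ[k] A) :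
    Λ.schouten (P + Q) = Λ.schouten P + Λ.schouten Q := by
  simp [schouten, ce_add]

lemma map_schouten {B : Type*} [CommRing B] [Algebra k B] (Λ' : PoissonBracket k B) (φ : A →ₐ[k] B)
    (h : ∀ x y, φ (Λ.bracket x y) = Λ'.bracket (φ x) (φ y)) {n : ℕ}
    (P : A [⋀^Fin n]→ₗ[k] A) (Q : B [⋀^Fin n]→ₗ[k] B)
    (hPQ : ∀ v, φ (P v) = Q (φ ∘ v)) (v : Fin (n + 1) → A) :
    φ (Λ.schouten P v) = Λ'.schouten Q (φ ∘ v) := by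
  have e : ∀ i : Fin (n + 1), φ ∘ i.removeNth v = i.removeNth (φ ∘ v) := fun i => rfl
  simp only [schouten, AlternatingMap.smul_apply, ce_apply, insertSum_apply, map_smul, map_sum,
    map_sub, map_zsmul, h, hPQ, Function.comp_update, e, Function.comp_apply]
  rfl

end PoissonBracket
end Algebra

section Geometry

/-- Constructor of alternating maps with the standard decidability instance on the index set. -/
def alternatingMapMk {R A B : Type*} [CommRing R] [AddCommGroup A] [Module R A] 
    [AddCommGroup B] [Module R B] {n : ℕ}
    (g : (Fin n → A) → B)
    (h1 : ∀ v i x y, g (Function.update v i (x + y)) =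
      g (Function.update v i x) + g (Function.update v i y))
    (h2 : ∀ v i (c : R) x, g (Function.update v i (c • x)) = c • g (Function.update v i x))
    (h3 : ∀ v i j, v i = v j → i ≠ j → g v = 0) : A [⋀^Fin n]→ₗ[R] B where
  toFun := g
  map_update_add' v i x y := by convert! h1 v i x y
  map_update_smul' v i c x := by convert! h2 v i c x
  map_eq_zero_of_eq' := h3

variable {R : Type u} [CommRing R] {X : Scheme.{u}}

/-- The ring `Γ(X, V)` of sections over `V` of an `R`-scheme `f : X ⟶ Spec R`, regarded as an
`R`-algebra. -/
def Sections (_f : X ⟶ Spec (.of R)) (V : X.Opens) : Type u := Γ(X, V)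

instance (f : X ⟶ Spec (.of R)) (V : X.Opens) : CommRing (Sections f V) :=
  inferInstanceAs (CommRing Γ(X, V))

instance (f : X ⟶ Spec (.of R)) (V : X.Opens) : Algebra R (Sections f V) :=
  RingHom.toAlgebra (R := R) (S := Γ(X, V))
    ((Scheme.ΓSpecIso (.of R)).inv ≫ f.appLE ⊤ V le_top).hom

/-- Restriction of sections. -/
def Sections.res (f : X ⟶ Spec (.of R)) {V W : X.Opens} (h : W ≤ V) :
    Sections f V →ₐ[R] Sections f W where
  __ := (X.presheaf.map (homOfLE h).op).hom
  commutes' r := by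
    have := f.appLE_map (U := ⊤) (V := V) le_top (homOfLE h).op
    exact congr(($this).hom ((Scheme.ΓSpecIso (.of R)).inv.hom r))

lemma Sections.res_apply (f : X ⟶ Spec (.of R)) {V W : X.Opens} (h : W ≤ V) (s : Sections f V) :
    Sections.res f h s = X.presheaf.map (homOfLE h).op s := rfl

lemma Sections.res_res (f : X ⟶ Spec (.of R)) {V W W' : X.Opens} (h : W ≤ V) (h' : W' ≤ W)
    (s : Sections f V) :
    Sections.res f h' (Sections.res f h s) = Sections.res f (h'.trans h) s := by
  have := X.presheaf.map_comp (homOfLE h).op (homOfLE h').op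
  exact congr(($this).hom s).symm

/-- A Poisson structure on the scheme `f : X ⟶ Spec R` over `R`: its structure sheaf is made into a
sheaf of Poisson `R`-algebras. -/
structure PoissonStructure (f : X ⟶ Spec (.of R)) where
  poisson : ∀ V : X.Opens, PoissonBracket R (Sections f V)
  res_bracket : ∀ {V W : X.Opens} (h : W ≤ V) (F G : Sections f V),
    Sections.res f h ((poisson V).bracket F G) =
      (poisson W).bracket (Sections.res f h F) (Sections.res f h G)

/-- The sections over `U` of the sheaf `⋀ⁿ T_{X/R} = ℋom(⋀ⁿ Ω_{X/R}, 𝒪_X)`: families of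
skew-symmetric `n`-derivations over `R` of the rings `Γ(X, V)`, for `V ⊆ U` open, that are
compatible with restriction. -/
def polyvectorFields (f : X ⟶ Spec (.of R)) (n : ℕ) (U : X.Opens) :
    AddSubgroup (∀ V : {V : X.Opens // V ≤ U}, (Sections f V.1) [⋀^Fin n]→ₗ[R] (Sections f V.1))
    where
  carrier := {P | (∀ V, P V ∈ skewDerivations R (Sections f V.1) n) ∧
    ∀ (V W : {V : X.Opens // V ≤ U}) (h : W.1 ≤ V.1) (v : Fin n → Sections f V.1),
      Sections.res f h (P V v) = P W (Sections.res f h ∘ v)}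
  zero_mem' := ⟨fun _ => Submodule.zero_mem _, fun _ _ _ _ => by simp⟩
  add_mem' hP hQ := ⟨fun V => Submodule.add_mem _ (hP.1 V) (hQ.1 V),
    fun V W h v => by simp [hP.2 V W h v, hQ.2 V W h v]⟩
  neg_mem' hP := ⟨fun V => Submodule.neg_mem _ (hP.1 V),
    fun V W h v => by simp [hP.2 V W h v]⟩

lemma polyvectorFields.res_apply {f : X ⟶ Spec (.of R)} {n : ℕ} {U V W : X.Opens}
    (P : polyvectorFields f n U) (hV : V ≤ U) (h : W ≤ V) (v : Fin n → Sections f V) :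
    Sections.res f h (P.1 ⟨V, hV⟩ v) = P.1 ⟨W, h.trans hV⟩ (Sections.res f h ∘ v) :=
  P.2.2 ⟨V, hV⟩ ⟨W, h.trans hV⟩ h v

/-- Restriction of polyvector fields to a smaller open subset. -/
def polyvectorFields.restrict (f : X ⟶ Spec (.of R)) (n : ℕ) {U U' : X.Opens} (h : U' ≤ U) :
    polyvectorFields f n U →+ polyvectorFields f n U' where
  toFun P := ⟨fun V => P.1 ⟨V.1, V.2.trans h⟩, fun V => P.2.1 ⟨V.1, V.2.trans h⟩,
    fun V W h' v => P.2.2 ⟨V.1, V.2.trans h⟩ ⟨W.1, W.2.trans h⟩ h' v⟩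
  map_zero' := rfl
  map_add' _ _ := rfl

/-- The presheaf `⋀ⁿ T_{X/R}`. -/
def polyvectorPresheaf (f : X ⟶ Spec (.of R)) (n : ℕ) : TopCat.Presheaf AddCommGrpCat.{u} X where
  obj U := AddCommGrpCat.of (polyvectorFields f n U.unop)
  map i := AddCommGrpCat.ofHom (polyvectorFields.restrict f n (leOfHom i.unop))
  map_id _ := rfl
  map_comp _ _ := by ext; rfl

lemma Sections.eq_of_locally_eq (f : X ⟶ Spec (.of R)) {ι : Type u} (U : ι → X.Opens)
    {V : X.Opens} (hV : V ≤ iSup U) {s t : Sections f V}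
    (h : ∀ i, Sections.res f (inf_le_left : V ⊓ U i ≤ V) s = Sections.res f inf_le_left t) :
    s = t :=
  X.sheaf.eq_of_locally_eq' (fun i => V ⊓ U i) V (fun _ => homOfLE inf_le_left)
    ((le_inf le_rfl hV).trans (inf_iSup_eq _ _).le) s t h

lemma Sections.exists_gluing (f : X ⟶ Spec (.of R)) {ι : Type u} (U : ι → X.Opens)
    {V : X.Opens} (hV : V ≤ iSup U) (s : ∀ i, Sections f (V ⊓ U i))
    (h : ∀ i j, Sections.res f (inf_le_left : (V ⊓ U i) ⊓ (V ⊓ U j) ≤ _) (s i) =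
      Sections.res f inf_le_right (s j)) :
    ∃ t : Sections f V, ∀ i, Sections.res f inf_le_left t = s i :=
  (X.sheaf.existsUnique_gluing' (fun i => V ⊓ U i) V (fun _ => homOfLE inf_le_left)
    ((le_inf le_rfl hV).trans (inf_iSup_eq _ _).le) s fun i j => h i j).exists

lemma polyvectorPresheaf_isSheaf (f : X ⟶ Spec (.of R)) (n : ℕ) :
    (polyvectorPresheaf f n).IsSheaf := by
  rw [TopCat.Presheaf.isSheaf_iff_isSheafUniqueGluing]
  intro ι U sf0 hsf
  let sf : ∀ i, polyvectorFields f n (U i) := sf0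
  have hcomp : ∀ (i j : ι) (W : X.Opens) (hi : W ≤ U i) (hj : W ≤ U j),
      (sf i).1 ⟨W, hi⟩ = (sf j).1 ⟨W, hj⟩ := by
    intro i j W hi hj
    exact congrFun (congrArg Subtype.val (hsf i j)) ⟨W, le_inf hi hj⟩
  have hex : ∀ (V : {V : X.Opens // V ≤ iSup U}) (v : Fin n → Sections f V.1),
      ∃ s : Sections f V.1, ∀ i, Sections.res f (inf_le_left : V.1 ⊓ U i ≤ V.1) s =
        (sf i).1 ⟨V.1 ⊓ U i, inf_le_right⟩ (Sections.res f inf_le_left ∘ v) := by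
    intro V v
    refine Sections.exists_gluing f U V.2 _ fun i j => ?_
    rw [polyvectorFields.res_apply, polyvectorFields.res_apply,
      hcomp i j _ (inf_le_left.trans inf_le_right) (inf_le_right.trans inf_le_right)]
    congr 1
    ext l
    simp only [Function.comp_apply, Sections.res_res]
  choose g hg using hex
  have hgu : ∀ (V : {V : X.Opens // V ≤ iSup U}) (v : Fin n → Sections f V.1)
      (s : Sections f V.1), (∀ i, Sections.res f (inf_le_left : V.1 ⊓ U i ≤ V.1) s =
        (sf i).1 ⟨V.1 ⊓ U i, inf_le_right⟩ (Sections.res f inf_le_left ∘ v)) → g V v = s :=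
    fun V v s hs => Sections.eq_of_locally_eq f U V.2 fun i => (hg V v i).trans (hs i).symm
  let G : ∀ V : {V : X.Opens // V ≤ iSup U}, (Sections f V.1) [⋀^Fin n]→ₗ[R] (Sections f V.1) :=
    fun V => alternatingMapMk (g V)
      (by
          intro v i x y
          refine hgu _ _ _ fun j => ?_
          rw [map_add, hg, hg]
          simp only [Function.comp_update]
          rw [map_add, AlternatingMap.map_update_add])
      (by
          intro v i c x
          refine hgu _ _ _ fun j => ?_
          rw [map_smul, hg]
          simp only [Function.comp_update]
          rw [map_smul, AlternatingMap.map_update_smul])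
      (by
          intro v i j hij hne
          refine hgu _ _ _ fun l => ?_
          rw [map_zero, AlternatingMap.map_eq_zero_of_eq _ _ (by simp [hij]) hne])
  have hG : ∀ V v, G V v = g V v := fun V v => rfl
  have hGmem : G ∈ polyvectorFields f n (iSup U) := by
    constructor
    · intro V v i x y
      refine hgu _ _ _ fun j => ?_
      rw [hG, hG, map_add, map_mul, map_mul, hg, hg]
      simp only [Function.comp_update]
      rw [map_mul, (sf j).2.1]
    · intro V W h v
      refine (hgu _ _ _ fun i => ?_).symm
      rw [hG, Sections.res_res, ← Sections.res_res f (inf_le_left : V.1 ⊓ U i ≤ V.1)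
        (inf_le_inf_right _ h), hg, polyvectorFields.res_apply]
      congr 1
      ext l
      simp only [Function.comp_apply, Sections.res_res]
  refine ⟨(⟨G, hGmem⟩ : polyvectorFields f n (iSup U)), ?_, ?_⟩
  · intro i
    refine Subtype.ext (funext fun V => AlternatingMap.ext fun v => ?_)
    refine hgu ⟨V.1, V.2.trans (le_iSup U i)⟩ v ((sf i).1 V v) fun j => ?_
    rw [polyvectorFields.res_apply, hcomp i j _ (inf_le_left.trans V.2) inf_le_right]
  · intro P0 hP
    let P : polyvectorFields f n (iSup U) := P0
    refine Subtype.ext (funext fun V => AlternatingMap.ext fun v => ?_)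
    refine (hgu V v (P.1 V v) fun i => ?_).symm
    rw [polyvectorFields.res_apply]
    have := congrFun (congrArg Subtype.val (hP i)) ⟨V.1 ⊓ U i, inf_le_right⟩
    exact congr($this _)

/-- The sheaf of abelian groups `⋀ⁿ T_{X/R}`. -/
def polyvectorSheaf (f : X ⟶ Spec (.of R)) (n : ℕ) : TopCat.Sheaf AddCommGrpCat.{u} X :=
  ⟨polyvectorPresheaf f n, polyvectorPresheaf_isSheaf f n⟩

section Lichnerowicz

variable {k : Type u} [Field k] [CharZero k] {f : X ⟶ Spec (.of k)} (Λ : PoissonStructure f)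

/-- The map `[Λ, -] : Γ(U, ⋀ⁿ⁺¹ T_X) → Γ(U, ⋀ⁿ⁺² T_X)`. -/
def polyvectorFields.schouten (n : ℕ) (U : X.Opens) :
    polyvectorFields f (n + 1) U →+ polyvectorFields f (n + 2) U where
  toFun P := ⟨fun V => (Λ.poisson V.1).schouten (P.1 V),
    fun V => (Λ.poisson V.1).schouten_mem (P.2.1 V),
    fun V W h v => (Λ.poisson V.1).map_schouten (Λ.poisson W.1) (Sections.res f h)
      (Λ.res_bracket h) (P.1 V) (P.1 W) (P.2.2 V W h) v⟩
  map_zero' := Subtype.ext <| funext fun V => by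
    simpa using (Λ.poisson V.1).schouten_add (0 : (Sections f V.1) [⋀^Fin (n + 1)]→ₗ[k] _) 0
  map_add' P Q := Subtype.ext <| funext fun V => (Λ.poisson V.1).schouten_add (P.1 V) (Q.1 V)

/-- The map of sheaves `[Λ, -] : ⋀ⁿ⁺¹ T_X → ⋀ⁿ⁺² T_X`. -/
def schoutenHom (n : ℕ) : polyvectorSheaf f (n + 1) ⟶ polyvectorSheaf f (n + 2) :=
  ⟨{ app := fun U => AddCommGrpCat.ofHom (polyvectorFields.schouten Λ n U.unop)
     naturality := fun _ _ _ => by ext; rfl }⟩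

/-- The shifted truncated Lichnerowicz-Poisson complex
`T_X → ⋀² T_X → ⋀³ T_X → ⋯` with differential `[Λ, -]` and with `T_X` in degree `0`. -/
def tangentComplex : CochainComplex (TopCat.Sheaf AddCommGrpCat.{u} X) ℕ :=
  CochainComplex.of (fun n => polyvectorSheaf f (n + 1)) (schoutenHom Λ) fun n => by
    refine Sheaf.hom_ext (NatTrans.ext (funext fun U => AddCommGrpCat.hom_ext ?_))
    refine AddMonoidHom.ext fun (P : polyvectorFields f (n + 1) U.unop) => ?_
    exact Subtype.ext <| funext fun V => (Λ.poisson V.1).schouten_schouten (P.1 V)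

end Lichnerowicz

end Geometry

/-- The hypercohomology `ℍⁿ(T, K) = Hom_{D(T)}(ℤ_T, K[n])` of a complex of sheaves of abelian groups
`K` in nonnegative degrees on a topological space `T`, where `D(T)` is the derived category of
sheaves of abelian groups on `T` and `ℤ_T` is the constant sheaf. -/
def Hypercohomology {T : TopCat.{u}} (K : CochainComplex (TopCat.Sheaf AddCommGrpCat.{u} T) ℕ)
    (n : ℕ) : Type (u + 1) :=
  letI := HasDerivedCategory.standard (TopCat.Sheaf AddCommGrpCat.{u} T)
  ShiftedHom
    ((DerivedCategory.singleFunctor (TopCat.Sheaf AddCommGrpCat.{u} T) 0).obj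
      ((constantSheaf (Opens.grothendieckTopology T) AddCommGrpCat.{u}).obj
        (AddCommGrpCat.of (ULift.{u} ℤ))))
    (DerivedCategory.Q.obj (K.extend ComplexShape.embeddingUpNat)) (n : ℤ)

instance {T : TopCat.{u}} (K : CochainComplex (TopCat.Sheaf AddCommGrpCat.{u} T) ℕ) (n : ℕ) :
    AddCommGroup (Hypercohomology K n) :=
  letI := HasDerivedCategory.standard (TopCat.Sheaf AddCommGrpCat.{u} T)
  inferInstanceAs (AddCommGroup (_ ⟶ _))

section Deformations

/-- Pullback of sections along a morphism. -/
def Sections.pullback {R S : Type u} [CommRing R] [CommRing S] {X Y : Scheme.{u}}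
    (f : X ⟶ Spec (.of R)) (g : Y ⟶ Spec (.of S)) (φ : X ⟶ Y) (V : Y.Opens) :
    Sections g V →+* Sections f (φ ⁻¹ᵁ V) :=
  (φ.app V).hom

/-- The morphism `φ : X ⟶ Y` is compatible with Poisson structures:
`φ^* {F, G} = {φ^* F, φ^* G}`. -/
def IsPoissonMorphism {R S : Type u} [CommRing R] [CommRing S] {X Y : Scheme.{u}}
    {f : X ⟶ Spec (.of R)} {g : Y ⟶ Spec (.of S)} (ΛX : PoissonStructure f)
    (ΛY : PoissonStructure g) (φ : X ⟶ Y) : Prop :=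
  ∀ (V : Y.Opens) (F G : Sections g V),
    Sections.pullback f g φ V ((ΛY.poisson V).bracket F G) =
      (ΛX.poisson (φ ⁻¹ᵁ V)).bracket (Sections.pullback f g φ V F) (Sections.pullback f g φ V G)

/-- `A` is a local Artinian `k`-algebra with residue field `k`. -/
class IsArtAlgebra (k A : Type u) [Field k] [CommRing A] [Algebra k A] : Prop extends
    IsLocalRing A, IsArtinianRing A where
  residue_bijective : Function.Bijective (algebraMap k (IsLocalRing.ResidueField A))

/-- The residue map `A → A / 𝔪 = k`. -/
def residueMap (k A : Type u) [Field k] [CommRing A] [Algebra k A] [IsArtAlgebra k A] : A →+* k :=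
  (RingEquiv.ofBijective (algebraMap k (IsLocalRing.ResidueField A))
    IsArtAlgebra.residue_bijective).symm.toRingHom.comp (IsLocalRing.residue A)

variable {k : Type u} [Field k] {X : Scheme.{u}} {f : X ⟶ Spec (.of k)}

/-- An infinitesimal Poisson deformation of `(X, Λ₀)` over `A`: a flat Poisson scheme
`(total, Λ)` over `Spec A` together with a cartesian square formed by `incl : X ⟶ total`,
`f : X ⟶ Spec k`, `π : total ⟶ Spec A` and the closed point `Spec k ⟶ Spec A`,
such that `Λ₀` is induced from `Λ`. -/
structure Deformation (Λ₀ : PoissonStructure f) (A : Type u) [CommRing A] [Algebra k A]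
    [IsArtAlgebra k A] where
  total : Scheme.{u}
  π : total ⟶ Spec (.of A)
  flat : Flat π
  Λ : PoissonStructure π
  incl : X ⟶ total
  isPullback : IsPullback incl f π (Spec.map (CommRingCat.ofHom (residueMap k A)))
  isPoissonMorphism : IsPoissonMorphism Λ₀ Λ incl

namespace Deformation

variable {Λ₀ : PoissonStructure f} {A : Type u} [CommRing A] [Algebra k A] [IsArtAlgebra k A]

/-- Two deformations are isomorphic if there is a Poisson isomorphism between them over `Spec A`
that induces the identity of `X`. -/
def Isomorphic (ξ η : Deformation Λ₀ A) : Prop :=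
  ∃ e : ξ.total ≅ η.total, e.hom ≫ η.π = ξ.π ∧ ξ.incl ≫ e.hom = η.incl ∧
    IsPoissonMorphism ξ.Λ η.Λ e.hom

/-- The deformation is the product `(X ×_{Spec k} Spec A, Λ₀)`: its total space is the fibre
product with projections `r` and `π`, the inclusion of `X` is the canonical section, and `Λ` is the
`A`-bilinear extension of `Λ₀`, i.e. the (unique) Poisson structure over `A` for which the
projection `r` to `X` is a Poisson morphism. -/
def IsProduct (η : Deformation Λ₀ A) : Prop :=
  ∃ r : η.total ⟶ X,
    IsPullback r η.π f (Spec.map (CommRingCat.ofHom (algebraMap k A))) ∧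
      η.incl ≫ r = 𝟙 X ∧ IsPoissonMorphism η.Λ Λ₀ r

/-- A deformation is trivial if it is isomorphic to the product `(X ×_{Spec k} Spec A, Λ₀)`. -/
def IsTrivial (ξ : Deformation Λ₀ A) : Prop :=
  ∃ η : Deformation Λ₀ A, η.IsProduct ∧ ξ.Isomorphic η

end Deformation

/-- `(X, Λ₀)` is rigid if every infinitesimal Poisson deformation of it, over every local Artinian
`k`-algebra with residue field `k`, is trivial. -/
def IsRigid (Λ₀ : PoissonStructure f) : Prop :=
  ∀ (A : Type u) [CommRing A] [Algebra k A] [IsArtAlgebra k A] (ξ : Deformation Λ₀ A), ξ.IsTrivial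

end Deformations
end PoissonDeformation
end

-- Both implications go through Čech hypercocycles of degree one for T → ∧²T → ∧³T: vector fields
-- D_ij on overlaps and bivectors P_i with [Λ₀, P_i] = 0, [Λ₀, D_ij] = P_i - P_j and D_ij + D_jl =
-- D_il. The vanishing of ℍ¹ makes all of them bound, on every open cover
-- (`Hypercocycle.isBoundary_of_subsingleton`), and conversely it follows once they bound on covers
-- by members of a basis (`subsingleton_hypercohomology_one`). For this the complex is compared with
-- a bounded below injective resolution J: ℍ¹ is the first cohomology of the global sections of J,
-- and the exactness of the mapping cone, read on sections, moves classes between J and Čech data.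
--
-- Vanishing implies rigidity. A deformation over A has the same underlying space as X, and on an
-- affine open set it is a flat A-algebra B with B/𝔪B = R. What is wanted is a compatible family of
-- Poisson algebra sections R → B. Take a minimal ideal I ≤ 𝔪 for which such sections R → B/IB
-- exist. If I ≠ 0, choose J < I with I/J of length one; by flatness the kernel of B/JB → B/IB is a
-- copy of R. Sections lift locally because X is smooth. Two lifts differ by a derivation, the
-- failure of a lift to be Poisson is a bivector, and these data form a hypercocycle, whose
-- primitive corrects the lifts (`exists_lift_of_isSmallExtension`, `exists_poisson_sections`). So I
-- = 0. The sections then glue to a retraction of the total space onto X, and flatness makes it the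
-- projection of a product: a k-basis of R is carried to an A-basis of B
-- (`bijective_lift_of_section`).
--
-- Rigidity implies vanishing. A hypercocycle is a recipe for a deformation over k[ε]: the charts
-- are (𝒪[ε], Λ₀ + ε P_i), glued along 1 + ε D_ij. `exists_deformation` performs the gluing, and a
-- trivialisation has the form 1 + ε E on each chart, where E bounds the hypercocycle up to sign and
-- change of index (`IsRigid.exists_primitive`, `IsRigid.isBoundary`).
--
-- Overlaps of affine open sets are never required to be affine: a polyvector field on an overlap is
-- given by compatible multiderivations on the members of an affine basis contained in it.

universe w v

open CategoryTheory Opposite TopologicalSpace AlgebraicGeometry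

noncomputable section

namespace PoissonDeformation

/-! ### Sections of sheaves of abelian groups -/

section SheafSections

variable {T : TopCat.{u}}

/-- Sections over `U` of a sheaf of abelian groups. -/
abbrev Sec (F : TopCat.Sheaf AddCommGrpCat.{u} T) (U : Opens T) : Type u := F.obj.obj (op U)

/-- Restriction of sections to a smaller open subset. -/
def secRes (F : TopCat.Sheaf AddCommGrpCat.{u} T) {U V : Opens T} (h : V ≤ U) :
    Sec F U →+ Sec F V :=
  (F.obj.map (homOfLE h).op).hom

/-- The map on sections induced by a morphism of sheaves. -/
def secMap {F G : TopCat.Sheaf AddCommGrpCat.{u} T} (φ : F ⟶ G) (U : Opens T) :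
    Sec F U →+ Sec G U :=
  (φ.hom.app (op U)).hom

variable {F G H : TopCat.Sheaf AddCommGrpCat.{u} T}

lemma secRes_secRes {U V W : Opens T} (h : V ≤ U) (h' : W ≤ V) (s : Sec F U) :
    secRes F h' (secRes F h s) = secRes F (h'.trans h) s := by
  have := F.obj.map_comp (homOfLE h).op (homOfLE h').op
  exact congr(($this).hom s).symm

lemma secRes_self {U : Opens T} (h : U ≤ U) (s : Sec F U) : secRes F h s = s := by
  have := F.obj.map_id (op U)
  exact congr(($this).hom s)

lemma secMap_secRes (φ : F ⟶ G) {U V : Opens T} (h : V ≤ U) (s : Sec F U) :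
    secMap φ V (secRes F h s) = secRes G h (secMap φ U s) := by
  have := φ.hom.naturality (homOfLE h).op
  exact congr(($this).hom s)

lemma secMap_comp (φ : F ⟶ G) (ψ : G ⟶ H) (U : Opens T) (s : Sec F U) :
    secMap (φ ≫ ψ) U s = secMap ψ U (secMap φ U s) := rfl

lemma secMap_id (U : Opens T) (s : Sec F U) : secMap (𝟙 F) U s = s := rfl

lemma secMap_add (φ ψ : F ⟶ G) (U : Opens T) (s : Sec F U) :
    secMap (φ + ψ) U s = secMap φ U s + secMap ψ U s := rfl

lemma secMap_sub (φ ψ : F ⟶ G) (U : Opens T) (s : Sec F U) :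
    secMap (φ - ψ) U s = secMap φ U s - secMap ψ U s := by
  have := secMap_add (φ - ψ) ψ U s
  rw [sub_add_cancel] at this
  rw [this, add_sub_cancel_right]

lemma secMap_zero (U : Opens T) (s : Sec F U) : secMap (0 : F ⟶ G) U s = 0 := rfl

lemma sec_ext {ι : Type u} (U : ι → Opens T) {V : Opens T} (hU : ∀ i, U i ≤ V)
    (hV : V ≤ iSup U) {s t : Sec F V} (h : ∀ i, secRes F (hU i) s = secRes F (hU i) t) : s = t :=
  F.eq_of_locally_eq' U V (fun i => homOfLE (hU i)) hV s t h

lemma sec_glue {ι : Type u} (U : ι → Opens T) {V : Opens T} (hU : ∀ i, U i ≤ V)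
    (hV : V ≤ iSup U) (s : ∀ i, Sec F (U i))
    (h : ∀ i j, secRes F (inf_le_left : U i ⊓ U j ≤ U i) (s i) =
      secRes F (inf_le_right : U i ⊓ U j ≤ U j) (s j)) :
    ∃ t : Sec F V, ∀ i, secRes F (hU i) t = s i :=
  (F.existsUnique_gluing' U V (fun i => homOfLE (hU i)) hV s fun i j => h i j).exists

/-- Exactness makes the map from `S.X₁` to the kernel of `S.g` an epimorphism of sheaves, hence
locally surjective, while sections of the kernel sheaf are exactly the sections killed by `S.g`. -/
lemma sec_exists_local_lift {S : ShortComplex (TopCat.Sheaf AddCommGrpCat.{u} T)} (hS : S.Exact)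
    {U : Opens T} (s : Sec S.X₂ U) (hs : secMap S.g U s = 0) (x : T) (hx : x ∈ U) :
    ∃ (V : Opens T) (h : V ≤ U) (t : Sec S.X₁ V), x ∈ V ∧ secMap S.f V t = secRes S.X₂ h s := by
  obtain ⟨t, ht⟩ := TopCat.Sheaf.sections_exact_of_left_exact (U := U)
    (S := ShortComplex.mk (Limits.kernel.ι S.g) S.g (by simp))
    (ShortComplex.exact_of_f_is_kernel _ (Limits.kernelIsKernel S.g))
    (by dsimp; infer_instance) s hs
  have hepi := (ShortComplex.exact_iff_epi_kernel_lift S).1 hS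
  have := (TopCat.Sheaf.isLocallySurjective_iff_epi
    (Limits.kernel.lift S.g S.f S.zero)).mpr hepi
  obtain ⟨V, hV, ⟨t', ht'⟩, hxV⟩ := (TopCat.Presheaf.isLocallySurjective_iff _).mp this U t x hx
  refine ⟨V, hV, t', hxV, ?_⟩
  have e : S.f = Limits.kernel.lift S.g S.f S.zero ≫ Limits.kernel.ι S.g := by simp
  rw [e, secMap_comp]
  refine (congrArg (secMap (Limits.kernel.ι S.g) V) ht').trans ?_
  refine (secMap_secRes (Limits.kernel.ι S.g) hV t).trans ?_
  exact congrArg _ ht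

lemma sec_exists_lift {S : ShortComplex (TopCat.Sheaf AddCommGrpCat.{u} T)} (hS : S.Exact)
    (hf : Mono S.f) {U : Opens T} (s : Sec S.X₂ U) (hs : secMap S.g U s = 0) :
    ∃ t : Sec S.X₁ U, secMap S.f U t = s :=
  TopCat.Sheaf.sections_exact_of_left_exact hS hf s hs

lemma mono_of_secMap_injective (φ : F ⟶ G) (h : ∀ U, Function.Injective (secMap φ U)) :
    Mono φ := by
  have : Mono ((sheafToPresheaf _ _).map φ) := by
    rw [NatTrans.mono_iff_mono_app]
    intro U
    exact (AddCommGrpCat.mono_iff_injective _).2 (h U.unop)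
  exact (sheafToPresheaf _ _).mono_of_mono_map this

end SheafSections

/-! ### Čech 1-cocycles in an injective sheaf -/

section CechSheaf

variable {T : TopCat.{u}} (F : TopCat.Sheaf AddCommGrpCat.{u} T) {ι : Type u} (U : ι → Opens T)

/-- The presheaf `V ↦ ∏ᵢ F (V ∩ Uᵢ)`. -/
def cechPresheaf : TopCat.Presheaf AddCommGrpCat.{u} T where
  obj V := AddCommGrpCat.of (∀ i, Sec F (V.unop ⊓ U i))
  map f := AddCommGrpCat.ofHom
    { toFun s i := secRes F (inf_le_inf_right _ (leOfHom f.unop)) (s i)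
      map_zero' := by ext; simp
      map_add' _ _ := by ext; simp }
  map_id V := by
    ext s i; exact secRes_self _ (s i)
  map_comp f g := by
    ext s i; exact (secRes_secRes _ _ (s i)).symm

lemma cechPresheaf_isSheaf : (cechPresheaf F U).IsSheaf := by
  rw [TopCat.Presheaf.isSheaf_iff_isSheafUniqueGluing]
  intro κ V sf0 hsf
  let sf : ∀ a i, Sec F (V a ⊓ U i) := sf0
  have hc : ∀ a b i, secRes F (inf_le_inf_right _ inf_le_left : V a ⊓ V b ⊓ U i ≤ V a ⊓ U i)
      (sf a i) = secRes F (inf_le_inf_right _ inf_le_right) (sf b i) :=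
    fun a b i => congrFun (hsf a b) i
  have hcov : ∀ i, iSup V ⊓ U i ≤ ⨆ a, V a ⊓ U i := fun i => by rw [iSup_inf_eq]
  have hex : ∀ i, ∃ t : Sec F (iSup V ⊓ U i), ∀ a,
      secRes F (inf_le_inf_right _ (le_iSup V a)) t = sf a i := fun i => by
    refine sec_glue (fun a => V a ⊓ U i) _ (hcov i) _ fun a b => ?_
    have := congrArg (secRes F (show (V a ⊓ U i) ⊓ (V b ⊓ U i) ≤ V a ⊓ V b ⊓ U i from
      le_inf (inf_le_inf inf_le_left inf_le_left) (inf_le_left.trans inf_le_right))) (hc a b i)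
    simpa only [secRes_secRes] using this
  choose t ht using hex
  refine ⟨t, fun a => funext fun i => ht i a, fun t' ht' => funext fun i => ?_⟩
  refine sec_ext (fun a => V a ⊓ U i) (fun a => inf_le_inf_right _ (le_iSup V a)) (hcov i)
    fun a => ?_
  exact (congrFun (ht' a) i).trans (ht i a).symm

/-- The sheaf `V ↦ ∏ᵢ F (V ∩ Uᵢ)`. -/
def cechSheaf : TopCat.Sheaf AddCommGrpCat.{u} T := ⟨cechPresheaf F U, cechPresheaf_isSheaf F U⟩

/-- The restriction map from `F` to the sheaf `V ↦ ∏ᵢ F (V ∩ Uᵢ)`. -/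
def toCechSheaf : F ⟶ cechSheaf F U :=
  ⟨{ app V := AddCommGrpCat.ofHom
      { toFun s i := secRes F inf_le_left s
        map_zero' := by ext; simp
        map_add' _ _ := by ext; simp }
     naturality V W f := by
      ext s; funext i
      exact (secRes_secRes _ _ s).trans (secRes_secRes _ _ s).symm }⟩

lemma mono_toCechSheaf (hU : iSup U = ⊤) : Mono (toCechSheaf F U) := by
  refine mono_of_secMap_injective _ fun V s t h => ?_
  refine sec_ext (fun i => V ⊓ U i) (fun i => inf_le_left) ?_ fun i => congrFun h i
  rw [← inf_iSup_eq, hU, inf_top_eq]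

/-- Čech 1-cocycles with values in an injective sheaf are coboundaries. -/
lemma exists_sub_eq_of_injective [Injective F] (hU : iSup U = ⊤)
    (D : ∀ i j, Sec F (U i ⊓ U j))
    (hD : ∀ i j l (W : Opens T) (hi : W ≤ U i) (hj : W ≤ U j) (hl : W ≤ U l),
      secRes F (le_inf hi hj) (D i j) + secRes F (le_inf hj hl) (D j l) =
        secRes F (le_inf hi hl) (D i l)) :
    ∃ y : ∀ i, Sec F (U i), ∀ i j, secRes F inf_le_left (y i) - secRes F inf_le_right (y j) =
      D i j := by
  have := mono_toCechSheaf F U hU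
  -- Injectivity splits the embedding of `F` into its Čech sheaf. The family `(D i j)_j` is a
  -- section of the Čech sheaf over `U i`; by the cocycle identity two such families differ on an
  -- overlap by the image of `D i j`, so their images under the splitting bound `D`.
  let r := Injective.factorThru (𝟙 F) (toCechSheaf F U)
  have hr : toCechSheaf F U ≫ r = 𝟙 F := Injective.comp_factorThru _ _
  let c : ∀ i, Sec (cechSheaf F U) (U i) := fun i j => D i j
  refine ⟨fun i => secMap r (U i) (c i), fun i j => ?_⟩
  rw [← secMap_secRes, ← secMap_secRes, ← map_sub]
  have e : secRes (cechSheaf F U) inf_le_left (c i) - secRes (cechSheaf F U) inf_le_right (c j) =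
      secMap (toCechSheaf F U) (U i ⊓ U j) (D i j) := by
    refine funext fun l => ?_
    have h := hD i j l (U i ⊓ U j ⊓ U l) (inf_le_left.trans inf_le_left)
      (inf_le_left.trans inf_le_right) inf_le_right
    exact sub_eq_of_eq_add (h.symm)
  rw [e, ← secMap_comp, hr, secMap_id]

end CechSheaf

/-! ### Čech hypercocycles and resolutions on sections -/

section Hypercocycle

variable {T : TopCat.{u}} {F₀ F₁ F₂ : TopCat.Sheaf AddCommGrpCat.{u} T}

/-- Čech hypercocycles of degree `1` of the complex `F₀ → F₁ → F₂` for a cover `U`. -/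
structure Hypercocycle (d₀ : F₀ ⟶ F₁) (d₁ : F₁ ⟶ F₂) {ι : Type u} (U : ι → Opens T) where
  D : ∀ i j, Sec F₀ (U i ⊓ U j)
  P : ∀ i, Sec F₁ (U i)
  closed : ∀ i, secMap d₁ _ (P i) = 0
  compat : ∀ i j, secMap d₀ _ (D i j) = secRes F₁ inf_le_left (P i) - secRes F₁ inf_le_right (P j)
  cocycle : ∀ i j l (W : Opens T) (hi : W ≤ U i) (hj : W ≤ U j) (hl : W ≤ U l),
    secRes F₀ (le_inf hi hj) (D i j) + secRes F₀ (le_inf hj hl) (D j l) =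
      secRes F₀ (le_inf hi hl) (D i l)

/-- The hypercocycle is the differential of a Čech hypercochain of degree `0`. -/
def Hypercocycle.IsBoundary {d₀ : F₀ ⟶ F₁} {d₁ : F₁ ⟶ F₂} {ι : Type u} {U : ι → Opens T}
    (c : Hypercocycle d₀ d₁ U) : Prop :=
  ∃ E : ∀ i, Sec F₀ (U i), (∀ i, secMap d₀ _ (E i) = c.P i) ∧
    ∀ i j, secRes F₀ inf_le_left (E i) - secRes F₀ inf_le_right (E j) = c.D i j

variable {J₀ J₁ J₂ : TopCat.Sheaf AddCommGrpCat.{u} T}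

/-- The properties in degrees `0` and `1`, on the level of sections, of a quasi-isomorphism
`a : F → J` of complexes of sheaves in nonnegative degrees. -/
structure IsResolutionOnSections (d₀ : F₀ ⟶ F₁) (d₁ : F₁ ⟶ F₂) (δ₀ : J₀ ⟶ J₁) (δ₁ : J₁ ⟶ J₂)
    (a₀ : F₀ ⟶ J₀) (a₁ : F₁ ⟶ J₁) (a₂ : F₂ ⟶ J₂) : Prop where
  d_d : d₀ ≫ d₁ = 0
  δ_δ : δ₀ ≫ δ₁ = 0
  comm₀ : d₀ ≫ a₁ = a₀ ≫ δ₀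
  comm₁ : d₁ ≫ a₂ = a₁ ≫ δ₁
  inj : ∀ U (z : Sec F₀ U), secMap d₀ U z = 0 → secMap a₀ U z = 0 → z = 0
  lift : ∀ U (x : Sec F₁ U) (y : Sec J₀ U), secMap d₁ U x = 0 → secMap a₁ U x = secMap δ₀ U y →
    ∃ z, secMap d₀ U z = x ∧ secMap a₀ U z = y
  local_lift : ∀ U (f : Sec J₁ U), secMap δ₁ U f = 0 → ∀ p ∈ U, ∃ (V : Opens T) (h : V ≤ U)
    (x : Sec F₁ V) (y : Sec J₀ V), p ∈ V ∧ secMap d₁ V x = 0 ∧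
      secRes J₁ h f = secMap a₁ V x + secMap δ₀ V y

namespace IsResolutionOnSections

variable {d₀ : F₀ ⟶ F₁} {d₁ : F₁ ⟶ F₂} {δ₀ : J₀ ⟶ J₁} {δ₁ : J₁ ⟶ J₂}
    {a₀ : F₀ ⟶ J₀} {a₁ : F₁ ⟶ J₁} {a₂ : F₂ ⟶ J₂}
    (h : IsResolutionOnSections d₀ d₁ δ₀ δ₁ a₀ a₁ a₂)

include h

/-- Bound the image of `D` in the injective sheaf `J₀` by a cochain `y`. The sections `a₁ P - δ₀ y`
then agree on overlaps and glue to a closed global section of `J₁`, which is `δ₀ y'` by assumption.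
The pair `(P, y + y')` now comes from `F₀`, and that lift is the primitive. -/
lemma isBoundary [Injective J₀]
    (hJ : ∀ f : Sec J₁ ⊤, secMap δ₁ ⊤ f = 0 → ∃ y, secMap δ₀ ⊤ y = f)
    {ι : Type u} {U : ι → Opens T} (hU : iSup U = ⊤) (c : Hypercocycle d₀ d₁ U) :
    c.IsBoundary := by
  obtain ⟨y, hy⟩ := exists_sub_eq_of_injective J₀ U hU (fun i j => secMap a₀ _ (c.D i j)) (by
    intro i j l W hi hj hl
    rw [← secMap_secRes, ← secMap_secRes, ← secMap_secRes, ← map_add, c.cocycle i j l W hi hj hl])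
  obtain ⟨f, hf⟩ := sec_glue (F := J₁) U (fun _ => le_top) hU.ge
    (fun i => secMap a₁ _ (c.P i) - secMap δ₀ _ (y i)) (by
      intro i j
      rw [map_sub, map_sub, sub_eq_sub_iff_sub_eq_sub, ← secMap_secRes, ← secMap_secRes,
        ← secMap_secRes, ← secMap_secRes, ← map_sub, ← map_sub, hy, ← c.compat, ← secMap_comp,
        ← secMap_comp, h.comm₀])
  obtain ⟨y', hy'⟩ := hJ f (by
    refine sec_ext U (fun _ => le_top) hU.ge fun i => ?_
    rw [← secMap_secRes, hf, map_sub, map_zero, ← secMap_comp, ← secMap_comp, ← h.comm₁, h.δ_δ,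
      secMap_comp, c.closed, map_zero, secMap_zero, sub_zero])
  have hz := fun i => h.lift (U i) (c.P i) (y i + secRes J₀ le_top y') (c.closed i) (by
    rw [map_add, secMap_secRes, hy', hf]; abel)
  choose E hE hE' using hz
  refine ⟨E, hE, fun i j => ?_⟩
  rw [← sub_eq_zero]
  refine h.inj _ _ ?_ ?_
  · rw [map_sub, map_sub, secMap_secRes, secMap_secRes, hE, hE, c.compat, sub_self]
  · rw [map_sub, map_sub, secMap_secRes, secMap_secRes, hE', hE', ← hy, map_add, map_add,
      secRes_secRes, secRes_secRes]
    abel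

/-- A closed section `f` of `J₁` is locally `a₁ x + δ₀ y` with `x` closed. On overlaps the ambiguity
of this presentation comes from a unique section of `F₀`, so the `x` extend to a hypercocycle. A
primitive `E` of it makes the sections `y + a₀ E` glue, and the result is a global primitive of `f`.
-/
lemma exists_eq (B : Set (Opens T)) (hB : Opens.IsBasis B)
    (hc : ∀ {ι : Type u} (U : ι → Opens T), (∀ i, U i ∈ B) → iSup U = ⊤ →
      ∀ c : Hypercocycle d₀ d₁ U, c.IsBoundary)
    (f : Sec J₁ ⊤) (hf : secMap δ₁ ⊤ f = 0) : ∃ y, secMap δ₀ ⊤ y = f := by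
  have hloc : ∀ p : T, ∃ (V : Opens T) (x : Sec F₁ V) (y : Sec J₀ V), p ∈ V ∧ V ∈ B ∧
      secMap d₁ V x = 0 ∧ secRes J₁ le_top f = secMap a₁ V x + secMap δ₀ V y := by
    intro p
    obtain ⟨V, hV, x, y, hp, hx, e⟩ := h.local_lift ⊤ f hf p trivial
    obtain ⟨V', hV', hp', hle⟩ := Opens.isBasis_iff_nbhd.1 hB hp
    refine ⟨V', secRes _ hle x, secRes _ hle y, hp', hV', ?_, ?_⟩
    · rw [secMap_secRes, hx, map_zero]
    · rw [secMap_secRes, secMap_secRes, ← map_add, ← e, secRes_secRes]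
  choose U x y hp hUB hx hxy using hloc
  have hU : iSup U = ⊤ := top_le_iff.1 fun p _ => Opens.mem_iSup.2 ⟨p, hp p⟩
  have hz : ∀ i j, ∃ z, secMap d₀ (U i ⊓ U j) z =
      secRes _ inf_le_left (x i) - secRes _ inf_le_right (x j) ∧ secMap a₀ (U i ⊓ U j) z =
      secRes _ inf_le_right (y j) - secRes _ inf_le_left (y i) := fun i j => by
    refine h.lift _ _ _ ?_ ?_
    · rw [map_sub, secMap_secRes, secMap_secRes, hx, hx, map_zero, map_zero, sub_zero]
    · rw [map_sub, map_sub, secMap_secRes, secMap_secRes, secMap_secRes, secMap_secRes,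
        sub_eq_sub_iff_add_eq_add, ← map_add, add_comm (secRes J₁ _ _), ← map_add, ← hxy, ← hxy,
        secRes_secRes, secRes_secRes]
  choose D hD hD' using hz
  -- A section of `F₀` is determined by its images in `F₁` and `J₀`; this proves the cocycle
  -- identity for `D`.
  have hzero : ∀ {V : Opens T} {z z' : Sec F₀ V}, secMap d₀ V z = secMap d₀ V z' →
      secMap a₀ V z = secMap a₀ V z' → z = z' := fun h₁ h₂ =>
    sub_eq_zero.1 (h.inj _ _ (by rw [map_sub, h₁, sub_self]) (by rw [map_sub, h₂, sub_self]))
  obtain ⟨E, hE, hE'⟩ := hc U hUB hU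
    { D := D
      P := x
      closed := hx
      compat := hD
      cocycle := fun i j l W hi hj hl => by
        refine hzero ?_ ?_ <;>
        simp only [map_add, secMap_secRes, hD, hD', map_sub, secRes_secRes] <;> abel }
  obtain ⟨t, ht⟩ := sec_glue (F := J₀) U (fun _ => le_top) hU.ge
    (fun i => y i + secMap a₀ _ (E i)) (by
      intro i j
      have := congrArg (secMap a₀ _) (hE' i j)
      simp only [hD', map_sub, secMap_secRes] at this
      rw [map_add, map_add, ← sub_eq_zero]
      rw [← sub_eq_zero] at this
      rw [← this]; abel)
  refine ⟨t, sec_ext U (fun _ => le_top) hU.ge fun i => ?_⟩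
  rw [← secMap_secRes, ht, hxy, map_add, ← secMap_comp, ← h.comm₀, secMap_comp, hE, add_comm]

end IsResolutionOnSections

end Hypercocycle

/-! ### Morphisms to a K-injective complex in the derived category -/

section Derived

open CochainComplex HomComplex

/-- Replace `K` by `J`. Morphisms in the derived category into a K-injective complex are homotopy
classes of morphisms, i.e. degree-one cohomology classes of the Hom complex. Out of a complex
concentrated in degree zero, a cochain of degree n is a single map to `J.X n`. -/
lemma subsingleton_shiftedHom_iff {C : Type w} [Category.{v} C] [Abelian C] [HasDerivedCategory C]
    (S : C) {K J : CochainComplex C ℤ} (i : K ⟶ J) [QuasiIso i] [J.IsKInjective] :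
    Subsingleton (ShiftedHom ((DerivedCategory.singleFunctor C 0).obj S) (DerivedCategory.Q.obj K)
      ((1 : ℕ) : ℤ)) ↔
      ∀ f : S ⟶ J.X 1, f ≫ J.d 1 2 = 0 → ∃ y : S ⟶ J.X 0, y ≫ J.d 0 1 = f := by
  have e : (ShiftedHom ((DerivedCategory.singleFunctor C 0).obj S) (DerivedCategory.Q.obj K)
      ((1 : ℕ) : ℤ)) ≃ CohomologyClass ((CochainComplex.singleFunctor C 0).obj S) J 1 :=
    (Iso.homCongr ((DerivedCategory.singleFunctorIsoCompQ C 0).app S ≪≫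
        (DerivedCategory.quotientCompQhIso C).symm.app _)
      ((CategoryTheory.shiftFunctor _ (1 : ℤ)).mapIso (asIso (DerivedCategory.Q.map i)) ≪≫
        (DerivedCategory.Q.commShiftIso (1 : ℤ)).symm.app J ≪≫
        (DerivedCategory.quotientCompQhIso C).symm.app _)).trans
    ((Equiv.ofBijective _ (CochainComplex.IsKInjective.Qh_map_bijective _ _)).symm.trans
    (Equiv.ofBijective _ (CohomologyClass.toHom_bijective
      ((CochainComplex.singleFunctor C 0).obj S) J 1)).symm)
  rw [e.subsingleton_congr]
  constructor
  · intro h f hf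
    have := Subsingleton.elim (CohomologyClass.mk
      (Cocycle.fromSingleMk (p := 0) (n := 1) f (zero_add 1) 2 rfl hf)) 0
    rw [CohomologyClass.mk_eq_zero_iff, mem_coboundaries_iff _ 0 (zero_add 1)] at this
    obtain ⟨β, hβ⟩ := this
    obtain ⟨y, rfl⟩ := Cochain.fromSingleMk_surjective β 0 (zero_add 0)
    refine ⟨y, ?_⟩
    rw [Cochain.δ_fromSingleMk y (zero_add 0) 1 1 (zero_add 1)] at hβ
    exact (Cochain.fromSingleEquiv (zero_add 1)).symm.injective hβ
  · intro h
    refine subsingleton_of_forall_eq 0 fun x => ?_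
    obtain ⟨x, rfl⟩ := x.mk_surjective
    obtain ⟨f, hfx⟩ := Cochain.fromSingleMk_surjective x.1 1 (zero_add 1)
    have hx' := (Cocycle.mem_iff 1 2 rfl _).1 x.2
    rw [← hfx, Cochain.δ_fromSingleMk f (zero_add 1) 2 2 (zero_add 2)] at hx'
    obtain ⟨y, rfl⟩ := h f ((Cochain.fromSingleEquiv (zero_add 2)).symm.injective
      (hx'.trans (map_zero (Cochain.fromSingleEquiv (zero_add 2)).symm).symm))
    rw [CohomologyClass.mk_eq_zero_iff, mem_coboundaries_iff _ 0 (zero_add 1)]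
    exact ⟨Cochain.fromSingleMk y (zero_add 0),
      (Cochain.δ_fromSingleMk y (zero_add 0) 1 1 (zero_add 1)).trans hfx⟩

end Derived

/-! ### Hypercohomology versus Čech hypercocycles -/

section Resolution

open CochainComplex HomComplex mappingCone

variable {T : TopCat.{u}}

variable (T) in
/-- The constant sheaf `ℤ`. -/
def integerSheaf : TopCat.Sheaf AddCommGrpCat.{u} T :=
  (constantSheaf (Opens.grothendieckTopology T) AddCommGrpCat.{u}).obj
    (AddCommGrpCat.of (ULift.{u} ℤ))

/-- Morphisms out of the constant sheaf `ℤ` are global sections. -/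
def homIntegerSheafEquiv (F : TopCat.Sheaf AddCommGrpCat.{u} T) :
    (integerSheaf T ⟶ F) ≃ Sec F ⊤ :=
  ((constantSheafAdj (Opens.grothendieckTopology T) AddCommGrpCat.{u}
    (T := (⊤ : Opens T)) Limits.isTerminalTop).homEquiv _ F).trans
  ((ConcreteCategory.homEquiv.trans (uliftZMultiplesHom _).symm))

lemma homIntegerSheafEquiv_comp {F G : TopCat.Sheaf AddCommGrpCat.{u} T} (f : integerSheaf T ⟶ F)
    (φ : F ⟶ G) : homIntegerSheafEquiv G (f ≫ φ) = secMap φ ⊤ (homIntegerSheafEquiv F f) := by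
  have := (constantSheafAdj (Opens.grothendieckTopology T) AddCommGrpCat.{u}
    (T := (⊤ : Opens T)) Limits.isTerminalTop).homEquiv_naturality_right f φ
  exact congrArg (ConcreteCategory.homEquiv.trans (uliftZMultiplesHom (Sec G ⊤)).symm) this

lemma homIntegerSheafEquiv_zero (F : TopCat.Sheaf AddCommGrpCat.{u} T) :
    homIntegerSheafEquiv F 0 = 0 := by
  have := homIntegerSheafEquiv_comp (0 : integerSheaf T ⟶ F) (0 : F ⟶ F)
  rwa [Limits.comp_zero, secMap_zero] at this

/-- In the homotopy category the quasi-isomorphisms are the morphisms whose cone lies in the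
triangulated subcategory of acyclic complexes. -/
lemma acyclic_mappingCone {C : Type w} [Category.{v} C] [Abelian C] {K L : CochainComplex C ℤ}
    (i : K ⟶ L) [QuasiIso i] : (mappingCone i).Acyclic := by
  have h : HomotopyCategory.quasiIso C (.up ℤ) ((HomotopyCategory.quotient _ _).map i) := by
    rw [HomotopyCategory.quotient_map_mem_quasiIso_iff, HomologicalComplex.mem_quasiIso_iff]
    infer_instance
  rw [HomotopyCategory.quasiIso_eq_trW_subcategoryAcyclic] at h
  exact (HomotopyCategory.quotient_obj_mem_subcategoryAcyclic_iff_acyclic _).1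
    ((ObjectProperty.trW_iff_of_distinguished _ _
      (HomotopyCategory.mappingCone_triangleh_distinguished i)).1 h)

lemma secMap_biprod_d {A A' B B' C C' : TopCat.Sheaf AddCommGrpCat.{u} T} {inl : A ⟶ C}
    {inr : B ⟶ C} {d : C ⟶ C'} {φ : A ⟶ B'} {inr' : B' ⟶ C'} {dA : A ⟶ A'} {inl' : A' ⟶ C'}
    {dB : B ⟶ B'} (h₁ : inl ≫ d = φ ≫ inr' - dA ≫ inl') (h₂ : inr ≫ d = dB ≫ inr')
    (U : Opens T) (x : Sec A U) (y : Sec B U) :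
    secMap d U (secMap inl U x + secMap inr U y) =
      secMap inr' U (secMap φ U x + secMap dB U y) - secMap inl' U (secMap dA U x) := by
  rw [map_add, map_add, ← secMap_comp inl, ← secMap_comp inr, h₁, h₂, secMap_sub,
    secMap_comp, secMap_comp, secMap_comp]
  abel

lemma secMap_biprod_split {A B C : TopCat.Sheaf AddCommGrpCat.{u} T} {inl : A ⟶ C}
    {inr : B ⟶ C} {fst : C ⟶ A} {snd : C ⟶ B} (h : fst ≫ inl + snd ≫ inr = 𝟙 C)
    (U : Opens T) (z : Sec C U) :
    secMap inl U (secMap fst U z) + secMap inr U (secMap snd U z) = z := by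
  rw [← secMap_comp, ← secMap_comp, ← secMap_add, h, secMap_id]

lemma secMap_biprod_proj {A B C : TopCat.Sheaf AddCommGrpCat.{u} T} {inl : A ⟶ C}
    {inr : B ⟶ C} {fst : C ⟶ A} {snd : C ⟶ B} (h₁ : inl ≫ fst = 𝟙 A) (h₂ : inl ≫ snd = 0)
    (h₃ : inr ≫ fst = 0) (h₄ : inr ≫ snd = 𝟙 B) (U : Opens T) (x : Sec A U) (y : Sec B U) :
    secMap fst U (secMap inl U x + secMap inr U y) = x ∧
      secMap snd U (secMap inl U x + secMap inr U y) = y := by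
  rw [map_add, map_add, ← secMap_comp, ← secMap_comp, ← secMap_comp, ← secMap_comp, h₁, h₂, h₃, h₄]
  simp [secMap_id, secMap_zero]

/-- As `C.X z` vanishes, the differential from `a` to `b` is a monomorphism and hence a kernel of
the next one. Taking sections preserves kernels, so the lift exists on all of `U` and not only
locally. -/
lemma sec_exists_lift_of_acyclic {C : CochainComplex (TopCat.Sheaf AddCommGrpCat.{u} T) ℤ}
    (hC : C.Acyclic) {z a b c : ℤ} (hza : z + 1 = a) (hab : a + 1 = b) (hbc : b + 1 = c)
    (hz : Limits.IsZero (C.X z)) (U : Opens T) (s : Sec (C.X b) U) (hs : secMap (C.d b c) U s = 0) :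
    ∃ t, secMap (C.d a b) U t = s := by
  obtain rfl := hza; obtain rfl := hab; obtain rfl := hbc
  have h₁ := hC (z + 1)
  have h₂ := hC (z + 1 + 1)
  rw [HomologicalComplex.exactAt_iff' _ z (z + 1) (z + 1 + 1) (by simp) (by simp)] at h₁
  rw [HomologicalComplex.exactAt_iff' _ (z + 1) (z + 1 + 1) (z + 1 + 1 + 1) (by simp) (by simp)]
    at h₂
  exact sec_exists_lift h₂ (h₁.mono_g (hz.eq_of_src _ _)) s hs

lemma secMap_d_injective_of_acyclic {C : CochainComplex (TopCat.Sheaf AddCommGrpCat.{u} T) ℤ}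
    (hC : C.Acyclic) {y z a b : ℤ} (hyz : y + 1 = z) (hza : z + 1 = a) (hab : a + 1 = b)
    (hy : Limits.IsZero (C.X y)) (hz : Limits.IsZero (C.X z)) (U : Opens T) (s : Sec (C.X a) U)
    (hs : secMap (C.d a b) U s = 0) : s = 0 := by
  obtain ⟨t, rfl⟩ := sec_exists_lift_of_acyclic hC hyz hza hab hy U s hs
  rw [hz.eq_of_src (C.d z a) 0, secMap_zero]

lemma sec_exists_local_lift_of_acyclic {C : CochainComplex (TopCat.Sheaf AddCommGrpCat.{u} T) ℤ}
    (hC : C.Acyclic) {a b c : ℤ} (hab : a + 1 = b) (hbc : b + 1 = c)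
    (U : Opens T) (s : Sec (C.X b) U) (hs : secMap (C.d b c) U s = 0) (p : T) (hp : p ∈ U) :
    ∃ (V : Opens T) (h : V ≤ U) (t : Sec (C.X a) V), p ∈ V ∧ secMap (C.d a b) V t =
      secRes (C.X b) h s := by
  obtain rfl := hab; obtain rfl := hbc
  have h₁ := hC (a + 1)
  rw [HomologicalComplex.exactAt_iff' _ a (a + 1) (a + 1 + 1) (by simp) (by simp)] at h₁
  exact sec_exists_local_lift h₁ s hs p hp

/-- A description on the level of sections of the mapping cone `C` of `i : K ⟶ J`. -/
structure IsConeOnSections {K J : CochainComplex (TopCat.Sheaf AddCommGrpCat.{u} T) ℤ} (i : K ⟶ J)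
    (C : CochainComplex (TopCat.Sheaf AddCommGrpCat.{u} T) ℤ) where
  inl (a b : ℤ) (h : b + 1 = a) (U : Opens T) : Sec (K.X a) U →+ Sec (C.X b) U
  inr (b : ℤ) (U : Opens T) : Sec (J.X b) U →+ Sec (C.X b) U
  fst (a b : ℤ) (h : b + 1 = a) (U : Opens T) : Sec (C.X b) U →+ Sec (K.X a) U
  snd (b : ℤ) (U : Opens T) : Sec (C.X b) U →+ Sec (J.X b) U
  split (a b : ℤ) (h : b + 1 = a) (U : Opens T) (z : Sec (C.X b) U) :
    inl a b h U (fst a b h U z) + inr b U (snd b U z) = z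
  proj (a b : ℤ) (h : b + 1 = a) (U : Opens T) (x : Sec (K.X a) U) (y : Sec (J.X b) U) :
    fst a b h U (inl a b h U x + inr b U y) = x ∧ snd b U (inl a b h U x + inr b U y) = y
  res_inr (b : ℤ) {U V : Opens T} (h : V ≤ U) (y : Sec (J.X b) U) :
    secRes (C.X b) h (inr b U y) = inr b V (secRes (J.X b) h y)
  d_eq (a b c : ℤ) (h : b + 1 = a) (h' : a + 1 = c) (U : Opens T) (x : Sec (K.X a) U)
    (y : Sec (J.X b) U) : secMap (C.d b a) U (inl a b h U x + inr b U y) =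
      inr a U (secMap (i.f a) U x + secMap (J.d b a) U y) - inl c a h' U (secMap (K.d a c) U x)

/-- The mapping cone, on the level of sections. -/
def isConeOnSectionsMappingCone {K J : CochainComplex (TopCat.Sheaf AddCommGrpCat.{u} T) ℤ}
    (i : K ⟶ J) : IsConeOnSections i (mappingCone i) where
  inl a b h U := secMap ((inl i).v a b (by lia)) U
  inr b U := secMap ((inr i).f b) U
  fst a b h U := secMap ((fst i).1.v b a h) U
  snd b U := secMap ((snd i).v b b (add_zero b)) U
  split a b h U z := secMap_biprod_split (id_X i b a h) U z
  proj a b h U x y := secMap_biprod_proj (inl_v_fst_v i a b h) (inl_v_snd_v i a b (by lia))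
      (inr_f_fst_v i b a h) (inr_f_snd_v i b) U x y
  res_inr b U V h y := (secMap_secRes _ h y).symm
  d_eq a b c h h' U x y :=
    secMap_biprod_d (inl_v_d i a b c (by lia) (by lia)) (inr_f_d i b a) U x y

/-- The three conditions are exactness of the cone in degrees -1, 0 and 1. It is zero in degrees -2
and -3, so in degrees -1 and 0 exactness persists on the sections over each open set; in degree 1 it
holds only locally. -/
lemma IsConeOnSections.isResolutionOnSections
    {K J C : CochainComplex (TopCat.Sheaf AddCommGrpCat.{u} T) ℤ} {i : K ⟶ J}
    (h : IsConeOnSections i C) (hC : C.Acyclic) (h₂ : Limits.IsZero (C.X (-2)))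
    (h₃ : Limits.IsZero (C.X (-3))) (hJ : Limits.IsZero (J.X (-1))) :
    IsResolutionOnSections (K.d 0 1) (K.d 1 2) (J.d 0 1) (J.d 1 2) (i.f 0) (i.f 1) (i.f 2) := by
  have hJ0 : ∀ U (y : Sec (J.X (-1)) U), y = 0 := fun U y => by
    rw [← secMap_id U y, hJ.eq_of_src (𝟙 _) 0, secMap_zero]
  refine ⟨by simp, by simp, by simp, by simp, ?_, ?_, ?_⟩
  · intro U z hz hz'
    have h0 := secMap_d_injective_of_acyclic hC (by lia : (-3 : ℤ) + 1 = -2) (by lia)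
      (by lia : (-1 : ℤ) + 1 = 0) h₃ h₂ U (h.inl 0 (-1) (by lia) U z + h.inr (-1) U 0) (by
        rw [h.d_eq 0 (-1) 1 _ (by lia), hz, hz', map_zero]; simp)
    have := (h.proj 0 (-1) (by lia) U z 0).1
    rw [h0, map_zero] at this
    exact this.symm
  · intro U x y hx hxy
    -- The sign in `-x` compensates the sign with which the differential of `K` enters the cone.
    obtain ⟨t, ht⟩ := sec_exists_lift_of_acyclic hC (by lia : (-2 : ℤ) + 1 = -1) (by lia)
      (by lia : (0 : ℤ) + 1 = 1) h₂ U (h.inl 1 0 (by lia) U (-x) + h.inr 0 U y) (by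
        rw [h.d_eq 1 0 2 _ (by lia), map_neg, map_neg, hxy, hx]; simp)
    have e := h.d_eq 0 (-1) 1 (by lia) (by lia) U (h.fst 0 (-1) (by lia) U t) (h.snd (-1) U t)
    rw [h.split, ht, hJ0 U (h.snd _ _ _), map_zero, add_zero, sub_eq_neg_add, ← map_neg] at e
    have p₁ := h.proj 1 0 (by lia) U (-x) y
    rw [e] at p₁
    obtain ⟨q₁, q₂⟩ := h.proj 1 0 (by lia) U _ _ |>.1.symm.trans p₁.1,
      (h.proj 1 0 (by lia) U _ _).2.symm.trans p₁.2
    exact ⟨_, neg_injective q₁, q₂⟩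
  · intro U f hf p hp
    obtain ⟨V, hV, t, hpV, ht⟩ := sec_exists_local_lift_of_acyclic hC (by lia : (0 : ℤ) + 1 = 1)
      (by lia : (1 : ℤ) + 1 = 2) U (h.inr 1 U f) (by
        have := h.d_eq 2 1 3 (by lia) (by lia) U 0 f
        simpa only [map_zero, zero_add, hf, sub_zero] using this) p hp
    have e := h.d_eq 1 0 2 (by lia) (by lia) V (h.fst 1 0 (by lia) V t) (h.snd 0 V t)
    rw [h.split, ht, h.res_inr, sub_eq_neg_add, ← map_neg] at e
    have p₁ := h.proj 2 1 (by lia) V 0 (secRes _ hV f)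
    rw [map_zero, zero_add, e] at p₁
    have q₁ := (h.proj 2 1 (by lia) V _ _).1.symm.trans p₁.1
    have q₂ := (h.proj 2 1 (by lia) V _ _).2.symm.trans p₁.2
    exact ⟨V, hV, h.fst 1 0 (by lia) V t, h.snd 0 V t, hpV, neg_eq_zero.1 q₁, q₂.symm⟩

lemma isResolutionOnSections_of_quasiIso
    {K J : CochainComplex (TopCat.Sheaf AddCommGrpCat.{u} T) ℤ} (i : K ⟶ J) [QuasiIso i]
    [K.IsStrictlyGE 0] [J.IsStrictlyGE 0] :
    IsResolutionOnSections (K.d 0 1) (K.d 1 2) (J.d 0 1) (J.d 1 2) (i.f 0) (i.f 1) (i.f 2) := by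
  refine (isConeOnSectionsMappingCone i).isResolutionOnSections (acyclic_mappingCone i) ?_ ?_
    (J.isZero_of_isStrictlyGE 0 _ (by lia)) <;>
  exact (mappingCone.isZero_X_iff i _).2 ⟨K.isZero_of_isStrictlyGE 0 _ (by lia),
    J.isZero_of_isStrictlyGE 0 _ (by lia)⟩

lemma IsResolutionOnSections.of_iso {F₀ F₁ F₂ G₀ G₁ G₂ J₀ J₁ J₂ : TopCat.Sheaf AddCommGrpCat.{u} T}
    {d₀ : F₀ ⟶ F₁} {d₁ : F₁ ⟶ F₂} {δ₀ : J₀ ⟶ J₁} {δ₁ : J₁ ⟶ J₂} {a₀ : F₀ ⟶ J₀} {a₁ : F₁ ⟶ J₁}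
    {a₂ : F₂ ⟶ J₂} (h : IsResolutionOnSections d₀ d₁ δ₀ δ₁ a₀ a₁ a₂) {d₀' : G₀ ⟶ G₁}
    {d₁' : G₁ ⟶ G₂} (e₀ : F₀ ≅ G₀) (e₁ : F₁ ≅ G₁) (e₂ : F₂ ≅ G₂)
    (h₀ : d₀ = e₀.hom ≫ d₀' ≫ e₁.inv) (h₁ : d₁ = e₁.hom ≫ d₁' ≫ e₂.inv) :
    IsResolutionOnSections d₀' d₁' δ₀ δ₁ (e₀.inv ≫ a₀) (e₁.inv ≫ a₁) (e₂.inv ≫ a₂) := by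
  obtain rfl : d₀' = e₀.inv ≫ d₀ ≫ e₁.hom := by simp [h₀]
  obtain rfl : d₁' = e₁.inv ≫ d₁ ≫ e₂.hom := by simp [h₁]
  have hinv : ∀ {A B : TopCat.Sheaf AddCommGrpCat.{u} T} (e : A ≅ B) (U : Opens T) (x : Sec B U),
    secMap e.hom U (secMap e.inv U x) = x := fun e U x => by
      rw [← secMap_comp, e.inv_hom_id, secMap_id]
  have hinv' : ∀ {A B : TopCat.Sheaf AddCommGrpCat.{u} T} (e : A ≅ B) (U : Opens T) (x : Sec A U),
    secMap e.inv U (secMap e.hom U x) = x := fun e U x => by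
      rw [← secMap_comp, e.hom_inv_id, secMap_id]
  have hinj : ∀ {A B : TopCat.Sheaf AddCommGrpCat.{u} T} (e : A ≅ B) (U : Opens T) (x : Sec A U),
    secMap e.hom U x = 0 → x = 0 := fun e U x hx => by
      rw [← hinv' e U x, hx, map_zero]
  refine ⟨by simp [reassoc_of% h.d_d], h.δ_δ, by simp [h.comm₀], by simp [h.comm₁], ?_, ?_, ?_⟩
  · intro U z hz hz'
    rw [secMap_comp, secMap_comp] at hz
    have := h.inj U _ (hinj e₁ U _ hz) hz'
    exact hinj e₀.symm U z this
  · intro U x y hx hxy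
    rw [secMap_comp, secMap_comp] at hx
    obtain ⟨z, hz, hz'⟩ := h.lift U _ y (hinj e₂ U _ hx) hxy
    refine ⟨secMap e₀.hom U z, ?_, ?_⟩
    · rw [secMap_comp, secMap_comp, hinv', hz, hinv]
    · rw [secMap_comp, hinv', hz']
  · intro U f hf p hp
    obtain ⟨V, hV, x, y, hpV, hx, hxy⟩ := h.local_lift U f hf p hp
    refine ⟨V, hV, secMap e₁.hom V x, y, hpV, ?_, ?_⟩
    · rw [secMap_comp, secMap_comp, hinv', hx, map_zero]
    · rw [secMap_comp, hinv', hxy]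

/-- The resolution starts in degree zero and has injective terms, so it is K-injective. Maps from
the constant sheaf ℤ into its terms are global sections, which turns the criterion for the derived
Hom group into one about sections over `⊤`. -/
lemma exists_isResolutionOnSections (K : CochainComplex (TopCat.Sheaf AddCommGrpCat.{u} T) ℕ) :
    ∃ (J₀ J₁ J₂ : TopCat.Sheaf AddCommGrpCat.{u} T) (δ₀ : J₀ ⟶ J₁) (δ₁ : J₁ ⟶ J₂)
      (a₀ : K.X 0 ⟶ J₀) (a₁ : K.X 1 ⟶ J₁) (a₂ : K.X 2 ⟶ J₂), Injective J₀ ∧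
      IsResolutionOnSections (K.d 0 1) (K.d 1 2) δ₀ δ₁ a₀ a₁ a₂ ∧
      (Subsingleton (Hypercohomology K 1) ↔
        ∀ f : Sec J₁ ⊤, secMap δ₁ ⊤ f = 0 → ∃ y, secMap δ₀ ⊤ y = f) := by
  let := HasDerivedCategory.standard (TopCat.Sheaf AddCommGrpCat.{u} T)
  obtain ⟨J, i, hi, hinj, hJ⟩ := Plus.modelCategoryQuillen.exists_quasiIso_injective
    (K.extend ComplexShape.embeddingUpNat) 0
  have := isKInjective_of_injective J 0
  have h := isResolutionOnSections_of_quasiIso i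
  have e0 : ComplexShape.embeddingUpNat.f 0 = 0 := rfl
  have e1 : ComplexShape.embeddingUpNat.f 1 = 1 := rfl
  have e2 : ComplexShape.embeddingUpNat.f 2 = 2 := rfl
  refine ⟨_, _, _, _, _, _, _, _, hinj 0, h.of_iso (K.extendXIso _ e0) (K.extendXIso _ e1)
    (K.extendXIso _ e2) (K.extend_d_eq _ e0 e1) (K.extend_d_eq _ e1 e2), ?_⟩
  refine (subsingleton_shiftedHom_iff (integerSheaf T) i).trans ?_
  constructor
  · intro H f hf
    obtain ⟨y, hy⟩ := H ((homIntegerSheafEquiv _).symm f) (by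
      apply (homIntegerSheafEquiv _).injective
      rw [homIntegerSheafEquiv_comp, Equiv.apply_symm_apply, hf, homIntegerSheafEquiv_zero])
    refine ⟨homIntegerSheafEquiv _ y, ?_⟩
    rw [← homIntegerSheafEquiv_comp, hy, Equiv.apply_symm_apply]
  · intro H f hf
    obtain ⟨y, hy⟩ := H (homIntegerSheafEquiv _ f) (by
      rw [← homIntegerSheafEquiv_comp, hf, homIntegerSheafEquiv_zero])
    refine ⟨(homIntegerSheafEquiv _).symm y, (homIntegerSheafEquiv _).injective ?_⟩
    rw [homIntegerSheafEquiv_comp, Equiv.apply_symm_apply, hy]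

/-- If `ℍ¹` vanishes, then every Čech hypercocycle is a boundary. -/
theorem Hypercocycle.isBoundary_of_subsingleton
    {K : CochainComplex (TopCat.Sheaf AddCommGrpCat.{u} T) ℕ}
    (hK : Subsingleton (Hypercohomology K 1)) {ι : Type u} {U : ι → Opens T} (hU : iSup U = ⊤)
    (c : Hypercocycle (K.d 0 1) (K.d 1 2) U) : c.IsBoundary := by
  obtain ⟨J₀, J₁, J₂, δ₀, δ₁, a₀, a₁, a₂, _, h, H⟩ := exists_isResolutionOnSections K
  exact h.isBoundary (H.1 hK) hU c

/-- If every Čech hypercocycle is a boundary, then `ℍ¹` vanishes. -/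
theorem subsingleton_hypercohomology_one
    {K : CochainComplex (TopCat.Sheaf AddCommGrpCat.{u} T) ℕ} (B : Set (Opens T))
    (hB : Opens.IsBasis B)
    (hc : ∀ {ι : Type u} (U : ι → Opens T), (∀ i, U i ∈ B) → iSup U = ⊤ →
      ∀ c : Hypercocycle (K.d 0 1) (K.d 1 2) U, c.IsBoundary) :
    Subsingleton (Hypercohomology K 1) := by
  obtain ⟨J₀, J₁, J₂, δ₀, δ₁, a₀, a₁, a₂, _, h, H⟩ := exists_isResolutionOnSections K
  exact H.2 fun f hf => h.exists_eq B hB hc f hf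

end Resolution

/-! ### Polyvector fields and Poisson structures defined on a basis of open sets -/

section Basis

variable {R : Type u} [CommRing R] {X : Scheme.{u}} (f : X ⟶ Spec (.of R)) {ι : Type u}
  {b : ι → X.Opens} (hb : Opens.IsBasis (Set.range b))

include hb

lemma exists_mem_basis {V : X.Opens} {x : X} (hx : x ∈ V) : ∃ i, x ∈ b i ∧ b i ≤ V := by
  obtain ⟨_, ⟨i, rfl⟩, h, h'⟩ := Opens.isBasis_iff_nbhd.1 hb hx
  exact ⟨i, h, h'⟩

lemma le_iSup_basis (V : X.Opens) : V ≤ ⨆ i : {i // b i ≤ V}, b i.1 := fun x hx => by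
  obtain ⟨i, h, h'⟩ := exists_mem_basis hb hx
  exact Opens.mem_iSup.2 ⟨⟨i, h'⟩, h⟩

lemma Sections.ext_of_basis {V : X.Opens} {s t : Sections f V}
    (h : ∀ i (hi : b i ≤ V), Sections.res f hi s = Sections.res f hi t) : s = t :=
  X.sheaf.eq_of_locally_eq' (fun i : {i // b i ≤ V} => b i.1) V (fun i => homOfLE i.2)
    (le_iSup_basis hb V) s t fun i => h i.1 i.2

lemma Sections.exists_of_basis {V : X.Opens} (s : ∀ i, b i ≤ V → Sections f (b i))
    (hs : ∀ i j (hj : b j ≤ V) (h : b i ≤ b j), Sections.res f h (s j hj) = s i (h.trans hj)) :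
    ∃ t : Sections f V, ∀ i (hi : b i ≤ V), Sections.res f hi t = s i hi := by
  -- The intersection of two basis members need not be one; agreement there is tested on the members
  -- inside it, where the compatibility along inclusions applies.
  have H : ∀ i j : {i // b i ≤ V}, Sections.res f (inf_le_left : b i.1 ⊓ b j.1 ≤ b i.1) (s i.1 i.2) =
      Sections.res f inf_le_right (s j.1 j.2) := by
    intro i j
    refine Sections.ext_of_basis f hb fun l hl => ?_
    rw [Sections.res_res, Sections.res_res, hs l i i.2 (hl.trans inf_le_left),
      hs l j j.2 (hl.trans inf_le_right)]
  obtain ⟨t, ht⟩ := (X.sheaf.existsUnique_gluing' (fun i : {i // b i ≤ V} => b i.1) V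
    (fun i => homOfLE i.2) (le_iSup_basis hb V) (fun i => s i.1 i.2) fun i j => H i j).exists
  exact ⟨t, fun i hi => ht ⟨i, hi⟩⟩

lemma polyvectorFields.ext_of_basis {n : ℕ} {U : X.Opens} {P Q : polyvectorFields f n U}
    (h : ∀ i (hi : b i ≤ U), P.1 ⟨b i, hi⟩ = Q.1 ⟨b i, hi⟩) : P = Q := by
  refine Subtype.ext (funext fun V => AlternatingMap.ext fun v => ?_)
  refine Sections.ext_of_basis f hb fun i hi => ?_
  rw [polyvectorFields.res_apply, polyvectorFields.res_apply, h]

/-- A compatible family of skew-symmetric `n`-derivations over a basis of open subsets extends to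
a polyvector field. -/
lemma polyvectorFields.exists_of_basis {n : ℕ} {U : X.Opens}
    (P : ∀ i, b i ≤ U → (Sections f (b i)) [⋀^Fin n]→ₗ[R] (Sections f (b i)))
    (hP : ∀ i hi, P i hi ∈ skewDerivations R (Sections f (b i)) n)
    (hres : ∀ i j (hj : b j ≤ U) (h : b i ≤ b j) (v : Fin n → Sections f (b j)),
      Sections.res f h (P j hj v) = P i (h.trans hj) (Sections.res f h ∘ v)) :
    ∃ Q : polyvectorFields f n U, ∀ i (hi : b i ≤ U), Q.1 ⟨b i, hi⟩ = P i hi := by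
  have hex : ∀ (V : {V : X.Opens // V ≤ U}) (v : Fin n → Sections f V.1), ∃ s : Sections f V.1,
      ∀ i (hi : b i ≤ V.1), Sections.res f hi s = P i (hi.trans V.2) (Sections.res f hi ∘ v) := by
    intro V v
    refine Sections.exists_of_basis f hb _ fun i j hj h => ?_
    rw [hres]
    congr 1
    ext l
    simp only [Function.comp_apply, Sections.res_res]
  choose g hg using hex
  have hgu : ∀ (V : {V : X.Opens // V ≤ U}) (v : Fin n → Sections f V.1) (s : Sections f V.1),
      (∀ i (hi : b i ≤ V.1), Sections.res f hi s = P i (hi.trans V.2) (Sections.res f hi ∘ v)) →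
        g V v = s :=
    fun V v s hs => Sections.ext_of_basis f hb fun i hi => (hg V v i hi).trans (hs i hi).symm
  let G : ∀ V : {V : X.Opens // V ≤ U}, (Sections f V.1) [⋀^Fin n]→ₗ[R] (Sections f V.1) :=
    fun V => alternatingMapMk (g V)
      (by
          intro v i x y
          refine hgu _ _ _ fun j hj => ?_
          rw [map_add, hg, hg]
          simp only [Function.comp_update]
          rw [map_add, AlternatingMap.map_update_add])
      (by
          intro v i c x
          refine hgu _ _ _ fun j hj => ?_
          rw [map_smul, hg]
          simp only [Function.comp_update]
          rw [map_smul, AlternatingMap.map_update_smul])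
      (by
          intro v i j hij hne
          refine hgu _ _ _ fun l hl => ?_
          rw [map_zero, AlternatingMap.map_eq_zero_of_eq _ _ (by simp [hij]) hne])
  have hG : ∀ V v, G V v = g V v := fun V v => rfl
  refine ⟨⟨G, ?_, ?_⟩, fun i hi => AlternatingMap.ext fun v => ?_⟩
  · intro V v i x y
    refine hgu _ _ _ fun j hj => ?_
    rw [hG, hG, map_add, map_mul, map_mul, hg, hg]
    simp only [Function.comp_update]
    rw [map_mul, hP]
  · intro V W h v
    refine (hgu _ _ _ fun i hi => ?_).symm
    rw [hG, Sections.res_res, hg]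
    congr 1
    ext l
    simp only [Function.comp_apply, Sections.res_res]
  · exact hgu ⟨b i, hi⟩ v _ fun j hj => hres j i hi hj v

/-- A compatible family of Poisson brackets over a basis of open subsets extends to
a Poisson structure. -/
lemma PoissonStructure.exists_of_basis (P : ∀ i, PoissonBracket R (Sections f (b i)))
    (hres : ∀ i j (h : b i ≤ b j) (F G : Sections f (b j)),
      Sections.res f h ((P j).bracket F G) =
        (P i).bracket (Sections.res f h F) (Sections.res f h G)) :
    ∃ Λ : PoissonStructure f, ∀ i F G, (Λ.poisson (b i)).bracket F G = (P i).bracket F G := by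
  have hex : ∀ (V : X.Opens) (F G : Sections f V), ∃ s : Sections f V,
      ∀ i (hi : b i ≤ V), Sections.res f hi s =
        (P i).bracket (Sections.res f hi F) (Sections.res f hi G) := by
    intro V F G
    refine Sections.exists_of_basis f hb _ fun i j hj h => ?_
    rw [hres, Sections.res_res, Sections.res_res]
  choose g hg using hex
  have hgu : ∀ (V : X.Opens) (F G s : Sections f V),
      (∀ i (hi : b i ≤ V), Sections.res f hi s =
        (P i).bracket (Sections.res f hi F) (Sections.res f hi G)) → g V F G = s :=
    fun V F G s hs => Sections.ext_of_basis f hb fun i hi => (hg V F G i hi).trans (hs i hi).symm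
  refine ⟨⟨fun V => ⟨LinearMap.mk₂ R (g V) ?_ ?_ ?_ ?_, ?_, ?_, ?_⟩, ?_⟩, ?_⟩
  · intro F F' G
    refine hgu _ _ _ _ fun i hi => ?_
    simp only [map_add, hg, LinearMap.add_apply]
  · intro c F G
    refine hgu _ _ _ _ fun i hi => ?_
    simp only [map_smul, hg, LinearMap.smul_apply]
  · intro F G G'
    refine hgu _ _ _ _ fun i hi => ?_
    simp only [map_add, hg]
  · intro c F G
    refine hgu _ _ _ _ fun i hi => ?_
    simp only [map_smul, hg]
  · intro F G
    refine hgu _ _ _ _ fun i hi => ?_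
    rw [map_neg, LinearMap.mk₂_apply, hg, ← (P i).skew]
  · intro F G H
    refine hgu _ _ _ _ fun i hi => ?_
    simp only [LinearMap.mk₂_apply, map_add, map_mul, hg, (P i).leibniz]
  · intro F G H
    refine Sections.ext_of_basis f hb fun i hi => ?_
    simp only [LinearMap.mk₂_apply, map_add, hg, (P i).jacobi, map_zero]
  · intro V W h F G
    refine (hgu _ _ _ _ fun i hi => ?_).symm
    simp only [LinearMap.mk₂_apply, Sections.res_res, hg]
  · intro i F G
    exact hgu _ _ _ _ fun j hj => hres j i hj F G

end Basis

/-! ### Hypercocycles of the Lichnerowicz-Poisson complex -/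

section TangentComplex

variable {k : Type u} [Field k] [CharZero k] {X : Scheme.{u}} {f : X ⟶ Spec (.of k)}
  {Λ : PoissonStructure f}

lemma tangentComplex_d_zero_one : (tangentComplex Λ).d 0 1 = schoutenHom Λ 0 :=
  CochainComplex.of_d (fun n => polyvectorSheaf f (n + 1)) (schoutenHom Λ) 0

lemma tangentComplex_d_one_two : (tangentComplex Λ).d 1 2 = schoutenHom Λ 1 :=
  CochainComplex.of_d (fun n => polyvectorSheaf f (n + 1)) (schoutenHom Λ) 1

lemma isBoundary_of_subsingleton_tangentComplex
    (h : Subsingleton (Hypercohomology (tangentComplex Λ) 1))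
    {ι : Type u} {U : ι → X.Opens} (hU : iSup U = ⊤)
    (c : Hypercocycle (schoutenHom Λ 0) (schoutenHom Λ 1) U) : c.IsBoundary := by
  have H := fun c => Hypercocycle.isBoundary_of_subsingleton (U := U) h hU c
  rw [tangentComplex_d_zero_one, tangentComplex_d_one_two] at H
  exact H c

lemma subsingleton_hypercohomology_tangentComplex
    (hc : ∀ {ι : Type u} (U : ι → X.Opens), iSup U = ⊤ →
      ∀ c : Hypercocycle (schoutenHom Λ 0) (schoutenHom Λ 1) U, c.IsBoundary) :
    Subsingleton (Hypercohomology (tangentComplex Λ) 1) := by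
  refine subsingleton_hypercohomology_one Set.univ (Opens.isBasis_iff_nbhd.2 fun {U x} hx =>
    ⟨U, trivial, hx, le_rfl⟩) ?_
  rw [tangentComplex_d_zero_one, tangentComplex_d_one_two]
  intro ι U _ hU c
  exact hc U hU c

end TangentComplex

/-! ### The Schouten bracket in degrees one and two -/

section Forms

variable {k A : Type*} [Field k] [CommRing A] [Algebra k A]

/-- A linear endomorphism as an alternating map in one argument. -/
def vectorForm (D : A →ₗ[k] A) : A [⋀^Fin 1]→ₗ[k] A :=
  alternatingMapMk (fun v => D (v 0))
    (fun v i x y => by fin_cases i; simp)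
    (fun v i c x => by fin_cases i; simp)
    (fun v i j _ h => (h (Subsingleton.elim _ _)).elim)

lemma vectorForm_apply (D : A →ₗ[k] A) (v : Fin 1 → A) : vectorForm D v = D (v 0) := rfl

lemma vectorForm_mem {D : A →ₗ[k] A} (hD : ∀ x y, D (x * y) = x * D y + y * D x) :
    vectorForm D ∈ skewDerivations k A 1 := by
  intro v i x y
  fin_cases i
  simp [vectorForm_apply, hD]

/-- An alternating bilinear map as an alternating map in two arguments. -/
def bivectorForm (β : A →ₗ[k] A →ₗ[k] A) (hβ : ∀ x, β x x = 0) : A [⋀^Fin 2]→ₗ[k] A :=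
  alternatingMapMk (fun v => β (v 0) (v 1))
    (fun v i x y => by fin_cases i <;> simp)
    (fun v i c x => by fin_cases i <;> simp)
    (fun v i j h hij => by
      fin_cases i <;> fin_cases j <;> first | exact (hij rfl).elim | (simp at h; simp [h, hβ]))

lemma bivectorForm_apply (β : A →ₗ[k] A →ₗ[k] A) (hβ : ∀ x, β x x = 0) (v : Fin 2 → A) :
    bivectorForm β hβ v = β (v 0) (v 1) := rfl

lemma bivectorForm_mem {β : A →ₗ[k] A →ₗ[k] A} {hβ : ∀ x, β x x = 0}
    (h : ∀ x y z, β (x * y) z = x * β y z + y * β x z) :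
    bivectorForm β hβ ∈ skewDerivations k A 2 := by
  have hs : ∀ x y, β x y = - β y x := by
    intro x y
    have := hβ (x + y)
    simp only [map_add, LinearMap.add_apply, hβ] at this
    linear_combination this
  intro v i x y
  fin_cases i
  · simp [bivectorForm_apply, h]
  · simp only [bivectorForm_apply, Fin.mk_one, Function.update_self, ne_eq, zero_ne_one,
      not_false_eq_true, Function.update_of_ne]
    rw [hs, h, hs y, hs x]
    ring

variable (Λ : PoissonBracket k A)

/-- The right-hand side measures how far `Q` is from being a derivation of the Poisson bracket. -/
lemma PoissonBracket.schouten_apply_one [CharZero k] (Q : A [⋀^Fin 1]→ₗ[k] A) (a b : A) :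
    Λ.schouten Q ![a, b] =
      Λ.bracket a (Q ![b]) + Λ.bracket (Q ![a]) b - Q ![Λ.bracket a b] := by
  have e0 : Fin.removeNth (0 : Fin 2) ![a, b] = ![b] := by
    ext i; fin_cases i; rfl
  have e1 : Fin.removeNth (1 : Fin 2) ![a, b] = ![a] := by
    ext i; fin_cases i; rfl
  have e2 : ∀ (x : A) (w : Fin 0 → A), (Fin.cons x w : Fin 1 → A) = ![x] := by
    intro x w; ext i; fin_cases i; rfl
  rw [Λ.schouten_apply]
  simp [Fin.sum_univ_two, e0, e1, e2, Λ.skew a (Q ![b])]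
  ring

/-- Up to sign this is the ε-coefficient of the Jacobi identity for `Λ + ε Q`, which is how closed
bivectors enter deformation theory. -/
lemma PoissonBracket.schouten_apply_two [CharZero k] (Q : A [⋀^Fin 2]→ₗ[k] A) (a b c : A) :
    Λ.schouten Q ![a, b, c] =
      - (Λ.bracket a (Q ![b, c]) + Λ.bracket b (Q ![c, a]) + Λ.bracket c (Q ![a, b]) + 
        Q ![a, Λ.bracket b c] + Q ![b, Λ.bracket c a] + Q ![c, Λ.bracket a b]) := by
  have hs : ∀ x y, Q ![x, y] = - Q ![y, x] := by
    intro x y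
    have := Q.map_swap ![y, x] (i := 0) (j := 1) (by simp)
    rw [← this]
    congr 1
    ext i; fin_cases i <;> rfl
  have e0 : Fin.removeNth (0 : Fin 3) ![a, b, c] = ![b, c] := by
    ext i; fin_cases i <;> rfl
  have e1 : Fin.removeNth (1 : Fin 3) ![a, b, c] = ![a, c] := by
    ext i; fin_cases i <;> rfl
  have e2 : Fin.removeNth (2 : Fin 3) ![a, b, c] = ![a, b] := by
    ext i; fin_cases i <;> rfl
  have e3 : ∀ (x : A) (w : Fin 1 → A), (Fin.cons x w : Fin 2 → A) = ![x, w 0] := by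
    intro x w; ext i; fin_cases i <;> rfl
  have f0 : ∀ x y : A, Fin.removeNth (0 : Fin 2) ![x, y] = ![y] := by
    intro x y; ext i; fin_cases i; rfl
  have f1 : ∀ x y : A, Fin.removeNth (1 : Fin 2) ![x, y] = ![x] := by
    intro x y; ext i; fin_cases i; rfl
  have g1 : ∀ F : Fin 2 → A, ∑ x ≥ 1, F x = F 1 := fun F => Finset.sum_singleton _ _
  rw [Λ.schouten_apply]
  simp [Fin.sum_univ_succ, e0, e1, e2, e3, f0, f1, g1]
  have hn : Q ![b, Λ.bracket c a] = -Q ![b, Λ.bracket a c] := by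
    rw [Λ.skew c a, hs b (-_), hs b (Λ.bracket a c)]
    have := Q.map_update_neg ![0, b] 0 (Λ.bracket a c)
    have e : ∀ x : A, Function.update ![0, b] 0 x = ![x, b] := fun x => by
      ext i; fin_cases i <;> rfl
    rw [e, e] at this
    rw [this]
  rw [hn, hs c a, hs (Λ.bracket a b) c, hs (Λ.bracket a c) b, hs (Λ.bracket b c) a, map_neg]
  linear_combination Λ.skew (Q ![b, c]) a - Λ.skew (Q ![a, c]) b + Λ.skew (Q ![a, b]) c

end Forms

/-! ### Flatness, infinitesimal lifting and quotients of Poisson algebras -/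

section Flat

/-- If `B` is flat over `A`, then `(J : t) B = (J B : t)`. -/
lemma mem_map_of_mul_mem_map {A B : Type*} [CommRing A] [CommRing B] [Algebra A B]
    [Module.Flat A B] {J M : Ideal A} {t : A} (hM : ∀ a, t * a ∈ J → a ∈ M) {b : B}
    (hb : algebraMap A B t * b ∈ J.map (algebraMap A B)) : b ∈ M.map (algebraMap A B) := by
  obtain ⟨n, c, x, hx⟩ : ∃ (n : ℕ) (c : Fin n → J) (x : Fin n → B),
      algebraMap A B t * b = ∑ i, (c i : A) • x i := by
    rw [Ideal.map, Ideal.span, Submodule.mem_span_image_iff_exists_fun] at hb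
    obtain ⟨s, hs, c, hc⟩ := hb
    refine ⟨s.card, fun i => ⟨s.equivFin.symm i, hs (s.equivFin.symm i).2⟩,
      fun i => c (s.equivFin.symm i), ?_⟩
    rw [← hc, ← s.equivFin.symm.sum_comp]
    simp [Algebra.smul_def, mul_comm]
  -- The membership is read as a relation with coefficients `t` at `none` and `-c j` at `some j`.
  -- The equational criterion writes `b` through elements `a none j` of `A` for which `t * a none j`
  -- lies in `J`, so `hM` applies to them.
  have h0 : ∑ i : Option (Fin n), (i.elim t fun j => - (c j : A)) • (i.elim b x) = 0 := by
    simp [Algebra.smul_def] at hx ⊢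
    rw [hx, ← sub_eq_add_neg, sub_self]
  obtain ⟨m, a, y, hy, ha⟩ := Module.Flat.isTrivialRelation_of_sum_smul_eq_zero (R := A) (M := B)
    (f := fun i : Option (Fin n) => i.elim t fun j => - (c j : A)) (x := fun i => i.elim b x) h0
  have hb' := hy none
  simp only [Option.elim_none] at hb'
  rw [hb']
  refine Ideal.sum_mem _ fun j _ => ?_
  rw [Algebra.smul_def]
  refine Ideal.mul_mem_right _ _ (Ideal.mem_map_of_mem _ (hM _ ?_))
  have := ha j
  simp only [Fintype.sum_option, Option.elim_none, Option.elim_some, neg_mul,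
    Finset.sum_neg_distrib, ← sub_eq_add_neg, sub_eq_zero] at this
  rw [this]
  exact Ideal.sum_mem _ fun i _ => Ideal.mul_mem_right _ _ (c i).2

end Flat

section Lift

variable {k R S C C' : Type*} [CommRing k] [CommRing R] [CommRing S] [CommRing C] [CommRing C']
  [Algebra k R] [Algebra k S] [Algebra k C] [Algebra k C']

lemma exists_lift_of_formallySmooth [Algebra.FormallySmooth k R] (g : C →ₐ[k] C')
    (hg : Function.Surjective g) (hn : IsNilpotent (RingHom.ker g)) (s : R →ₐ[k] C') :
    ∃ u : R →ₐ[k] C, ∀ a, g (u a) = s a :=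
  ⟨Algebra.FormallySmooth.liftOfSurjective s g hg hn,
    Algebra.FormallySmooth.liftOfSurjective_apply s g hg hn⟩

/-- Through `α` the ring `C` becomes an `R`-algebra, and an `R`-algebra lift of `s` is a lift that
extends `α`. It transports a lift chosen on an open set to a smaller one. -/
lemma exists_lift_of_formallyEtale (ρ : R →ₐ[k] S) (hρ : ρ.toRingHom.FormallyEtale)
    (g : C →ₐ[k] C') (hg : Function.Surjective g) (hn : IsNilpotent (RingHom.ker g))
    (s : S →ₐ[k] C') (α : R →ₐ[k] C) (h : ∀ a, g (α a) = s (ρ a)) :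
    ∃ u : S →ₐ[k] C, (∀ a, g (u a) = s a) ∧ ∀ a, u (ρ a) = α a := by
  let := ρ.toRingHom.toAlgebra
  let := α.toRingHom.toAlgebra
  let := (g.comp α).toRingHom.toAlgebra
  have : Algebra.FormallyEtale R S := hρ
  let s' : S →ₐ[R] C' := { s with commutes' := fun a => (h a).symm }
  let g' : C →ₐ[R] C' := { g with commutes' := fun a => rfl }
  let u := Algebra.FormallySmooth.liftOfSurjective s' g' hg hn
  have hu : ∀ a, u (ρ a) = α a := u.commutes
  refine ⟨{ u with commutes' := fun c => ?_ },
    Algebra.FormallySmooth.liftOfSurjective_apply s' g' hg hn, hu⟩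
  change u _ = _
  rw [← ρ.commutes, hu, α.commutes]

lemma lift_unique_of_formallyEtale (ρ : R →ₐ[k] S) (hρ : ρ.toRingHom.FormallyEtale)
    (g : C →ₐ[k] C') (hn : IsNilpotent (RingHom.ker g))
    {u v : S →ₐ[k] C} (hg : ∀ a, g (u a) = g (v a)) (h : ∀ a, u (ρ a) = v (ρ a)) (a : S) :
    u a = v a := by
  let := ρ.toRingHom.toAlgebra
  let := (u.comp ρ).toRingHom.toAlgebra
  have : Algebra.FormallyEtale R S := hρ
  let u' : S →ₐ[R] C := { u with commutes' := fun a => rfl }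
  let v' : S →ₐ[R] C := { v with commutes' := fun a => (h a).symm }
  exact congr($(Algebra.FormallyUnramified.ext' (g : C →+* C') hn u' v' hg) a)

end Lift

section Quotient

variable {A B : Type*} [CommRing A] [CommRing B] [Algebra A B]

/-- Elements of `A` pass through the bracket by `A`-linearity, and the Leibniz rule handles
multiples of generators: an ideal extended from the base is a Poisson ideal. -/
lemma PoissonBracket.map_bracket_mem (M : PoissonBracket A B) (I : Ideal A) {x : B}
    (hx : x ∈ I.map (algebraMap A B)) (y : B) : M.bracket x y ∈ I.map (algebraMap A B) := by
  refine Submodule.span_induction ?_ (by simp) (fun x z _ _ hx hz => ?_) (fun c x hx' hx => ?_) hx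
  · rintro _ ⟨a, ha, rfl⟩
    rw [Algebra.algebraMap_eq_smul_one, map_smul, LinearMap.smul_apply, Algebra.smul_def]
    exact Ideal.mul_mem_right _ _ (Ideal.mem_map_of_mem _ ha)
  · rw [map_add, LinearMap.add_apply]
    exact add_mem hx hz
  · rw [smul_eq_mul, M.leibniz]
    exact add_mem (Ideal.mul_mem_left _ _ hx) (Ideal.mul_mem_right _ _ hx')

lemma PoissonBracket.mk_bracket_eq (M : PoissonBracket A B) (I : Ideal A) {x x' y y' : B}
    (hx : Ideal.Quotient.mk (I.map (algebraMap A B)) x = Ideal.Quotient.mk _ x')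
    (hy : Ideal.Quotient.mk (I.map (algebraMap A B)) y = Ideal.Quotient.mk _ y') :
    Ideal.Quotient.mk (I.map (algebraMap A B)) (M.bracket x y) =
      Ideal.Quotient.mk _ (M.bracket x' y') := by
  rw [Ideal.Quotient.eq] at hx hy ⊢
  have h1 := M.map_bracket_mem I hx y
  have h2 := M.map_bracket_mem I hy x'
  rw [M.skew, neg_mem_iff] at h2
  have := add_mem h1 h2
  simpa using this

/-- The Poisson bracket on the target of a surjection. -/
def PoissonBracket.ofSurjective {C : Type*} [CommRing C] [Algebra A C] (M : PoissonBracket A B)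
    (φ : B →ₐ[A] C) (hφ : Function.Surjective φ) (β : C → C → C)
    (hβ : ∀ x y, β (φ x) (φ y) = φ (M.bracket x y)) : PoissonBracket A C where
  bracket := LinearMap.mk₂ A β
    (hφ.forall.2 fun x => hφ.forall.2 fun x' => hφ.forall.2 fun y => by
      rw [← map_add, hβ, hβ, hβ, ← map_add, map_add, LinearMap.add_apply])
    (fun c => hφ.forall.2 fun x => hφ.forall.2 fun y => by
      rw [← map_smul, hβ, hβ, ← map_smul, map_smul, LinearMap.smul_apply])
    (hφ.forall.2 fun x => hφ.forall.2 fun y => hφ.forall.2 fun y' => by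
      rw [← map_add, hβ, hβ, hβ, ← map_add, map_add])
    (fun c => hφ.forall.2 fun x => hφ.forall.2 fun y => by
      rw [← map_smul, hβ, hβ, ← map_smul, map_smul])
  skew := hφ.forall.2 fun x => hφ.forall.2 fun y => by
    rw [LinearMap.mk₂_apply, LinearMap.mk₂_apply, hβ, hβ, M.skew, map_neg]
  leibniz := hφ.forall.2 fun x => hφ.forall.2 fun y => hφ.forall.2 fun z => by
    simp only [LinearMap.mk₂_apply, ← map_mul, hβ, ← map_add, M.leibniz]
  jacobi := hφ.forall.2 fun x => hφ.forall.2 fun y => hφ.forall.2 fun z => by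
    simp only [LinearMap.mk₂_apply, hβ, ← map_add, M.jacobi, map_zero]

/-- The Poisson bracket induced on `B / I B`. -/
def PoissonBracket.quotient (M : PoissonBracket A B) (I : Ideal A) :
    PoissonBracket A (B ⧸ I.map (algebraMap A B)) :=
  M.ofSurjective (Ideal.Quotient.mkₐ A _) Ideal.Quotient.mk_surjective
    (fun x y => Ideal.Quotient.mk _ (M.bracket x.out y.out))
    fun _ _ => M.mk_bracket_eq I (Ideal.Quotient.mk_out _) (Ideal.Quotient.mk_out _)

lemma PoissonBracket.quotient_mk (M : PoissonBracket A B) (I : Ideal A) (x y : B) :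
    (M.quotient I).bracket (Ideal.Quotient.mk _ x) (Ideal.Quotient.mk _ y) =
      Ideal.Quotient.mk _ (M.bracket x y) :=
  M.mk_bracket_eq I (Ideal.Quotient.mk_out _) (Ideal.Quotient.mk_out _)

end Quotient

/-! ### Small extensions: derivations and bivectors as obstructions -/

section SmallExtension

variable {k A R C : Type*} [Field k] [CommRing A] [CommRing R] [CommRing C]
  [Algebra k R] [Algebra k C] [Algebra A C]

/-- The `k`-linear map `τ` embeds `R` as an ideal of square zero in the Poisson algebra `C`, such
that multiplication and bracket with elements of `C` are induced from the map `p : C → R`. -/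
structure IsSmallExtension (Λ : PoissonBracket k R) (M : PoissonBracket A C) (p : C →ₐ[k] R)
    (τ : R →ₗ[k] C) : Prop where
  injective : Function.Injective τ
  map_eq_zero : ∀ x, p (τ x) = 0
  mul_eq : ∀ c x, c * τ x = τ (p c * x)
  bracket_eq : ∀ c x, M.bracket c (τ x) = τ (Λ.bracket (p c) x)

lemma PoissonBracket.bracket_self [CharZero k] (Λ : PoissonBracket k R) (x : R) : Λ.bracket x x = 0 := by
  have h := Λ.skew x x
  rw [eq_neg_iff_add_eq_zero, ← two_smul k, smul_eq_zero_iff_right two_ne_zero] at h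
  exact h

namespace IsSmallExtension

variable {Λ : PoissonBracket k R} {M : PoissonBracket A C} {p : C →ₐ[k] R} {τ : R →ₗ[k] C}
variable (h : IsSmallExtension Λ M p τ)

include h

lemma mul_eq_zero (x y : R) : τ x * τ y = 0 := by
  rw [h.mul_eq, h.map_eq_zero, zero_mul, map_zero]

lemma bracket_eq' (x : R) (c : C) : M.bracket (τ x) c = τ (Λ.bracket x (p c)) := by
  rw [M.skew, h.bracket_eq, ← map_neg, ← Λ.skew]

/-- The difference of two sections is a derivation. -/
lemma exists_derivation (u v : R →ₐ[k] C) (hu : ∀ a, p (u a) = a) (hv : ∀ a, p (v a) = a)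
    (huv : ∀ a, ∃ x, τ x = u a - v a) :
    ∃ D : R →ₗ[k] R, (∀ a, τ (D a) = u a - v a) ∧
      ∀ x y, D (x * y) = x * D y + y * D x := by
  choose D hD using huv
  refine ⟨⟨⟨D, fun x y => h.injective ?_⟩, fun c x => h.injective ?_⟩, hD,
    fun x y => h.injective ?_⟩
  · simp only [map_add, hD]; ring
  · simp only [map_smul, hD, RingHom.id_apply, smul_sub]
  · change τ (D _) = τ (x * D y + y * D x)
    -- (u - v)(xy) = u(x)(u - v)(y) + v(y)(u - v)(x), and u(x), v(y) act on the image of `τ` through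
    -- `p`, that is, as x and y.
    have h1 := h.mul_eq (u x) (D y)
    have h2 := h.mul_eq (v y) (D x)
    rw [hu] at h1
    rw [hv] at h2
    rw [map_add, ← h1, ← h2]
    simp only [hD, map_mul]
    ring

/-- A section plus a derivation is a section. -/
lemma exists_section (u : R →ₐ[k] C) (hu : ∀ a, p (u a) = a) (E : R →ₗ[k] R)
    (hE : ∀ x y, E (x * y) = x * E y + y * E x) :
    ∃ v : R →ₐ[k] C, ∀ a, v a = u a - τ (E a) := by
  have h1 : E 1 = 0 := by simpa using hE 1 1
  refine ⟨AlgHom.ofLinearMap (u.toLinearMap - τ.comp E) (by simp [h1]) fun x y => ?_, fun a => rfl⟩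
  have h2 := h.mul_eq (u x) (E y)
  have h3 := h.mul_eq (u y) (E x)
  rw [hu] at h2 h3
  simp only [LinearMap.sub_apply, AlgHom.toLinearMap_apply, LinearMap.comp_apply, hE, map_add,
    ← h2, ← h3, map_mul]
  linear_combination - h.mul_eq_zero (E x) (E y)

/-- The failure of a section to be Poisson is a closed bivector. -/
lemma exists_bivector [CharZero k] [Algebra k A] [IsScalarTower k A C] (u : R →ₐ[k] C) (hu : ∀ a, p (u a) = a)
    (huv : ∀ a b, ∃ x, τ x = M.bracket (u a) (u b) - u (Λ.bracket a b)) :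
    ∃ β : R →ₗ[k] R →ₗ[k] R, (∀ a b, τ (β a b) = M.bracket (u a) (u b) - u (Λ.bracket a b)) ∧
      (∀ x, β x x = 0) ∧ (∀ x y z, β (x * y) z = x * β y z + y * β x z) ∧
      ∀ x y z, Λ.bracket x (β y z) + Λ.bracket y (β z x) + Λ.bracket z (β x y) +
        β x (Λ.bracket y z) + β y (Λ.bracket z x) + β z (Λ.bracket x y) = 0 := by
  choose β hβ using huv
  have hMl : ∀ (c : k) (x y : C), M.bracket (c • x) y = c • M.bracket x y := fun c x y => by
    rw [← algebraMap_smul A c x, map_smul, LinearMap.smul_apply, algebraMap_smul]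
  have hMr : ∀ (c : k) (x y : C), M.bracket x (c • y) = c • M.bracket x y := fun c x y => by
    rw [← algebraMap_smul A c y, map_smul, algebraMap_smul]
  refine ⟨LinearMap.mk₂ k β (fun x x' y => h.injective ?_) (fun c x y => h.injective ?_)
    (fun x y y' => h.injective ?_) (fun c x y => h.injective ?_), hβ, fun x => h.injective ?_,
    fun x y z => h.injective ?_, fun x y z => h.injective ?_⟩
  · simp only [map_add, hβ, LinearMap.add_apply]; ring
  · simp only [map_smul, hβ, LinearMap.smul_apply, hMl, smul_sub]
  · simp only [map_add, hβ]; ring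
  · simp only [map_smul, hβ, hMr, smul_sub]
  · have h0 : M.bracket (u x) (u x) = 0 := by
      have h := M.skew (u x) (u x)
      rw [eq_neg_iff_add_eq_zero, ← two_smul k, smul_eq_zero_iff_right two_ne_zero] at h
      exact h
    rw [LinearMap.mk₂_apply, hβ, Λ.bracket_self, h0, map_zero, sub_zero, map_zero]
  · have h1 := h.mul_eq (u x) (β y z)
    have h2 := h.mul_eq (u y) (β x z)
    rw [hu] at h1 h2
    simp only [LinearMap.mk₂_apply, map_add, ← h1, ← h2, hβ, map_mul, M.leibniz, Λ.leibniz]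
    ring
  · have hb : ∀ a b c : R, τ (Λ.bracket a (β b c)) =
        M.bracket (u a) (M.bracket (u b) (u c)) - M.bracket (u a) (u (Λ.bracket b c)) := by
      intro a b c
      rw [← map_sub, ← hβ, h.bracket_eq, hu]
    -- Closedness is the Jacobi identity of `M` on lifted elements minus the image under `u` of the
    -- Jacobi identity of `Λ`.
    have j1 := M.jacobi (u x) (u y) (u z)
    have j2 := congrArg u (Λ.jacobi x y z)
    simp only [map_add, map_zero] at j2
    simp only [LinearMap.mk₂_apply, map_add, hb, hβ, map_zero]
    linear_combination j1 - j2

/-- The brackets of two elements in the image of `τ` vanish, so changing a section by `D` changes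
its defect exactly linearly, by [Λ, D]. This is the compatibility condition of a hypercocycle. -/
lemma bivector_sub (u v : R →ₐ[k] C) (hu : ∀ a, p (u a) = a) (D : R →ₗ[k] R)
    (hD : ∀ a, τ (D a) = u a - v a) (β γ : R →ₗ[k] R →ₗ[k] R)
    (hβ : ∀ a b, τ (β a b) = M.bracket (u a) (u b) - u (Λ.bracket a b))
    (hγ : ∀ a b, τ (γ a b) = M.bracket (v a) (v b) - v (Λ.bracket a b)) (a b : R) :
    Λ.bracket a (D b) + Λ.bracket (D a) b - D (Λ.bracket a b) = β a b - γ a b := by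
  apply h.injective
  have hv : ∀ a, v a = u a - τ (D a) := fun a => by rw [hD]; ring
  simp only [map_add, map_sub, hβ, hγ, hv, LinearMap.sub_apply, h.bracket_eq, h.bracket_eq', hu,
    h.map_eq_zero, map_zero, LinearMap.zero_apply]
  ring

end IsSmallExtension

end SmallExtension

/-! ### Correcting local lifts in a system of Poisson algebras -/

section System

variable {k : Type*} [Field k] {ι : Type*} [Preorder ι] {R : ι → Type*}
  [∀ i, CommRing (R i)] [∀ i, Algebra k (R i)]

/-- Every hypercocycle of degree one of the system of Poisson algebras `R i` is a coboundary. -/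
def HypercocyclesBound (Λ : ∀ i, PoissonBracket k (R i)) (ρ : ∀ {i j}, i ≤ j → R j →ₐ[k] R i) :
    Prop :=
  ∀ (D : ∀ i j l, l ≤ i → l ≤ j → R l →ₗ[k] R l)
    (P : ∀ i l, l ≤ i → R l →ₗ[k] R l →ₗ[k] R l),
    (∀ i j l hi hj x y, D i j l hi hj (x * y) = x * D i j l hi hj y + y * D i j l hi hj x) →
    (∀ i j l m hi hj (h : m ≤ l) x,
      ρ h (D i j l hi hj x) = D i j m (h.trans hi) (h.trans hj) (ρ h x)) →
    (∀ i l hi x, P i l hi x x = 0) →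
    (∀ i l hi x y z, P i l hi (x * y) z = x * P i l hi y z + y * P i l hi x z) →
    (∀ i l m hi (h : m ≤ l) x y, ρ h (P i l hi x y) = P i m (h.trans hi) (ρ h x) (ρ h y)) →
    (∀ i l hi x y z, (Λ l).bracket x (P i l hi y z) + (Λ l).bracket y (P i l hi z x) +
      (Λ l).bracket z (P i l hi x y) + P i l hi x ((Λ l).bracket y z) +
      P i l hi y ((Λ l).bracket z x) + P i l hi z ((Λ l).bracket x y) = 0) →
    (∀ i j l hi hj x y, (Λ l).bracket x (D i j l hi hj y) + (Λ l).bracket (D i j l hi hj x) y -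
      D i j l hi hj ((Λ l).bracket x y) = P i l hi x y - P j l hj x y) →
    (∀ i j l m hi hj hl x, D i j m hi hj x + D j l m hj hl x = D i l m hi hl x) →
    ∃ E : ∀ i l, l ≤ i → R l →ₗ[k] R l,
      (∀ i l hi x y, E i l hi (x * y) = x * E i l hi y + y * E i l hi x) ∧
      (∀ i l m hi (h : m ≤ l) x, ρ h (E i l hi x) = E i m (h.trans hi) (ρ h x)) ∧
      (∀ i l hi x y, (Λ l).bracket x (E i l hi y) + (Λ l).bracket (E i l hi x) y -
        E i l hi ((Λ l).bracket x y) = P i l hi x y) ∧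
      ∀ i j l hi hj x, E i l hi x - E j l hj x = D i j l hi hj x

variable [CharZero k] {A : Type*} [CommRing A] [Algebra k A]
  {C C' : ι → Type*} [∀ i, CommRing (C i)] [∀ i, CommRing (C' i)]
  [∀ i, Algebra k (C i)] [∀ i, Algebra k (C' i)] [∀ i, Algebra A (C i)] [∀ i, Algebra A (C' i)]
  [∀ i, IsScalarTower k A (C i)] 

/-- Formal smoothness gives a lift on each chart, and formal étaleness carries it uniquely to
smaller charts. Differences of lifts and their Poisson defects form a hypercocycle; subtracting its
primitive makes the lifts agree and respect the brackets at once. -/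
lemma exists_lift_of_isSmallExtension {Λ : ∀ i, PoissonBracket k (R i)}
    {ρ : ∀ {i j}, i ≤ j → R j →ₐ[k] R i} (H : HypercocyclesBound Λ ρ)
    (M : ∀ i, PoissonBracket A (C i)) (M' : ∀ i, PoissonBracket A (C' i))
    [∀ i, Algebra.FormallySmooth k (R i)]
    (hρ : ∀ {i j} (h : i ≤ j), (ρ h).toRingHom.FormallyEtale)
    (ρρ : ∀ {i j l} (h : i ≤ j) (h' : j ≤ l) (x : R l), ρ h (ρ h' x) = ρ (h.trans h') x)
    (Λρ : ∀ {i j} (h : i ≤ j) (x y : R j), 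
      ρ h ((Λ j).bracket x y) = (Λ i).bracket (ρ h x) (ρ h y))
    (σ : ∀ {i j}, i ≤ j → C j →ₐ[k] C i) (σ' : ∀ {i j}, i ≤ j → C' j →ₐ[k] C' i)
    (σσ : ∀ {i j l} (h : i ≤ j) (h' : j ≤ l) (x : C l), σ h (σ h' x) = σ (h.trans h') x)
    (Mσ : ∀ {i j} (h : i ≤ j) (x y : C j),
      σ h ((M j).bracket x y) = (M i).bracket (σ h x) (σ h y))
    (p : ∀ i, C i →ₐ[k] R i) (τ : ∀ i, R i →ₗ[k] C i) (g : ∀ i, C i →ₐ[k] C' i)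
    (hτ : ∀ i, IsSmallExtension (Λ i) (M i) (p i) (τ i))
    (hg : ∀ i, Function.Surjective (g i)) (hn : ∀ i, IsNilpotent (RingHom.ker (g i)))
    (gτ : ∀ i x, g i (τ i x) = 0) (hgτ : ∀ i x, g i x = 0 → ∃ y, τ i y = x)
    (gM : ∀ i x y, g i ((M i).bracket x y) = (M' i).bracket (g i x) (g i y))
    (gσ : ∀ {i j} (h : i ≤ j) x, g i (σ h x) = σ' h (g j x))
    (τσ : ∀ {i j} (h : i ≤ j) x, τ i (ρ h x) = σ h (τ j x))
    (s : ∀ i, R i →ₐ[k] C' i) (hs : ∀ i c a, g i c = s i a → p i c = a)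
    (sσ : ∀ {i j} (h : i ≤ j) x, s i (ρ h x) = σ' h (s j x))
    (sM : ∀ i x y, s i ((Λ i).bracket x y) = (M' i).bracket (s i x) (s i y)) :
    ∃ t : ∀ i, R i →ₐ[k] C i, (∀ i a, g i (t i a) = s i a) ∧
      (∀ {i j} (h : i ≤ j) x, t i (ρ h x) = σ h (t j x)) ∧
      ∀ i x y, t i ((Λ i).bracket x y) = (M i).bracket (t i x) (t i y) := by
  choose w hw using fun i => exists_lift_of_formallySmooth (g i) (hg i) (hn i) (s i)
  -- `u i l` is the lift on the chart `l` induced by the one chosen on the larger chart `i`. It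
  -- depends on `i`, and this dependence is the vector field part `D` of the hypercocycle.
  have hex : ∀ i l (h : l ≤ i), ∃ u : R l →ₐ[k] C l, (∀ a, g l (u a) = s l a) ∧
      ∀ a, u (ρ h a) = σ h (w i a) := fun i l h =>
    exists_lift_of_formallyEtale (ρ h) (hρ h) (g l) (hg l) (hn l) (s l) ((σ h).comp (w i))
      fun a => by simp [gσ, hw, sσ]
  choose u hus hu using hex
  have hup : ∀ i l h a, p l (u i l h a) = a := fun i l h a => hs _ _ _ (hus i l h a)
  have huσ : ∀ i l m hi (h : m ≤ l) x,
      σ h (u i l hi x) = u i m (h.trans hi) (ρ h x) := by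
    intro i l m hi h x
    refine lift_unique_of_formallyEtale (u := (σ h).comp (u i l hi))
      (v := (u i m (h.trans hi)).comp (ρ h)) (ρ hi) (hρ hi) (g m) (hn m) (fun a => ?_)
      (fun a => ?_) x
    · simp [gσ, hus, sσ]
    · simp [ρρ, hu, σσ]
  have hdiff : ∀ i j l hi hj a, ∃ x, τ l x = u i l hi a - u j l hj a := fun i j l hi hj a =>
    hgτ _ _ (by rw [map_sub, hus, hus, sub_self])
  have hdef : ∀ i l hi a b, ∃ x, τ l x = (M l).bracket (u i l hi a) (u i l hi b) -
      u i l hi ((Λ l).bracket a b) := fun i l hi a b =>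
    hgτ _ _ (by rw [map_sub, gM, hus, hus, hus, sM, sub_self])
  choose D hD hDm using fun i j l hi hj => (hτ l).exists_derivation (u i l hi) (u j l hj)
    (hup i l hi) (hup j l hj) (hdiff i j l hi hj)
  choose P hP hP0 hPm hPc using fun i l hi => (hτ l).exists_bivector (u i l hi) (hup i l hi)
    (hdef i l hi)
  obtain ⟨E, hEm, hEρ, hEP, hED⟩ := H D P hDm
    (fun i j l m hi hj h x => (hτ m).injective (by rw [τσ, hD, hD, map_sub, huσ, huσ]))
    hP0 hPm
    (fun i l m hi h x y => (hτ m).injective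
      (by rw [τσ, hP, hP, map_sub, Mσ, huσ, huσ, huσ, Λρ])) hPc
    (fun i j l hi hj => (hτ l).bivector_sub _ _ (hup i l hi) _ (hD i j l hi hj) _ _ (hP i l hi)
      (hP j l hj))
    (fun i j l m hi hj hl x => (hτ m).injective (by simp only [map_add, hD]; ring))
  choose v hv using fun i l hi => (hτ l).exists_section (u i l hi) (hup i l hi) (E i l hi)
    (hEm i l hi)
  -- After correction the lift no longer depends on the larger chart, since `E i - E j = D i j`;
  -- hence the diagonal choice `v i i` is compatible with restriction.
  have hvv : ∀ i j l hi hj x, v i l hi x = v j l hj x := by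
    intro i j l hi hj x
    have := hD i j l hi hj x
    rw [← hED, map_sub] at this
    rw [hv, hv]
    linear_combination -this
  refine ⟨fun i => v i i le_rfl, fun i a => ?_, fun {i j} h x => ?_, fun i x y => ?_⟩
  · rw [hv, map_sub, gτ, sub_zero, hus]
  · rw [hvv i j i le_rfl h, hv, hv, map_sub, huσ _ _ _ _ h, ← τσ, hEρ]
  · have h1 := hP i i le_rfl x y
    rw [← hEP, map_sub, map_add] at h1
    simp only [hv, map_sub, LinearMap.sub_apply, (hτ i).bracket_eq, (hτ i).bracket_eq', hup,
      (hτ i).map_eq_zero, map_zero, LinearMap.zero_apply]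
    linear_combination h1

end System

/-- Take `J` maximal among the ideals strictly below `I`, and `t` in `I` outside `J`. Nakayama's
lemma keeps 𝔪I inside `J`, and an element carrying `t` into `J` cannot be a unit; so I/J is
one-dimensional over the residue field, spanned by `t`. -/
lemma exists_ideal_lt_of_ne_bot {A : Type*} [CommRing A] [IsLocalRing A] [IsNoetherianRing A]
    {I : Ideal A} (hI : I ≠ ⊥) : ∃ (J : Ideal A) (t : A), J < I ∧ t ∈ I ∧ I ≤ J ⊔ Ideal.span {t} ∧
      (∀ a, t * a ∈ J → a ∈ IsLocalRing.maximalIdeal A) ∧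
      ∀ a ∈ IsLocalRing.maximalIdeal A, t * a ∈ J := by
  obtain ⟨J, hJ, hmax⟩ := set_has_maximal_iff_noetherian.2 ‹IsNoetherianRing A› {J | J < I}
    ⟨⊥, bot_lt_iff_ne_bot.2 hI⟩
  replace hJ : J < I := hJ
  obtain ⟨t, htI, htJ⟩ := SetLike.exists_of_lt hJ
  -- By maximality, an ideal inside `I` that does not generate `I` together with `J` already lies in
  -- `J`.
  have hle : ∀ K : Ideal A, K ≤ I → ¬ I ≤ J ⊔ K → K ≤ J := fun K hK h => by
    by_contra hKJ
    exact hmax (J ⊔ K) (lt_of_le_of_ne (sup_le hJ.le hK) fun e => h e.ge) (left_lt_sup.2 hKJ)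
  refine ⟨J, t, hJ, htI, ?_, fun a ha => ?_, fun a ha => ?_⟩
  · by_contra h
    exact htJ (hle _ ((Ideal.span_singleton_le_iff_mem _).2 htI) h
      (Ideal.mem_span_singleton_self t))
  · rw [IsLocalRing.mem_maximalIdeal, mem_nonunits_iff]
    intro hu
    exact htJ ((Ideal.mul_unit_mem_iff_mem J hu).1 ha)
  · refine hle (IsLocalRing.maximalIdeal A • I) Submodule.smul_le_right (fun h => ?_) ?_
    · exact hJ.not_ge (Submodule.le_of_le_smul_of_le_jacobson_bot (IsNoetherian.noetherian I)
        (IsLocalRing.maximalIdeal_le_jacobson ⊥) h)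
    · rw [mul_comm]
      exact Submodule.smul_mem_smul ha htI

section

variable {A B B' : Type*} [CommRing A] [CommRing B] [Algebra A B] [CommRing B'] [Algebra A B']

/-- The map `B / I B → B' / I B'` induced by a map of `A`-algebras. -/
def quotientMapIdeal (I : Ideal A) (φ : B →ₐ[A] B') :
    B ⧸ I.map (algebraMap A B) →ₐ[A] B' ⧸ I.map (algebraMap A B') :=
  Ideal.quotientMapₐ _ φ (by
    rw [Ideal.map_le_iff_le_comap]
    intro a ha
    simp only [Ideal.mem_comap, AlgHom.commutes]
    exact Ideal.mem_map_of_mem _ ha)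

@[simp]
lemma quotientMapIdeal_mk (I : Ideal A) (φ : B →ₐ[A] B') (b : B) :
    quotientMapIdeal I φ (Ideal.Quotient.mk _ b) = Ideal.Quotient.mk _ (φ b) := rfl

end

section SmallExtension

variable {k A B R : Type*} [Field k] [CommRing A] [CommRing B] [CommRing R]
  [Algebra k B] [Algebra k R] [Algebra A B] [IsLocalRing A]

/-- The embedding is multiplication by `t`. It is well defined on R = B/𝔪B because t𝔪 ⊆ J, and
injective because flatness turns `(J : t) ≤ 𝔪` into `(JB : t) ≤ 𝔪B`. The bracket formula holds
because `t` comes from the base and the bracket is `A`-linear. -/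
lemma exists_isSmallExtension_quotient [Module.Flat A B] (M : PoissonBracket A B)
    (Λ : PoissonBracket k R)
    (q : B →ₐ[k] R) (hq : Function.Surjective q)
    (hker : RingHom.ker q = (IsLocalRing.maximalIdeal A).map (algebraMap A B))
    (hM : ∀ x y, q (M.bracket x y) = Λ.bracket (q x) (q y)) {I J : Ideal A} {t : A} (hJI : J < I)
    (hI : I ≤ IsLocalRing.maximalIdeal A)
    (ht : t ∈ I) (hIJ : I ≤ J ⊔ Ideal.span {t})
    (h1 : ∀ a, t * a ∈ J → a ∈ IsLocalRing.maximalIdeal A)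
    (h2 : ∀ a ∈ IsLocalRing.maximalIdeal A, t * a ∈ J) :
    ∃ (p : B ⧸ J.map (algebraMap A B) →ₐ[k] R) (τ : R →ₗ[k] B ⧸ J.map (algebraMap A B)),
      IsSmallExtension Λ (M.quotient J) p τ ∧ (∀ b, p (Ideal.Quotient.mk _ b) = q b) ∧
      (∀ b, τ (q b) = Ideal.Quotient.mk _ (algebraMap A B t * b)) ∧
      (∀ x, τ x ∈ (I.map (algebraMap A B)).map (Ideal.Quotient.mk (J.map (algebraMap A B)))) ∧
      ∀ b ∈ I.map (algebraMap A B), ∃ x, τ x = Ideal.Quotient.mk _ b := by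
  have hker' : ∀ b, q b = 0 ↔ b ∈ (IsLocalRing.maximalIdeal A).map (algebraMap A B) := fun b => by
    rw [← hker]; rfl
  have hmul : ∀ b ∈ (IsLocalRing.maximalIdeal A).map (algebraMap A B),
      algebraMap A B t * b ∈ J.map (algebraMap A B) := by
    intro b hb
    have := Ideal.mul_mem_mul (Ideal.mem_span_singleton_self (algebraMap A B t)) hb
    rw [← Set.image_singleton, ← Ideal.map_span, ← Ideal.map_mul] at this
    refine Ideal.map_mono ?_ this
    rw [Ideal.span_singleton_mul_le_iff]
    exact h2
  have key : ∀ b, Ideal.Quotient.mk (J.map (algebraMap A B))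
      (algebraMap A B t * Function.surjInv hq (q b)) =
        Ideal.Quotient.mk _ (algebraMap A B t * b) := by
    intro b
    rw [Ideal.Quotient.eq, ← mul_sub]
    refine hmul _ ((hker' _).1 ?_)
    rw [map_sub, Function.surjInv_eq hq, sub_self]
  let τ : R →ₗ[k] B ⧸ J.map (algebraMap A B) :=
    { toFun := fun x => Ideal.Quotient.mk _ (algebraMap A B t * Function.surjInv hq x)
      map_add' := hq.forall.2 fun x => hq.forall.2 fun y => by
        rw [← map_add, key, key, key, mul_add, map_add]
      map_smul' := fun c => hq.forall.2 fun x => by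
        rw [← map_smul, key, key, mul_smul_comm]
        rfl }
  have hτ : ∀ b, τ (q b) = Ideal.Quotient.mk _ (algebraMap A B t * b) := key
  let p : B ⧸ J.map (algebraMap A B) →ₐ[k] R := Ideal.Quotient.liftₐ _ q fun b hb =>
    (hker' b).2 (Ideal.map_mono (hJI.le.trans hI) hb)
  have hp : ∀ b, p (Ideal.Quotient.mk _ b) = q b := fun b => rfl
  refine ⟨p, τ, ⟨?_, ?_, ?_, ?_⟩, hp, hτ, ?_, ?_⟩
  · rw [injective_iff_map_eq_zero]
    refine hq.forall.2 fun b hb => ?_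
    rw [hτ, Ideal.Quotient.eq_zero_iff_mem] at hb
    exact (hker' b).2 (mem_map_of_mul_mem_map h1 hb)
  · refine hq.forall.2 fun b => ?_
    rw [hτ, hp, hker']
    exact Ideal.mul_mem_right _ _ (Ideal.mem_map_of_mem _ (hI ht))
  · refine Ideal.Quotient.mk_surjective.forall.2 fun c => hq.forall.2 fun b => ?_
    rw [hp, ← map_mul, hτ, hτ, ← map_mul, mul_left_comm]
  · refine Ideal.Quotient.mk_surjective.forall.2 fun c => hq.forall.2 fun b => ?_
    rw [hp, ← hM, hτ, hτ, M.quotient_mk, ← Algebra.smul_def, ← Algebra.smul_def, map_smul]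
  · refine hq.forall.2 fun b => ?_
    rw [hτ]
    exact Ideal.mem_map_of_mem _ (Ideal.mul_mem_right _ _ (Ideal.mem_map_of_mem _ ht))
  · intro b hb
    have := Ideal.map_mono (f := algebraMap A B) hIJ hb
    rw [Ideal.map_sup, Ideal.map_span, Set.image_singleton, Submodule.mem_sup] at this
    obtain ⟨j, hj, y, hy, rfl⟩ := this
    obtain ⟨c, rfl⟩ := Ideal.mem_span_singleton.1 hy
    refine ⟨q c, ?_⟩
    rw [hτ, map_add, Ideal.Quotient.eq_zero_iff_mem.2 hj, zero_add]

end SmallExtension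

/-! ### Descent through the ideals of the Artinian base -/

section System

variable {k : Type*} [Field k] [CharZero k] {ι : Type*} [Preorder ι] {R : ι → Type*}
  [∀ i, CommRing (R i)] [∀ i, Algebra k (R i)]
  {A : Type*} [CommRing A] [Algebra k A] [IsLocalRing A] [IsArtinianRing A]
  {B : ι → Type*} [∀ i, CommRing (B i)] [∀ i, Algebra k (B i)] [∀ i, Algebra A (B i)]
  [∀ i, IsScalarTower k A (B i)] [∀ i, Module.Flat A (B i)]

/-- A compatible family of sections of flat deformations of formally smooth Poisson algebras. -/
theorem exists_poisson_sections {Λ : ∀ i, PoissonBracket k (R i)}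
    {ρ : ∀ {i j}, i ≤ j → R j →ₐ[k] R i} (H : HypercocyclesBound Λ ρ)
    (M : ∀ i, PoissonBracket A (B i))
    [∀ i, Algebra.FormallySmooth k (R i)]
    (hρ : ∀ {i j} (h : i ≤ j), (ρ h).toRingHom.FormallyEtale)
    (ρρ : ∀ {i j l} (h : i ≤ j) (h' : j ≤ l) (x : R l), ρ h (ρ h' x) = ρ (h.trans h') x)
    (Λρ : ∀ {i j} (h : i ≤ j) (x y : R j), 
      ρ h ((Λ j).bracket x y) = (Λ i).bracket (ρ h x) (ρ h y))
    (σ : ∀ {i j}, i ≤ j → B j →ₐ[A] B i)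
    (σσ : ∀ {i j l} (h : i ≤ j) (h' : j ≤ l) (x : B l), σ h (σ h' x) = σ (h.trans h') x)
    (Mσ : ∀ {i j} (h : i ≤ j) (x y : B j),
      σ h ((M j).bracket x y) = (M i).bracket (σ h x) (σ h y))
    (q : ∀ i, B i →ₐ[k] R i) (hq : ∀ i, Function.Surjective (q i))
    (hker : ∀ i, RingHom.ker (q i) = (IsLocalRing.maximalIdeal A).map (algebraMap A (B i)))
    (qM : ∀ i x y, q i ((M i).bracket x y) = (Λ i).bracket (q i x) (q i y))
    (qσ : ∀ {i j} (h : i ≤ j) x, q i (σ h x) = ρ h (q j x)) :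
    ∃ s : ∀ i, R i →ₐ[k] B i, (∀ i a, q i (s i a) = a) ∧
      (∀ {i j} (h : i ≤ j) x, s i (ρ h x) = σ h (s j x)) ∧
      ∀ i x y, s i ((Λ i).bracket x y) = (M i).bracket (s i x) (s i y) := by
  -- The condition on `Ideal.Quotient.mk _ b = s i a` says that `s i` is a section of the reduction
  -- B/IB → R, without introducing that map.
  let P : Ideal A → Prop := fun I => I ≤ IsLocalRing.maximalIdeal A ∧
    ∃ s : ∀ i, R i →ₐ[k] B i ⧸ I.map (algebraMap A (B i)),
      (∀ i b a, Ideal.Quotient.mk _ b = s i a → q i b = a) ∧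
      (∀ {i j} (h : i ≤ j) x, s i (ρ h x) = (quotientMapIdeal I (σ h)) (s j x)) ∧
      ∀ i x y, s i ((Λ i).bracket x y) = ((M i).quotient I).bracket (s i x) (s i y)
  have hP0 : P (IsLocalRing.maximalIdeal A) := by
    refine ⟨le_rfl, ?_⟩
    have hex : ∀ i, ∃ s : R i →ₐ[k] B i ⧸ (IsLocalRing.maximalIdeal A).map (algebraMap A (B i)),
        ∀ b, s (q i b) = Ideal.Quotient.mk _ b := by
      intro i
      refine ⟨((Ideal.quotientEquivAlgOfEq k (hker i)).toAlgHom.comp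
        (Ideal.quotientKerAlgEquivOfSurjective (hq i)).symm.toAlgHom), fun b => ?_⟩
      have : (Ideal.quotientKerAlgEquivOfSurjective (hq i)).symm (q i b) =
          Ideal.Quotient.mk _ b := by
        rw [AlgEquiv.symm_apply_eq]; rfl
      rw [AlgHom.comp_apply]
      exact congrArg (Ideal.quotientEquivAlgOfEq k (hker i)) this
    choose s hs using hex
    refine ⟨s, fun i b a h => ?_, fun {i j} h => (hq j).forall.2 fun b => ?_,
      fun i => (hq i).forall.2 fun x => (hq i).forall.2 fun y => ?_⟩
    · obtain ⟨c, rfl⟩ := hq i a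
      rw [hs, Ideal.Quotient.eq, ← hker, RingHom.mem_ker, map_sub, sub_eq_zero] at h
      exact h
    · rw [← qσ, hs, hs, quotientMapIdeal_mk]
    · rw [← qM, hs, hs, hs, PoissonBracket.quotient_mk]
  -- The ring `A` is Artinian, so an ideal minimal with this property exists; it will be shown to be
  -- zero.
  obtain ⟨I, hPI, hmin⟩ := wellFounded_lt.has_min {I | P I} ⟨_, hP0⟩
  obtain ⟨hIm, s, hs, sσ, sM⟩ := hPI
  by_cases hI : I = ⊥
  · subst hI
    have hbot : ∀ i, (⊥ : Ideal A).map (algebraMap A (B i)) = ⊥ := fun i => Ideal.map_bot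
    have hex : ∀ i, ∃ t : R i →ₐ[k] B i, ∀ a, Ideal.Quotient.mk _ (t a) = s i a := by
      intro i
      let e := (Ideal.quotientEquivAlgOfEq k (hbot i)).trans (AlgEquiv.quotientBot k (B i))
      refine ⟨e.toAlgHom.comp (s i), fun a => ?_⟩
      obtain ⟨b, hb⟩ := Ideal.Quotient.mk_surjective (s i a)
      simp only [AlgHom.comp_apply, ← hb]
      rfl
    choose t ht using hex
    have hinj : ∀ i (x y : B i), Ideal.Quotient.mk ((⊥ : Ideal A).map (algebraMap A (B i))) x =
        Ideal.Quotient.mk _ y → x = y := fun i x y h => by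
      rwa [Ideal.Quotient.eq, hbot, Ideal.mem_bot, sub_eq_zero] at h
    refine ⟨t, fun i a => hs i _ a (ht i a), fun {i j} h x => hinj i _ _ ?_,
      fun i x y => hinj i _ _ ?_⟩
    · rw [ht, sσ, ← ht, quotientMapIdeal_mk]
    · rw [ht, sM, ← ht, ← ht, PoissonBracket.quotient_mk]
  · exfalso
    obtain ⟨J, t, hJI, htI, hIJ, h1, h2⟩ := exists_ideal_lt_of_ne_bot hI
    refine hmin J ?_ hJI
    choose p τ hτ hp hτq hτI hIτ using fun i => exists_isSmallExtension_quotient (M i) (Λ i) (q i)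
      (hq i) (hker i) (qM i) hJI hIm htI hIJ h1 h2
    have hle : ∀ i, J.map (algebraMap A (B i)) ≤ I.map (algebraMap A (B i)) :=
      fun i => Ideal.map_mono hJI.le
    let g : ∀ i, B i ⧸ J.map (algebraMap A (B i)) →ₐ[k] B i ⧸ I.map (algebraMap A (B i)) :=
      fun i => Ideal.Quotient.factorₐ k (hle i)
    have hgmk : ∀ i b, g i (Ideal.Quotient.mk _ b) = Ideal.Quotient.mk _ b := fun i b => rfl
    have gτ : ∀ i x, g i (τ i x) = 0 := fun i => (hq i).forall.2 fun b => by
      rw [hτq, hgmk, Ideal.Quotient.eq_zero_iff_mem]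
      exact Ideal.mul_mem_right _ _ (Ideal.mem_map_of_mem _ htI)
    have hgτ : ∀ i x, g i x = 0 → ∃ y, τ i y = x := fun i =>
      Ideal.Quotient.mk_surjective.forall.2 fun b hb => by
        rw [hgmk, Ideal.Quotient.eq_zero_iff_mem] at hb
        exact hIτ i b hb
    have hn : ∀ i, IsNilpotent (RingHom.ker (g i)) := by
      refine fun i => ⟨2, ?_⟩
      rw [sq, Ideal.zero_eq_bot, eq_bot_iff, Ideal.mul_le]
      intro x hx y hy
      obtain ⟨x, rfl⟩ := hgτ i x hx
      obtain ⟨y, rfl⟩ := hgτ i y hy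
      exact (hτ i).mul_eq_zero x y
    obtain ⟨s', hs', s'σ, s'M⟩ := exists_lift_of_isSmallExtension H (fun i => (M i).quotient J)
      (fun i => (M i).quotient I) hρ ρρ Λρ
      (fun h => (quotientMapIdeal J (σ h)).restrictScalars k)
      (fun h => (quotientMapIdeal I (σ h)).restrictScalars k)
      (fun h h' => Ideal.Quotient.mk_surjective.forall.2 fun x => by simp [σσ])
      (fun h => Ideal.Quotient.mk_surjective.forall.2 fun x =>
        Ideal.Quotient.mk_surjective.forall.2 fun y => by
          simp [PoissonBracket.quotient_mk, Mσ])
      p τ g hτ (fun i => Ideal.Quotient.factor_surjective (hle i)) hn gτ hgτ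
      (fun i => Ideal.Quotient.mk_surjective.forall.2 fun x =>
        Ideal.Quotient.mk_surjective.forall.2 fun y => by
          simp [PoissonBracket.quotient_mk, hgmk])
      (fun h => Ideal.Quotient.mk_surjective.forall.2 fun x => by simp [hgmk])
      (fun {i j} h => (hq j).forall.2 fun x => by
        rw [← qσ, hτq, hτq]
        simp)
      s (fun i => Ideal.Quotient.mk_surjective.forall.2 fun b a h => by
        rw [hp]; exact hs i b a h)
      (fun h x => by simp [sσ]) sM
    refine ⟨hJI.le.trans hIm, s', fun i b a h => hs i b a ?_, fun h x => s'σ h x, s'M⟩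
    rw [← hs', ← h, hgmk]

end System

/-! ### Cartesian squares in terms of rings of sections -/

section Pullback
open Limits

lemma le_preimage_top {X Y : Scheme.{u}} (f : X ⟶ Y) (U : X.Opens) : U ≤ f ⁻¹ᵁ ⊤ := le_top

lemma isIso_of_isPushout {C : Type*} [Category* C] {X Y Z P Q : C} {f : Z ⟶ X} {g : Z ⟶ Y}
    {i : X ⟶ P} {j : Y ⟶ P} {i' : X ⟶ Q} {j' : Y ⟶ Q} (h : IsPushout f g i j)
    (h' : IsPushout f g i' j') (φ : P ⟶ Q) (hi : i ≫ φ = i') (hj : j ≫ φ = j') : IsIso φ := by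
  have : φ = (h.isoIsPushout _ _ h').hom := h.hom_ext (by simp [hi]) (by simp [hj])
  rw [this]
  infer_instance

lemma isPushout_sections {P X Y Z : Scheme.{u}} {fst : P ⟶ X} {snd : P ⟶ Y} {f : X ⟶ Z} {g : Y ⟶ Z}
    [IsAffine Y] [IsAffine Z] (H : IsPullback fst snd f g) {U : X.Opens} (hU : IsAffineOpen U) :
    IsPushout (f.appLE ⊤ U (le_preimage_top _ _)) (g.appLE ⊤ ⊤ (le_preimage_top _ _)) (fst.appLE U (fst ⁻¹ᵁ U) le_rfl)
      (snd.appLE ⊤ (fst ⁻¹ᵁ U) (le_preimage_top _ _)) :=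
  (isIso_pushoutSection_iff H (US := ⊤) (UT := ⊤) (le_preimage_top _ _) (le_preimage_top _ _) (UY := fst ⁻¹ᵁ U) (inf_top_eq _).symm).1
    (isIso_pushoutSection_of_isAffineOpen H _ _ (by simp) (isAffineOpen_top Z)
      (isAffineOpen_top Y) hU)

/-- Both `P → X` and `L` are affine, so bijectivity of `L` can be tested on sections over the
preimages of the `U i`. There source and target are pushouts of the same pair of ring maps. -/
lemma isIso_of_isPushout_sections {Q P X Y Z : Scheme.{u}} {fst : P ⟶ X} {snd : P ⟶ Y} {f : X ⟶ Z}
    {g : Y ⟶ Z} [IsAffine Y] [IsAffine Z] (H : IsPullback fst snd f g) (L : Q ⟶ P)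
    {ι : Type*} (U : ι → X.Opens) (hU : iSup U = ⊤) (hUa : ∀ i, IsAffineOpen (U i))
    (hUQ : ∀ i, IsAffineOpen ((L ≫ fst) ⁻¹ᵁ U i))
    (hpo : ∀ i, IsPushout (f.appLE ⊤ (U i) (le_preimage_top _ _)) (g.appLE ⊤ ⊤ (le_preimage_top _ _))
      ((L ≫ fst).appLE (U i) ((L ≫ fst) ⁻¹ᵁ U i) le_rfl)
      ((L ≫ snd).appLE ⊤ ((L ≫ fst) ⁻¹ᵁ U i) (le_preimage_top _ _))) : IsIso L := by
  have : IsAffineHom g := inferInstance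
  have : IsAffineHom fst := MorphismProperty.of_isPullback H.flip ‹_›
  have hsup : ⨆ i, fst ⁻¹ᵁ U i = ⊤ := by rw [← Scheme.Hom.preimage_iSup, hU]; rfl
  have hV : ∀ i, IsAffineOpen (fst ⁻¹ᵁ U i) := fun i => (hUa i).preimage fst
  have : IsAffineHom L := isAffineHom_of_forall_exists_isAffineOpen _ fun x => by
    obtain ⟨i, hi⟩ := Opens.mem_iSup.1 (hsup.ge (Opens.mem_top x))
    exact ⟨_, hi, hV i, hUQ i⟩
  refine (IsZariskiLocalAtTarget.iff_of_iSup_eq_top (P := MorphismProperty.isomorphisms Scheme)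
    _ hsup).2 fun i => ?_
  change IsIso _
  rw [isIso_morphismRestrict_iff_isIso_app L (hV i)]
  refine isIso_of_isPushout (isPushout_sections H (hUa i)) (hpo i) _ ?_ ?_
  · rw [Scheme.Hom.app_eq_appLE]
    exact Scheme.Hom.appLE_comp_appLE ..
  · rw [Scheme.Hom.app_eq_appLE]
    exact Scheme.Hom.appLE_comp_appLE ..

lemma isPullback_of_isPushout_sections {P X Y Z : Scheme.{u}} {fst : P ⟶ X} {snd : P ⟶ Y}
    {f : X ⟶ Z} {g : Y ⟶ Z} [IsAffine Y] [IsAffine Z] (w : fst ≫ f = snd ≫ g)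
    {ι : Type*} (U : ι → X.Opens) (hU : iSup U = ⊤) (hUa : ∀ i, IsAffineOpen (U i))
    (hUP : ∀ i, IsAffineOpen (fst ⁻¹ᵁ U i))
    (hpo : ∀ i, IsPushout (f.appLE ⊤ (U i) (le_preimage_top _ _)) (g.appLE ⊤ ⊤ (le_preimage_top _ _))
      (fst.appLE (U i) (fst ⁻¹ᵁ U i) le_rfl) (snd.appLE ⊤ (fst ⁻¹ᵁ U i) (le_preimage_top _ _))) :
    IsPullback fst snd f g := by
  obtain ⟨L, rfl, rfl⟩ : ∃ L : P ⟶ pullback f g, L ≫ pullback.fst f g = fst ∧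
    L ≫ pullback.snd f g = snd := ⟨pullback.lift fst snd w, pullback.lift_fst _ _ _, pullback.lift_snd _ _ _⟩
  have := isIso_of_isPushout_sections (IsPullback.of_hasPullback f g) L U hU hUa hUP hpo
  exact IsPullback.of_iso_pullback ⟨w⟩ (asIso L) rfl rfl

end Pullback

section Sections
open Limits

variable {R S : Type u} [CommRing R] [CommRing S] {X Y : Scheme.{u}}
  {f : X ⟶ Spec (.of S)} {g : Y ⟶ Spec (.of R)} {φ : X ⟶ Y}

/-- The type synonym `Sections f V` for `Γ(X, V)`. -/
def sectionsIso (f : X ⟶ Spec (.of S)) (V : X.Opens) : Γ(X, V) ≅ CommRingCat.of (Sections f V) :=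
  Iso.refl _

lemma algebraMap_sections (f : X ⟶ Spec (.of S)) (V : X.Opens) :
    CommRingCat.ofHom (algebraMap S (Sections f V)) =
      (Scheme.ΓSpecIso (.of S)).inv ≫ f.appLE ⊤ V (le_preimage_top f V) ≫ (sectionsIso f V).hom :=
  rfl

lemma ofHom_pullback (f : X ⟶ Spec (.of S)) (g : Y ⟶ Spec (.of R)) (φ : X ⟶ Y) (V : Y.Opens) :
    CommRingCat.ofHom (Sections.pullback f g φ V) =
      (sectionsIso g V).inv ≫ φ.appLE V (φ ⁻¹ᵁ V) le_rfl ≫ (sectionsIso f (φ ⁻¹ᵁ V)).hom := by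
  rw [← Scheme.Hom.app_eq_appLE]
  rfl

lemma Sections.pullback_res (f : X ⟶ Spec (.of S)) (g : Y ⟶ Spec (.of R)) (φ : X ⟶ Y)
    {V W : Y.Opens} (h : W ≤ V) (s : Sections g V) :
    Sections.pullback f g φ W (Sections.res g h s) =
      Sections.res f (φ.preimage_mono h) (Sections.pullback f g φ V s) :=
  congr(($(φ.naturality (homOfLE h).op)).hom s)

lemma algebraMap_comp_app (h : R →+* S) (w : φ ≫ g = f ≫ Spec.map (CommRingCat.ofHom h))
    (V : Y.Opens) : CommRingCat.ofHom (algebraMap R (Sections g V)) ≫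
      CommRingCat.ofHom (Sections.pullback f g φ V) =
    CommRingCat.ofHom h ≫ CommRingCat.ofHom (algebraMap S (Sections f (φ ⁻¹ᵁ V))) := by
  rw [algebraMap_sections, algebraMap_sections, ofHom_pullback]
  have h1 : (Spec.map (CommRingCat.ofHom h)).appLE ⊤ ⊤ (le_preimage_top _ _) =
      (Scheme.ΓSpecIso (.of R)).hom ≫ CommRingCat.ofHom h ≫ (Scheme.ΓSpecIso (.of S)).inv := by
    rw [← Iso.inv_comp_eq, Scheme.ΓSpecIso_inv_naturality]
    rfl
  have h2 : g.appLE ⊤ V (le_preimage_top _ _) ≫ φ.appLE V (φ ⁻¹ᵁ V) le_rfl =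
      (Spec.map (CommRingCat.ofHom h)).appLE ⊤ ⊤ (le_preimage_top _ _) ≫
        f.appLE ⊤ (φ ⁻¹ᵁ V) (le_preimage_top _ _) := by
    rw [Scheme.Hom.appLE_comp_appLE, Scheme.Hom.appLE_comp_appLE]
    simp only [w]
  simp only [Category.assoc, Iso.hom_inv_id_assoc]
  rw [reassoc_of% h2, h1]
  simp only [Category.assoc, Iso.inv_hom_id_assoc]

lemma Sections.pullback_algebraMap (h : R →+* S) (w : φ ≫ g = f ≫ Spec.map (CommRingCat.ofHom h))
    (V : Y.Opens) (r : R) : Sections.pullback f g φ V (algebraMap R _ r) = algebraMap S _ (h r) :=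
  congr(($(algebraMap_comp_app h w V)).hom r)

lemma isPushout_sections_iff (h : R →+* S) (V : Y.Opens) :
    IsPushout (g.appLE ⊤ V (le_preimage_top _ _))
      ((Spec.map (CommRingCat.ofHom h)).appLE ⊤ ⊤ (le_preimage_top _ _))
      (φ.appLE V (φ ⁻¹ᵁ V) le_rfl) (f.appLE ⊤ (φ ⁻¹ᵁ V) (le_preimage_top _ _)) ↔
    IsPushout (CommRingCat.ofHom (algebraMap R (Sections g V))) (CommRingCat.ofHom h)
      (CommRingCat.ofHom (Sections.pullback f g φ V))
      (CommRingCat.ofHom (algebraMap S (Sections f (φ ⁻¹ᵁ V)))) := by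
  have e1 : (Spec.map (CommRingCat.ofHom h)).appLE ⊤ ⊤ (le_preimage_top _ _) ≫
      (Scheme.ΓSpecIso (.of S)).hom = (Scheme.ΓSpecIso (.of R)).hom ≫ CommRingCat.ofHom h := by
    rw [← Scheme.ΓSpecIso_naturality]
    rfl
  constructor
  · intro H
    exact H.of_iso (Scheme.ΓSpecIso (.of R)) (sectionsIso g V) (Scheme.ΓSpecIso (.of S))
      (sectionsIso f _) (by simp [algebraMap_sections]) e1 (by simp [ofHom_pullback])
      (by simp [algebraMap_sections])
  · intro H
    exact H.of_iso (Scheme.ΓSpecIso (.of R)).symm (sectionsIso g V).symm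
      (Scheme.ΓSpecIso (.of S)).symm (sectionsIso f _).symm (by simp [algebraMap_sections])
      (by rw [Iso.symm_hom, Iso.symm_hom, Iso.comp_inv_eq, Category.assoc, e1,
        Iso.inv_hom_id_assoc]) (by simp [ofHom_pullback]) (by simp [algebraMap_sections])

lemma isPushout_of_isPullback (h : R →+* S)
    (H : IsPullback φ f g (Spec.map (CommRingCat.ofHom h))) {V : Y.Opens} (hV : IsAffineOpen V) :
    IsPushout (CommRingCat.ofHom (algebraMap R (Sections g V))) (CommRingCat.ofHom h)
      (CommRingCat.ofHom (Sections.pullback f g φ V))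
      (CommRingCat.ofHom (algebraMap S (Sections f (φ ⁻¹ᵁ V)))) :=
  (isPushout_sections_iff h V).1 (isPushout_sections H hV)

lemma isPullback_of_isPushout (h : R →+* S) (w : φ ≫ g = f ≫ Spec.map (CommRingCat.ofHom h))
    {ι : Type*} (U : ι → Y.Opens) (hU : iSup U = ⊤) (hUa : ∀ i, IsAffineOpen (U i))
    (hUP : ∀ i, IsAffineOpen (φ ⁻¹ᵁ U i))
    (H : ∀ i, IsPushout (CommRingCat.ofHom (algebraMap R (Sections g (U i)))) (CommRingCat.ofHom h)
      (CommRingCat.ofHom (Sections.pullback f g φ (U i)))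
      (CommRingCat.ofHom (algebraMap S (Sections f (φ ⁻¹ᵁ (U i)))))) :
    IsPullback φ f g (Spec.map (CommRingCat.ofHom h)) :=
  isPullback_of_isPushout_sections w U hU hUa hUP fun i =>
    (isPushout_sections_iff h (U i)).2 (H i)

/-- A cobase change of a surjection is a surjection, with kernel generated by the kernel. -/
lemma surjective_and_ker_of_isPushout {A B k R : Type u} [CommRing A] [CommRing B] [CommRing k]
    [CommRing R] {a : A →+* B} {r : A →+* k} {q : B →+* R} {b : k →+* R}
    (H : IsPushout (CommRingCat.ofHom a) (CommRingCat.ofHom r) (CommRingCat.ofHom q)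
      (CommRingCat.ofHom b)) (hr : Function.Surjective r) :
    Function.Surjective q ∧ RingHom.ker q = (RingHom.ker r).map a := by
  have hw : ∀ x, q (a x) = b (r x) := fun x => congr(($H.w).hom x)
  let I := (RingHom.ker r).map a
  have hI : I ≤ RingHom.ker q := by
    rw [Ideal.map_le_iff_le_comap]
    intro x hx
    rw [Ideal.mem_comap, RingHom.mem_ker, hw, (RingHom.mem_ker).1 hx, map_zero]
  let c : k →+* B ⧸ I := RingHom.liftOfSurjective r hr ⟨(Ideal.Quotient.mk I).comp a, fun x hx =>
    Ideal.Quotient.eq_zero_iff_mem.2 (Ideal.mem_map_of_mem _ hx)⟩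
  have hc : ∀ x, c (r x) = Ideal.Quotient.mk I (a x) := fun x =>
    RingHom.liftOfRightInverse_comp_apply ..
  -- The quotient B/I solves the same universal problem. The map `d` shows that the kernel of `q` is
  -- no larger than `I`, and `d ≫ e = 𝟙` gives surjectivity.
  let d : CommRingCat.of R ⟶ CommRingCat.of (B ⧸ I) := H.desc (CommRingCat.ofHom
    (Ideal.Quotient.mk I)) (CommRingCat.ofHom c) (by ext x; exact (hc x).symm)
  have hd : ∀ x, d.hom (q x) = Ideal.Quotient.mk I x := fun x =>
    congr(($(H.inl_desc _ _ _)).hom x)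
  have hd' : ∀ x, d.hom (b x) = c x := fun x => congr(($(H.inr_desc _ _ _)).hom x)
  let e : CommRingCat.of (B ⧸ I) ⟶ CommRingCat.of R := CommRingCat.ofHom (Ideal.Quotient.lift I q hI)
  have he : ∀ x, e.hom (Ideal.Quotient.mk I x) = q x := fun x => rfl
  have hde : d ≫ e = 𝟙 _ := by
    refine H.hom_ext ?_ ?_
    · ext x
      change e.hom (d.hom (q x)) = q x
      rw [hd, he]
    · ext x
      obtain ⟨x, rfl⟩ := hr x
      change e.hom (d.hom (b (r x))) = b (r x)
      rw [hd', hc, he, hw]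
  refine ⟨fun y => ?_, le_antisymm (fun x hx => ?_) hI⟩
  · obtain ⟨x, hx⟩ := Ideal.Quotient.mk_surjective (d.hom y)
    refine ⟨x, ?_⟩
    rw [← he, hx]
    exact congr(($hde).hom y)
  · rw [← Ideal.Quotient.eq_zero_iff_mem, ← hd, (RingHom.mem_ker).1 hx, map_zero]

lemma Sections.flat (g : Y ⟶ Spec (.of R)) [Flat g] {V : Y.Opens} (hV : IsAffineOpen V) :
    Module.Flat R (Sections g V) :=
  RingHom.flat_algebraMap_iff.1 <|
    (RingHom.Flat.of_bijective (ConcreteCategory.bijective_of_isIso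
      (Scheme.ΓSpecIso (.of R)).inv)).comp
      (g.flat_appLE (isAffineOpen_top _) hV (le_preimage_top _ _))

lemma Sections.formallySmooth (g : Y ⟶ Spec (.of R)) [Smooth g] {V : Y.Opens}
    (hV : IsAffineOpen V) : Algebra.FormallySmooth R (Sections g V) :=
  RingHom.formallySmooth_algebraMap.1 <|
    (RingHom.FormallySmooth.of_bijective (ConcreteCategory.bijective_of_isIso
      (Scheme.ΓSpecIso (.of R)).inv)).comp
      (g.smooth_appLE (isAffineOpen_top _) hV (le_preimage_top _ _)).formallySmooth

/-- Restriction is a chart expression of the identity morphism, which is étale; only `V` and `W`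
need to be affine. -/
lemma Sections.res_formallyEtale (g : Y ⟶ Spec (.of R)) {V W : Y.Opens}
    (hV : IsAffineOpen V) (hW : IsAffineOpen W) (h : W ≤ V) :
    (Sections.res g h).toRingHom.FormallyEtale := by
  have := (𝟙 Y : Y ⟶ Y).etale_appLE hV hW h
  have e : (Scheme.Hom.appLE (𝟙 Y) V W h).hom = (Sections.res g h).toRingHom := by
    exact congrArg CommRingCat.Hom.hom (Category.id_comp (Y.presheaf.map (homOfLE h).op))
  rw [e] at this
  exact this.formallyEtale

end Sections

/-! ### Vanishing of hypercohomology as an algebraic statement on a basis -/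

section Forms

variable {k A : Type*} [Field k] [CommRing A] [Algebra k A]

/-- The linear endomorphism given by an alternating map in one argument. -/
def ofVectorForm (Q : A [⋀^Fin 1]→ₗ[k] A) : A →ₗ[k] A where
  toFun x := Q ![x]
  map_add' x y := by
    have h : ∀ z : A, Function.update ![(0 : A)] 0 z = ![z] := fun z => by
      ext i; fin_cases i; rfl
    simpa only [h] using Q.map_update_add ![0] 0 x y
  map_smul' c x := by
    have h : ∀ z : A, Function.update ![(0 : A)] 0 z = ![z] := fun z => by
      ext i; fin_cases i; rfl
    simpa only [h, RingHom.id_apply] using Q.map_update_smul ![0] 0 c x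

lemma ofVectorForm_apply (Q : A [⋀^Fin 1]→ₗ[k] A) (x : A) : ofVectorForm Q x = Q ![x] := rfl

lemma ofVectorForm_mul {Q : A [⋀^Fin 1]→ₗ[k] A} (hQ : Q ∈ skewDerivations k A 1) (x y : A) :
    ofVectorForm Q (x * y) = x * ofVectorForm Q y + y * ofVectorForm Q x := by
  have h : ∀ z : A, Function.update ![(0 : A)] 0 z = ![z] := fun z => by
    ext i; fin_cases i; rfl
  simpa only [h, ofVectorForm_apply] using hQ ![0] 0 x y

lemma vec_one_eta {A : Type*} (v : Fin 1 → A) : v = ![v 0] := by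
  ext i; fin_cases i; rfl

lemma vec_two_eta {A : Type*} (v : Fin 2 → A) : v = ![v 0, v 1] := by
  ext i; fin_cases i <;> rfl

lemma vec_three_eta {A : Type*} (v : Fin 3 → A) : v = ![v 0, v 1, v 2] := by
  ext i; fin_cases i <;> rfl

end Forms

section Hypercocycles

variable {k : Type u} [Field k] [CharZero k] {X : Scheme.{u}} {f : X ⟶ Spec (.of k)}
  (Λ : PoissonStructure f) {ι : Type u} [Preorder ι] {b : ι → X.Opens}

/-- Compatible families over the members inside `b i` or `b i ⊓ b j` are the same as polyvector
fields there, so the algebraic data assemble to a Čech hypercocycle for the cover `b`, and its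
primitive is read back on basis members. -/
lemma hypercocyclesBound_of_subsingleton
    (h : Subsingleton (Hypercohomology (tangentComplex Λ) 1))
    (hb : Opens.IsBasis (Set.range b)) (hle : ∀ {i j}, i ≤ j → b i ≤ b j)
    (hle' : ∀ {i j}, b i ≤ b j → i ≤ j) :
    HypercocyclesBound (fun i => Λ.poisson (b i)) (fun h => Sections.res f (hle h)) := by
  intro D P hDm hDρ hP0 hPm hPρ hPc hDP hDD
  have hD := fun i j => polyvectorFields.exists_of_basis f hb (n := 1) (U := b i ⊓ b j)
    (fun l hl => vectorForm (D i j l (hle' (hl.trans inf_le_left)) (hle' (hl.trans inf_le_right))))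
    (fun l hl => vectorForm_mem (hDm i j l _ _))
    (fun l m hm hl v => hDρ i j m l (hle' (hm.trans inf_le_left)) (hle' (hm.trans inf_le_right))
      (hle' hl) (v 0))
  choose QD hQD using hD
  have hP := fun i => polyvectorFields.exists_of_basis f hb (n := 2) (U := b i)
    (fun l hl => bivectorForm (P i l (hle' hl)) (hP0 i l (hle' hl)))
    (fun l hl => bivectorForm_mem (hPm i l _))
    (fun l m hm hl v => hPρ i m l (hle' hm) (hle' hl) (v 0) (v 1))
  choose QP hQP using hP
  let c : Hypercocycle (schoutenHom Λ 0) (schoutenHom Λ 1) b :=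
    { D := QD
      P := QP
      closed := fun i => polyvectorFields.ext_of_basis f hb
        (P := polyvectorFields.schouten Λ 1 (b i) (QP i)) fun l hl => by
          change (Λ.poisson (b l)).schouten ((QP i).1 ⟨b l, hl⟩) = 0
          rw [hQP]
          ext v
          rw [vec_three_eta v, PoissonBracket.schouten_apply_two, AlternatingMap.zero_apply,
            neg_eq_zero]
          exact hPc i l (hle' hl) _ _ _
      compat := fun i j => polyvectorFields.ext_of_basis f hb
        (P := polyvectorFields.schouten Λ 0 (b i ⊓ b j) (QD i j)) 
        (Q := polyvectorFields.restrict f 2 inf_le_left (QP i) -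
          polyvectorFields.restrict f 2 inf_le_right (QP j)) fun l hl => by
          change (Λ.poisson (b l)).schouten ((QD i j).1 ⟨b l, hl⟩) =
            (QP i).1 ⟨b l, _⟩ - (QP j).1 ⟨b l, _⟩
          rw [hQP, hQP, hQD]
          ext v
          rw [vec_two_eta v, PoissonBracket.schouten_apply_one]
          exact hDP i j l _ _ _ _
      cocycle := fun i j m W hi hj hm => polyvectorFields.ext_of_basis f hb
        (P := polyvectorFields.restrict f 1 (le_inf hi hj) (QD i j) +
          polyvectorFields.restrict f 1 (le_inf hj hm) (QD j m))
        (Q := polyvectorFields.restrict f 1 (le_inf hi hm) (QD i m)) fun l hl => by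
          change (QD i j).1 ⟨b l, _⟩ + (QD j m).1 ⟨b l, _⟩ = (QD i m).1 ⟨b l, _⟩
          rw [hQD, hQD, hQD]
          ext v
          exact hDD i j m l _ _ _ _ }
  obtain ⟨E, hE, hE'⟩ : c.IsBoundary := isBoundary_of_subsingleton_tangentComplex h
    (eq_top_iff.2 ((le_iSup_basis hb ⊤).trans (iSup_le fun i => le_iSup b i.1))) c
  let E : ∀ i, polyvectorFields f 1 (b i) := E
  refine ⟨fun i l hi => ofVectorForm ((E i).1 ⟨b l, hle hi⟩),
    fun i l hi => ofVectorForm_mul ((E i).2.1 ⟨b l, hle hi⟩), fun i l m hi h x => ?_, fun i l hi x y => ?_,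
    fun i j l hi hj x => ?_⟩
  · rw [ofVectorForm_apply, polyvectorFields.res_apply, ofVectorForm_apply]
    congr 1
    ext i; fin_cases i; rfl
  · have h1 : (Λ.poisson (b l)).schouten ((E i).1 ⟨b l, hle hi⟩) = (QP i).1 ⟨b l, hle hi⟩ :=
      congrFun (congrArg Subtype.val (hE i)) ⟨b l, hle hi⟩
    rw [hQP] at h1
    have h2 := congr($h1 ![x, y])
    rw [PoissonBracket.schouten_apply_one] at h2
    exact h2
  · have h1 : (E i).1 ⟨b l, hle hi⟩ - (E j).1 ⟨b l, hle hj⟩ =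
        (QD i j).1 ⟨b l, le_inf (hle hi) (hle hj)⟩ :=
      congrFun (congrArg Subtype.val (hE' i j)) ⟨b l, le_inf (hle hi) (hle hj)⟩
    rw [hQD] at h1
    exact congr($h1 ![x])

end Hypercocycles

/-! ### Flat algebras with a section over an Artinian base -/

section FlatBasis
open TensorProduct

variable {k A B R : Type*} [Field k] [CommRing A] [IsLocalRing A] [IsArtinianRing A]
  [CommRing B] [Algebra k B] [Algebra A B] [Module.Flat A B]
  [CommRing R] [Algebra k R] (q : B →ₐ[k] R) (s : R →ₐ[k] B) (hs : ∀ a, q (s a) = a)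
  (hker : RingHom.ker q = (IsLocalRing.maximalIdeal A).map (algebraMap A B))
  (r : A →+* k) (hr : ∀ a, q (algebraMap A B a) = algebraMap k R (r a))

include hs hker hr

/-- Suppose the ideal `I` of the coefficients of a relation is nonzero, and write them as `j + t *
c` with `j` in `J`. By flatness the combination of the `s (e i)` with coefficients `c` lies in 𝔪B,
so it dies under `q`. Independence of `e` over `k` puts every `c` into 𝔪, and then `I ≤ J`, a
contradiction. -/
lemma linearIndependent_of_section {ι : Type*} {e : ι → R} (he : LinearIndependent k e) :
    LinearIndependent A (fun i => s (e i)) := by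
  rw [linearIndependent_iff']
  intro T g hg
  let I : Ideal A := Ideal.span (g '' T)
  suffices hI : I = ⊥ by
    intro i hi
    have : g i ∈ I := Ideal.subset_span ⟨i, hi, rfl⟩
    rwa [hI] at this
  by_contra hI
  obtain ⟨J, t, hJI, htI, hIJ, h1, h2⟩ := exists_ideal_lt_of_ne_bot hI
  have hgi : ∀ i ∈ T, ∃ j ∈ J, ∃ c, g i = j + t * c := by
    intro i hi
    have : g i ∈ I := Ideal.subset_span ⟨i, hi, rfl⟩
    obtain ⟨j, hj, y, hy, h⟩ := Submodule.mem_sup.1 (hIJ this)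
    obtain ⟨c, rfl⟩ := Ideal.mem_span_singleton.1 hy
    exact ⟨j, hj, c, h.symm⟩
  choose! j hj c hc using hgi
  have hsum : algebraMap A B t * ∑ i ∈ T, c i • s (e i) ∈ J.map (algebraMap A B) := by
    have h3 : ∑ i ∈ T, j i • s (e i) + algebraMap A B t * ∑ i ∈ T, c i • s (e i) = 0 := by
      rw [← hg, Finset.mul_sum, ← Finset.sum_add_distrib]
      refine Finset.sum_congr rfl fun i hi => ?_
      rw [hc i hi, add_smul, ← Algebra.smul_def, smul_smul]
    rw [← neg_eq_iff_add_eq_zero] at h3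
    rw [← h3, neg_mem_iff]
    refine Ideal.sum_mem _ fun i hi => ?_
    rw [Algebra.smul_def]
    exact Ideal.mul_mem_right _ _ (Ideal.mem_map_of_mem _ (hj i hi))
  have h4 := mem_map_of_mul_mem_map h1 hsum
  rw [← hker, RingHom.mem_ker, map_sum] at h4
  simp only [Algebra.smul_def, map_mul, hr, hs] at h4
  simp only [← Algebra.smul_def] at h4
  have h5 := linearIndependent_iff'.1 he T _ h4
  refine hJI.not_ge (Ideal.span_le.2 ?_)
  rintro _ ⟨i, hi, rfl⟩
  rw [hc i hi]
  refine add_mem (hj i hi) (h2 _ ?_)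
  rw [IsLocalRing.mem_maximalIdeal, mem_nonunits_iff]
  intro hu
  exact (hu.map r).ne_zero (h5 i hi)

variable [Algebra k A] [IsScalarTower k A B]

-- Nakayama's argument with a nilpotent ideal, so no finiteness of `B` is needed: B = N + 𝔪B
-- iterates to B = N + 𝔪ⁿB, and 𝔪ⁿ = 0 for some n.
omit [Module.Flat A B] hr in
lemma span_range_section {ι : Type*} {e : ι → R} (he : Submodule.span k (Set.range e) = ⊤) :
    Submodule.span A (Set.range fun i => s (e i)) = ⊤ := by
  set N := Submodule.span A (Set.range fun i => s (e i))
  have hsN : ∀ x, s x ∈ N := by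
    intro x
    have hx : x ∈ Submodule.span k (Set.range e) := he ▸ Submodule.mem_top
    refine Submodule.span_induction ?_ (by simp) (fun x y _ _ hx hy => ?_) (fun c x _ hx => ?_) hx
    · rintro _ ⟨i, rfl⟩
      exact Submodule.subset_span ⟨i, rfl⟩
    · rw [map_add]; exact add_mem hx hy
    · rw [map_smul, ← algebraMap_smul A]
      exact N.smul_mem _ hx
  have h1 : ∀ n : ℕ, (⊤ : Submodule A B) ≤
      N ⊔ (IsLocalRing.maximalIdeal A) ^ n • (⊤ : Submodule A B) := by
    intro n
    induction n with
    | zero => rw [pow_zero, Ideal.one_eq_top, Submodule.top_smul]; exact le_sup_right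
    | succ n ih =>
      refine ih.trans (sup_le le_sup_left ?_)
      have h2 : (⊤ : Submodule A B) ≤ N ⊔ IsLocalRing.maximalIdeal A • (⊤ : Submodule A B) := by
        intro b _
        have hb : b - s (q b) ∈ (IsLocalRing.maximalIdeal A).map (algebraMap A B) := by
          rw [← hker, RingHom.mem_ker, map_sub, hs, sub_self]
        rw [← sub_add_cancel b (s (q b)), add_comm]
        refine Submodule.add_mem_sup (hsN _) ?_
        rw [Ideal.smul_top_eq_map]
        exact hb
      calc (IsLocalRing.maximalIdeal A) ^ n • (⊤ : Submodule A B)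
          ≤ (IsLocalRing.maximalIdeal A) ^ n •
            (N ⊔ IsLocalRing.maximalIdeal A • (⊤ : Submodule A B)) := Submodule.smul_mono le_rfl h2
        _ ≤ _ := by
          rw [Submodule.smul_sup, ← Submodule.mul_smul, ← pow_succ]
          exact sup_le_sup_right Submodule.smul_le_right _
  obtain ⟨n, hn⟩ := IsArtinianRing.isNilpotent_jacobson_bot (R := A)
  rw [IsLocalRing.jacobson_eq_maximalIdeal _ bot_ne_top] at hn
  have := h1 n
  rw [hn, Ideal.zero_eq_bot, Submodule.bot_smul, sup_bot_eq] at this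
  exact top_le_iff.1 this

/-- A `k`-basis `e` of `R` gives the `A`-basis `1 ⊗ e` of the tensor product and, by the two
preceding lemmas, the `A`-basis `s ∘ e` of `B`; the map matches them. -/
lemma bijective_lift_of_section : Function.Bijective
    (Algebra.TensorProduct.lift (Algebra.ofId A B) s fun _ _ => Commute.all _ _ :
      A ⊗[k] R →ₐ[A] B) := by
  let e := Module.Basis.ofVectorSpace k R
  let v : Module.Basis _ A B := Module.Basis.mk
    (linearIndependent_of_section q s hs hker r hr e.linearIndependent)
    (span_range_section q s hs hker e.span_eq).ge
  let w := Algebra.TensorProduct.basis A e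
  have hE : (w.equiv v (Equiv.refl _)).toLinearMap =
      (Algebra.TensorProduct.lift (Algebra.ofId A B) s fun _ _ => Commute.all _ _ :
      A ⊗[k] R →ₐ[A] B).toLinearMap := w.ext fun i => by
    simp [w, v, -Algebra.TensorProduct.basis_apply]
    simp
  exact congrArg DFunLike.coe hE ▸ (w.equiv v (Equiv.refl _)).bijective

end FlatBasis

lemma isPushout_of_section {k A B R : Type u} [Field k] [CommRing A] [Algebra k A] [IsLocalRing A]
    [IsArtinianRing A]
    [CommRing B] [Algebra k B] [Algebra A B] [IsScalarTower k A B] [Module.Flat A B]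
    [CommRing R] [Algebra k R] (q : B →ₐ[k] R) (s : R →ₐ[k] B) (hs : ∀ a, q (s a) = a)
    (hker : RingHom.ker q = (IsLocalRing.maximalIdeal A).map (algebraMap A B))
    (r : A →+* k) (hr : ∀ a, q (algebraMap A B a) = algebraMap k R (r a)) :
    IsPushout (CommRingCat.ofHom (algebraMap k R)) (CommRingCat.ofHom (algebraMap k A))
      (CommRingCat.ofHom s.toRingHom) (CommRingCat.ofHom (algebraMap A B)) := by
  let E := RingEquiv.ofBijective _ (bijective_lift_of_section q s hs hker r hr)
  refine (CommRingCat.isPushout_tensorProduct k A R).flip.of_iso (Iso.refl _) (Iso.refl _) (Iso.refl _)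
    E.toCommRingCatIso ?_ ?_ ?_ ?_
  · rfl
  · rfl
  · ext x
    change E (1 ⊗ₜ x) = s x
    simp [E]
  · ext x
    change E (x ⊗ₜ 1) = _
    simp [E, Algebra.ofId_apply]

/-! ### Gluing morphisms along an affine basis -/

section Glue

variable {X Y : Scheme.{u}} {ι : Type u} {b : ι → X.Opens}

/-- The open cover given by a covering family of affine open subsets. -/
def fromSpecCover (hb : iSup b = ⊤) (hba : ∀ i, IsAffineOpen (b i)) : X.OpenCover where
  I₀ := ι
  X i := Spec Γ(X, b i)
  f i := (hba i).fromSpec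
  mem₀ := by
    rw [Scheme.presieve₀_mem_precoverage_iff]
    refine ⟨fun x => ?_, fun i => inferInstance⟩
    obtain ⟨i, hi⟩ := Opens.mem_iSup.1 (hb.ge (Opens.mem_top x))
    refine ⟨i, ?_⟩
    rw [(hba i).range_fromSpec]
    exact hi

lemma hom_ext_fromSpec (hb : iSup b = ⊤) (hba : ∀ i, IsAffineOpen (b i)) {r r' : X ⟶ Y}
    (h : ∀ i, (hba i).fromSpec ≫ r = (hba i).fromSpec ≫ r') : r = r' :=
  (fromSpecCover hb hba).hom_ext _ _ h

/-- The cover is locally directed: each point of an overlap lies in a smaller member. Compatibility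
along inclusions therefore suffices, and overlaps never have to be described. -/
lemma exists_glue_fromSpec [Preorder ι] (hb : Opens.IsBasis (Set.range b))
    (hba : ∀ i, IsAffineOpen (b i))
    (hle : ∀ {i j}, i ≤ j → b i ≤ b j) (hle' : ∀ {i j}, b i ≤ b j → i ≤ j)
    (g : ∀ i, Spec Γ(X, b i) ⟶ Y)
    (h : ∀ i j (hij : i ≤ j), Spec.map (X.presheaf.map (homOfLE (hle hij)).op) ≫ g j = g i) :
    ∃ r : X ⟶ Y, ∀ i, (hba i).fromSpec ≫ r = g i := by
  have hsup : iSup b = ⊤ :=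
    eq_top_iff.2 ((le_iSup_basis hb ⊤).trans (iSup_le fun i => le_iSup b i.1))
  let U := fromSpecCover hsup hba
  let : Preorder U.I₀ := (inferInstance : Preorder ι)
  have hr : ∀ i : U.I₀, (U.f i).opensRange = b i := fun i => (hba i).opensRange_fromSpec
  let : U.LocallyDirected := .ofIsBasisOpensRange
    (fun {i j} => by rw [hr, hr]; exact ⟨hle, hle'⟩) (by simp_rw [hr]; exact hb)
  refine ⟨U.glueMorphismsOfLocallyDirected g fun {i j} hij => ?_,
    U.map_glueMorphismsOfLocallyDirected g _⟩
  have e : U.trans hij = Spec.map (X.presheaf.map (homOfLE (hle (leOfHom hij))).op) :=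
    (cancel_mono (U.f j)).1 ((U.trans_map hij).trans
      ((hba j).map_fromSpec (hba i) (homOfLE (hle (leOfHom hij))).op).symm)
  rw [e]
  exact h i j (leOfHom hij)

lemma fromSpec_comp {R : Type u} [CommRing R] (f : X ⟶ Spec (.of R)) {V : X.Opens}
    (hV : IsAffineOpen V) : hV.fromSpec ≫ f =
      Spec.map (CommRingCat.ofHom (algebraMap R (Sections f V)) ≫ (sectionsIso f V).inv) := by
  rw [← (isAffineOpen_top _).SpecMap_appLE_fromSpec f hV (le_preimage_top f V),
    IsAffineOpen.fromSpec_top, algebraMap_sections]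
  simp [Scheme.isoSpec_Spec_inv]

end Glue

/-! ### The special fibre and retractions onto it -/

section ResidueMap

variable {k A : Type u} [Field k] [CommRing A] [Algebra k A] [IsArtAlgebra k A]

lemma residueMap_algebraMap (c : k) : residueMap k A (algebraMap k A c) = c :=
  (RingEquiv.ofBijective (algebraMap k (IsLocalRing.ResidueField A))
    IsArtAlgebra.residue_bijective).symm_apply_apply c

lemma residueMap_surjective : Function.Surjective (residueMap k A) :=
  fun c => ⟨_, residueMap_algebraMap c⟩

lemma ker_residueMap : RingHom.ker (residueMap k A) = IsLocalRing.maximalIdeal A :=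
  IsLocalRing.eq_maximalIdeal (RingHom.ker_isMaximal_of_surjective _ residueMap_surjective)

instance : IsClosedImmersion (Spec.map (CommRingCat.ofHom (residueMap k A))) :=
  IsClosedImmersion.spec_of_surjective _ residueMap_surjective

/-- The spectrum of an Artinian local ring is a point. -/
instance : Surjective (Spec.map (CommRingCat.ofHom (residueMap k A))) := by
  refine ⟨fun x => ?_⟩
  have : Subsingleton (PrimeSpectrum A) := inferInstance
  let y : PrimeSpectrum k := ⊥
  exact ⟨y, Subsingleton.elim (α := PrimeSpectrum A) _ _⟩

end ResidueMap

namespace Deformation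

variable {k : Type u} [Field k] {X : Scheme.{u}} {f : X ⟶ Spec (.of k)} {Λ₀ : PoissonStructure f}
  {A : Type u} [CommRing A] [Algebra k A] [IsArtAlgebra k A] (ξ : Deformation Λ₀ A)

lemma isClosedImmersion_incl : IsClosedImmersion ξ.incl :=
  MorphismProperty.of_isPullback ξ.isPullback.flip inferInstance

lemma surjective_incl : Function.Surjective ξ.incl :=
  (MorphismProperty.of_isPullback (P := @Surjective) ξ.isPullback.flip inferInstance).surj

/-- The inclusion of the special fibre is surjective on points, so open sets of the total space and
of `X` can be compared through their preimages. -/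
lemma incl_preimage_le_iff {V W : ξ.total.Opens} :
    ξ.incl ⁻¹ᵁ V ≤ ξ.incl ⁻¹ᵁ W ↔ V ≤ W := by
  refine ⟨fun h x hx => ?_, fun h => ξ.incl.preimage_mono h⟩
  obtain ⟨y, rfl⟩ := ξ.surjective_incl x
  exact h hx

lemma isBasis_incl_preimage :
    Opens.IsBasis (Set.range fun W : ξ.total.affineOpens => ξ.incl ⁻¹ᵁ W.1) := by
  rw [Opens.isBasis_iff_nbhd]
  intro V x hx
  have := ξ.isClosedImmersion_incl
  obtain ⟨V', hV', e⟩ := ξ.incl.isClosedEmbedding.isInducing.isOpen_iff.1 V.2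
  obtain ⟨W, hW, hxW, hWV⟩ := Opens.isBasis_iff_nbhd.1 ξ.total.isBasis_affineOpens
    (U := ⟨V', hV'⟩) (x := ξ.incl x) (by
      change x ∈ ξ.incl ⁻¹' V'
      rw [e]; exact hx)
  refine ⟨_, ⟨⟨W, hW⟩, rfl⟩, hxW, fun y hy => ?_⟩
  change y ∈ V.1
  rw [← e]
  exact hWV hy

lemma isAffineOpen_incl_preimage (W : ξ.total.affineOpens) : IsAffineOpen (ξ.incl ⁻¹ᵁ W.1) := by
  have := ξ.isClosedImmersion_incl
  exact W.2.preimage ξ.incl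

/-- The retraction of the total space of a deformation onto the special fibre that is given on
affine open subsets by a compatible family of ring homomorphisms. -/
lemma exists_retraction
    (s : ∀ W : ξ.total.affineOpens, Sections f (ξ.incl ⁻¹ᵁ W.1) →+* Sections ξ.π W.1)
    (hsk : ∀ W c, s W (algebraMap k _ c) = algebraMap A _ (algebraMap k A c))
    (hs : ∀ W a, Sections.pullback f ξ.π ξ.incl W.1 (s W a) = a)
    (hres : ∀ (V W : ξ.total.affineOpens) (h : V ≤ W) a,
      s V (Sections.res f (ξ.incl.preimage_mono h) a) = Sections.res ξ.π h (s W a)) :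
    ∃ r : ξ.total ⟶ X, ξ.incl ≫ r = 𝟙 X ∧
      r ≫ f = ξ.π ≫ Spec.map (CommRingCat.ofHom (algebraMap k A)) ∧
      ∀ W : ξ.total.affineOpens, ∃ h : W.1 = r ⁻¹ᵁ (ξ.incl ⁻¹ᵁ W.1),
        ∀ a, r.appLE (ξ.incl ⁻¹ᵁ W.1) W.1 h.le a = s W a := by
  have hba := ξ.isAffineOpen_incl_preimage
  have hWa : ∀ W : ξ.total.affineOpens, IsAffineOpen W.1 := fun W => W.2
  let s' (W : ξ.total.affineOpens) : Γ(X, ξ.incl ⁻¹ᵁ W.1) ⟶ Γ(ξ.total, W.1) :=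
    CommRingCat.ofHom (s W)
  have hb : Opens.IsBasis (Set.range fun W : ξ.total.affineOpens => W.1) := by
    convert! ξ.total.isBasis_affineOpens
    exact Subtype.range_coe
  have hsup : ⨆ W : ξ.total.affineOpens, W.1 = ⊤ :=
    eq_top_iff.2 ((le_iSup_basis hb ⊤).trans (iSup_le fun i => le_iSup _ i.1))
  have hsup' : ⨆ W : ξ.total.affineOpens, ξ.incl ⁻¹ᵁ W.1 = ⊤ := by
    rw [← Scheme.Hom.preimage_iSup, hsup]; rfl
  obtain ⟨r, hr⟩ := exists_glue_fromSpec hb hWa (fun h => h) (fun h => h)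
    (fun W => Spec.map (s' W) ≫ (hba W).fromSpec) (fun V W h => by
      have h' : V.1 ≤ W.1 := h
      have e : s' W ≫ ξ.total.presheaf.map (homOfLE h').op =
          X.presheaf.map (homOfLE (ξ.incl.preimage_mono h')).op ≫ s' V := by
        ext a; exact (hres V W h a).symm
      change Spec.map (ξ.total.presheaf.map (homOfLE h').op) ≫ Spec.map (s' W) ≫ _ = _
      rw [← Spec.map_comp_assoc, e, Spec.map_comp_assoc, IsAffineOpen.map_fromSpec])
  have hincl : ξ.incl ≫ r = 𝟙 X := by
    refine hom_ext_fromSpec hsup' hba fun W => ?_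
    rw [Category.comp_id,
      ← (hWa W).SpecMap_appLE_fromSpec_assoc ξ.incl (hba W) le_rfl, hr, ← Spec.map_comp_assoc]
    have e : s' W ≫ ξ.incl.appLE W.1 (ξ.incl ⁻¹ᵁ W.1) le_rfl = 𝟙 _ := by
      rw [← Scheme.Hom.app_eq_appLE]
      ext a; exact hs W a
    rw [e, Spec.map_id, Category.id_comp]
  refine ⟨r, hincl, hom_ext_fromSpec hsup hWa fun W => ?_, fun W => ?_⟩
  · rw [← Category.assoc, hr, Category.assoc, fromSpec_comp, ← Category.assoc, fromSpec_comp,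
      ← Spec.map_comp, ← Spec.map_comp]
    congr 1
    ext c
    exact hsk W c
  -- Both sides have the same preimage under `ξ.incl`, because `r` retracts it.
  · have h : W.1 = r ⁻¹ᵁ (ξ.incl ⁻¹ᵁ W.1) := by
      have h1 : ξ.incl ⁻¹ᵁ (r ⁻¹ᵁ (ξ.incl ⁻¹ᵁ W.1)) = ξ.incl ⁻¹ᵁ W.1 := by
        change (ξ.incl ≫ r) ⁻¹ᵁ (ξ.incl ⁻¹ᵁ W.1) = _
        rw [hincl]; rfl
      exact le_antisymm (ξ.incl_preimage_le_iff.1 h1.ge) (ξ.incl_preimage_le_iff.1 h1.le)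
    refine ⟨h, fun a => ?_⟩
    have e : r.appLE (ξ.incl ⁻¹ᵁ W.1) W.1 h.le = s' W := by
      apply Spec.map_injective
      rw [← cancel_mono (hba W).fromSpec, IsAffineOpen.SpecMap_appLE_fromSpec (hV := hWa W), hr]
    rw [e]; rfl

end Deformation

/-! ### Vanishing of ℍ¹ implies rigidity -/

section AppLE

variable {R S : Type u} [CommRing R] [CommRing S] {X Y : Scheme.{u}}
  {f : X ⟶ Spec (.of S)} {g : Y ⟶ Spec (.of R)} {φ : X ⟶ Y}

/-- The open set `W` is only propositionally equal to the preimage of `V`; this allows a ring map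
known on `W` to serve as the pullback map. -/
lemma isPushout_of_appLE {h : R →+* S} {V : Y.Opens} {W : X.Opens} (e : W = φ ⁻¹ᵁ V)
    (s : Sections g V →+* Sections f W) (hs : ∀ a, φ.appLE V W e.le a = s a)
    (H : IsPushout (CommRingCat.ofHom (algebraMap R (Sections g V))) (CommRingCat.ofHom h)
      (CommRingCat.ofHom s) (CommRingCat.ofHom (algebraMap S (Sections f W)))) :
    IsPushout (CommRingCat.ofHom (algebraMap R (Sections g V))) (CommRingCat.ofHom h)
      (CommRingCat.ofHom (Sections.pullback f g φ V))
      (CommRingCat.ofHom (algebraMap S (Sections f (φ ⁻¹ᵁ V)))) := by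
  subst e
  obtain rfl : s = Sections.pullback f g φ V := by
    ext a
    refine (hs a).symm.trans ?_
    rw [← Scheme.Hom.app_eq_appLE]
    rfl
  exact H

lemma res_pullback_eq_appLE {U V : Y.Opens} {W : X.Opens} (hW : W ≤ φ ⁻¹ᵁ U) (hV : V ≤ U)
    (e : W = φ ⁻¹ᵁ V) (F : Sections g U) :
    Sections.res f hW (Sections.pullback f g φ U F) =
      φ.appLE V W e.le (Sections.res g hV F) := by
  have : φ.app U ≫ X.presheaf.map (homOfLE hW).op =
      Y.presheaf.map (homOfLE hV).op ≫ φ.appLE V W e.le := by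
    rw [Scheme.Hom.map_appLE]; rfl
  exact congr(($this).hom F)

lemma isPoissonMorphism_id (Λ : PoissonStructure f) : IsPoissonMorphism Λ Λ (𝟙 X) := by
  intro V F G
  have : ∀ F, Sections.pullback f f (𝟙 X) V F = F := fun F => rfl
  simp only [this]
  rfl

end AppLE

section

variable {k : Type u} [Field k] [CharZero k] {X : Scheme.{u}} {f : X ⟶ Spec (.of k)} [Smooth f]
  {Λ₀ : PoissonStructure f}

/-- The affine open sets of the total space restrict to an affine basis of `X`. The Poisson sections
found on it glue to a retraction, the square over Spec A → Spec k is cartesian by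
`isPushout_of_section`, and the retraction is Poisson because the sections are. -/
theorem isRigid_of_subsingleton (H : Subsingleton (Hypercohomology (tangentComplex Λ₀) 1)) :
    IsRigid Λ₀ := by
  intro A _ _ _ ξ
  have hba := ξ.isAffineOpen_incl_preimage
  let : ∀ W : ξ.total.affineOpens, Algebra k (Sections ξ.π W.1) := fun W =>
    Algebra.compHom _ (algebraMap k A)
  have : ∀ W : ξ.total.affineOpens, IsScalarTower k A (Sections ξ.π W.1) := fun W =>
    .of_algebraMap_eq fun _ => rfl
  have : ∀ W : ξ.total.affineOpens, Module.Flat A (Sections ξ.π W.1) := fun W =>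
    have := ξ.flat
    Sections.flat ξ.π W.2
  have : ∀ W : ξ.total.affineOpens, Algebra.FormallySmooth k (Sections f (ξ.incl ⁻¹ᵁ W.1)) :=
    fun W => Sections.formallySmooth f (hba W)
  have hqA : ∀ W a, Sections.pullback f ξ.π ξ.incl W (algebraMap A _ a) =
      algebraMap k _ (residueMap k A a) := Sections.pullback_algebraMap _ ξ.isPullback.w
  let q (W : ξ.total.affineOpens) : Sections ξ.π W.1 →ₐ[k] Sections f (ξ.incl ⁻¹ᵁ W.1) :=
    { Sections.pullback f ξ.π ξ.incl W.1 with
      commutes' := fun c => (hqA W.1 (algebraMap k A c)).trans (by rw [residueMap_algebraMap]) }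
  have hq (W : ξ.total.affineOpens) := surjective_and_ker_of_isPushout
    (isPushout_of_isPullback _ ξ.isPullback W.2) residueMap_surjective
  have hker (W : ξ.total.affineOpens) : RingHom.ker (q W) =
    (IsLocalRing.maximalIdeal A).map (algebraMap A (Sections ξ.π W.1)) :=
    (hq W).2.trans (by rw [ker_residueMap])
  obtain ⟨s, hs, hres, hbr⟩ := exists_poisson_sections (A := A)
    (B := fun W : ξ.total.affineOpens => Sections ξ.π W.1)
    (hypercocyclesBound_of_subsingleton Λ₀ H ξ.isBasis_incl_preimage
      (fun h => ξ.incl.preimage_mono h) (fun h => ξ.incl_preimage_le_iff.1 h))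
    (fun W => ξ.Λ.poisson W.1)
    (fun {V W} h => Sections.res_formallyEtale f (hba W) (hba V) _)
    (fun h h' x => Sections.res_res ..)
    (fun h x y => Λ₀.res_bracket _ x y)
    (fun h => Sections.res ξ.π h) (fun h h' x => Sections.res_res ..)
    (fun h x y => ξ.Λ.res_bracket h x y) q (fun W => (hq W).1) hker
    (fun W x y => ξ.isPoissonMorphism W.1 x y)
    (fun h x => Sections.pullback_res f ξ.π ξ.incl h x)
  obtain ⟨r, hr, hrf, hrs⟩ := ξ.exists_retraction (fun W => (s W).toRingHom)
    (fun W c => (s W).commutes c) (fun W a => hs W a) (fun V W h a => hres h a)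
  have hsup : ⨆ W : ξ.total.affineOpens, ξ.incl ⁻¹ᵁ W.1 = ⊤ :=
    eq_top_iff.2 ((le_iSup_basis ξ.isBasis_incl_preimage ⊤).trans
      (iSup_le fun i => le_iSup (fun W : ξ.total.affineOpens => ξ.incl ⁻¹ᵁ W.1) i.1))
  have hrP : IsPullback r ξ.π f (Spec.map (CommRingCat.ofHom (algebraMap k A))) := by
    refine isPullback_of_isPushout (algebraMap k A) hrf _ hsup hba (fun W => ?_) fun W => ?_
    · obtain ⟨h, -⟩ := hrs W
      rw [← h]; exact W.2
    · obtain ⟨h, h'⟩ := hrs W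
      exact isPushout_of_appLE h (s W).toRingHom h' (isPushout_of_section (q W) (s W) (hs W)
        (hker W) (residueMap k A) (hqA W.1))
  have hrΛ : IsPoissonMorphism ξ.Λ Λ₀ r := by
    intro U F G
    have hbW : Opens.IsBasis (Set.range fun W : ξ.total.affineOpens => W.1) := by
      convert! ξ.total.isBasis_affineOpens
      exact Subtype.range_coe
    refine Sections.ext_of_basis ξ.π hbW fun W hW => ?_
    have hWU : ξ.incl ⁻¹ᵁ W.1 ≤ U := by
      refine (ξ.incl.preimage_mono hW).trans ?_
      change (ξ.incl ≫ r) ⁻¹ᵁ U ≤ U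
      rw [hr]; exact le_rfl
    have key : ∀ F, Sections.res ξ.π hW (Sections.pullback ξ.π f r U F) =
        s W (Sections.res f hWU F) := by
      intro F
      obtain ⟨h, h'⟩ := hrs W
      refine Eq.trans ?_ (h' _)
      exact res_pullback_eq_appLE hW hWU h F
    rw [key, Λ₀.res_bracket, hbr, ← key, ← key, ξ.Λ.res_bracket]
  -- With the retraction `r` as projection, the deformation itself is the product, so the identity
  -- serves as the isomorphism.
  exact ⟨ξ, ⟨r, hrP, hr, hrΛ⟩, Iso.refl _, Category.id_comp _, Category.comp_id _,
    isPoissonMorphism_id _⟩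

end

/-! ### Gluing thickenings of an affine basis -/

lemma exists_iso_sections {X : Scheme.{u}} {B : CommRingCat.{u}} (φ : Spec B ⟶ X)
    [IsOpenImmersion φ] {V : X.Opens} (hV : IsAffineOpen V) (h : φ.opensRange = V) :
    ∃ t : Γ(X, V) ≅ B, Spec.map t.hom ≫ hV.fromSpec = φ := by
  have e : Set.range φ = Set.range hV.fromSpec := by
    rw [hV.range_fromSpec, ← h]; rfl
  let s := IsOpenImmersion.isoOfRangeEq φ hV.fromSpec e
  refine ⟨⟨Spec.preimage s.hom, Spec.preimage s.inv, ?_, ?_⟩, ?_⟩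
  · apply Spec.map_injective
    simp
  · apply Spec.map_injective
    simp
  · rw [Spec.map_preimage, IsOpenImmersion.isoOfRangeEq_hom_fac]

section Thickening
open Limits

variable {X : Scheme.{u}} {J : Type u} [Preorder J] {b : J → X.Opens}
  (hb : Opens.IsBasis (Set.range b)) (hba : ∀ i, IsAffineOpen (b i))
  (hle : ∀ {i j}, i ≤ j → b i ≤ b j) (hle' : ∀ {i j}, b i ≤ b j → i ≤ j)
  (F : J ⥤ Scheme.{u}) [∀ {i j : J} (h : i ⟶ j), IsOpenImmersion (F.map h)]
  (c : ∀ i, Spec Γ(X, b i) ⟶ F.obj i) (hc : ∀ i, Function.Bijective (c i))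
  (hcn : ∀ i j (h : i ⟶ j), Spec.map (X.presheaf.map (homOfLE (hle h.le)).op) ≫ c j =
    c i ≫ F.map h)

include hb hba hle' hc hcn

-- The bijections `c` carry the question to `X`. Points of two charts with the same image in a third
-- come from one point of `b i ⊓ b j`, and a basis member around it gives the common smaller chart.
omit [∀ {i j : J} (h : i ⟶ j), IsOpenImmersion (F.map h)] in
lemma isLocallyDirected_thickening : (F ⋙ Scheme.forget).IsLocallyDirected := by
  refine ⟨fun {i j m} fi fj xi xj e => ?_⟩
  obtain ⟨yi, hyi⟩ := (hc i).2 xi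
  obtain ⟨yj, hyj⟩ := (hc j).2 xj
  have key : ∀ {i j : J} (h : i ⟶ j) (y : Spec Γ(X, b i)),
      c j (Spec.map (X.presheaf.map (homOfLE (hle h.le)).op) y) = F.map h (c i y) := by
    intro i j h y
    rw [← Scheme.Hom.comp_apply, ← Scheme.Hom.comp_apply, hcn]
  have keyX : ∀ {i j : J} (h : i ⟶ j) (y : Spec Γ(X, b i)),
      (hba j).fromSpec (Spec.map (X.presheaf.map (homOfLE (hle h.le)).op) y) =
        (hba i).fromSpec y := by
    intro i j h y
    rw [← Scheme.Hom.comp_apply, (hba j).map_fromSpec (hba i)]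
  have hmem : ∀ (i) (y : Spec Γ(X, b i)), (hba i).fromSpec y ∈ b i := fun i y => by
    have : (hba i).fromSpec y ∈ Set.range (hba i).fromSpec := ⟨y, rfl⟩
    rwa [(hba i).range_fromSpec] at this
  have e' : F.map fi xi = F.map fj xj := e
  rw [← hyi, ← hyj, ← key, ← key] at e'
  have e2 : (hba i).fromSpec yi = (hba j).fromSpec yj := by
    rw [← keyX fi, (hc m).1 e', keyX fj]
  obtain ⟨l, hl, hlij⟩ := exists_mem_basis hb
    (show (hba i).fromSpec yi ∈ b i ⊓ b j from ⟨hmem i yi, e2 ▸ hmem j yj⟩)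
  have hl' : (hba i).fromSpec yi ∈ Set.range (hba l).fromSpec := by
    rw [(hba l).range_fromSpec]; exact hl
  obtain ⟨yl, hyl⟩ := hl'
  have fli : l ⟶ i := homOfLE (hle' (hlij.trans inf_le_left))
  have flj : l ⟶ j := homOfLE (hle' (hlij.trans inf_le_right))
  refine ⟨l, fli, flj, c l yl, ?_, ?_⟩
  · change F.map fli (c l yl) = xi
    rw [← key fli, ← hyi]
    congr 1
    apply (hba i).fromSpec.isOpenEmbedding.injective
    rw [keyX fli, hyl]
  · change F.map flj (c l yl) = xj
    rw [← key flj, ← hyj]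
    congr 1
    apply (hba j).fromSpec.isOpenEmbedding.injective
    rw [keyX flj, hyl, e2]

/-- Gluing of a system of homeomorphic thickenings of the members of an affine basis. -/
lemma exists_thickening : ∃ (X' : Scheme.{u}) (incl : X ⟶ X') (ι : ∀ i, F.obj i ⟶ X')
    (_ : ∀ i, IsOpenImmersion (ι i)), (∀ i j (h : i ⟶ j), F.map h ≫ ι j = ι i) ∧
    (∀ i, (hba i).fromSpec ≫ incl = c i ≫ ι i) ∧ (∀ i, incl ⁻¹ᵁ (ι i).opensRange = b i) ∧
    Opens.IsBasis (Set.range fun i => (ι i).opensRange) ∧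
    ∀ {V W : X'.Opens}, incl ⁻¹ᵁ V ≤ incl ⁻¹ᵁ W → V ≤ W := by
  have := isLocallyDirected_thickening hb hba hle hle' F c hc hcn
  obtain ⟨incl, hincl⟩ := exists_glue_fromSpec hb hba hle hle' (fun i => c i ≫ colimit.ι F i)
    (fun i j h => by rw [reassoc_of% (hcn i j (homOfLE h)), colimit.w])
  have hincl' : ∀ i y, incl ((hba i).fromSpec y) = colimit.ι F i (c i y) := by
    intro i y
    rw [← Scheme.Hom.comp_apply, ← Scheme.Hom.comp_apply, hincl]
  have hmem : ∀ (i) (y : Spec Γ(X, b i)), (hba i).fromSpec y ∈ b i := fun i y => by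
    have : (hba i).fromSpec y ∈ Set.range (hba i).fromSpec := ⟨y, rfl⟩
    rwa [(hba i).range_fromSpec] at this
  have hex : ∀ (i) (x : X), x ∈ b i → ∃ y, (hba i).fromSpec y = x := fun i x hx => by
    change x ∈ Set.range (hba i).fromSpec
    rwa [(hba i).range_fromSpec]
  have hpre : ∀ i, incl ⁻¹ᵁ (colimit.ι F i).opensRange = b i := by
    intro i
    refine le_antisymm (fun x hx => ?_) fun x hx => ?_
    · obtain ⟨y, hy : colimit.ι F i y = incl x⟩ := hx
      obtain ⟨j, hj, -⟩ := exists_mem_basis hb (Opens.mem_top x)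
      obtain ⟨z, rfl⟩ := hex j x hj
      -- Points of two charts agree in the colimit only if they come from a common smaller chart;
      -- this places the given point of `X` in `b l`, which lies in `b i`.
      rw [hincl', Scheme.IsLocallyDirected.ι_eq_ι_iff] at hy
      obtain ⟨l, fi, fj, w, hwi, hwj⟩ := hy
      obtain ⟨v, rfl⟩ := (hc l).2 w
      rw [← Scheme.Hom.comp_apply, ← hcn, Scheme.Hom.comp_apply] at hwj
      rw [← (hc j).1 hwj, ← Scheme.Hom.comp_apply, (hba j).map_fromSpec (hba l)]
      exact hle fi.le (hmem l v)
    · obtain ⟨y, rfl⟩ := hex i x hx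
      exact ⟨c i y, (hincl' i y).symm⟩
  have hsurj : Function.Surjective incl := by
    intro x
    obtain ⟨i, y, rfl⟩ := Scheme.IsLocallyDirected.ι_jointly_surjective F x
    obtain ⟨z, rfl⟩ := (hc i).2 y
    exact ⟨_, hincl' i z⟩
  have hmono : ∀ {V W : (colimit F).Opens}, incl ⁻¹ᵁ V ≤ incl ⁻¹ᵁ W → V ≤ W := by
    intro V W h x hx
    obtain ⟨y, rfl⟩ := hsurj x
    exact h hx
  refine ⟨colimit F, incl, fun i => colimit.ι F i, fun i => inferInstance,
    fun i j h => colimit.w F h, hincl, hpre, ?_, hmono⟩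
  rw [Opens.isBasis_iff_nbhd]
  intro V x hx
  obtain ⟨y, rfl⟩ := hsurj x
  obtain ⟨i, hi, hiV⟩ := exists_mem_basis hb (show y ∈ incl ⁻¹ᵁ V from hx)
  refine ⟨_, ⟨i, rfl⟩, ?_, hmono ((hpre i).trans_le hiV)⟩
  exact (hpre i).ge hi

end Thickening

/-! ### Gluing local Poisson deformations -/

section GlueDeformation

/-- Transport of a Poisson bracket along an isomorphism. -/
def PoissonBracket.ofEquiv {A B C : Type*} [CommRing A] [CommRing B] [CommRing C] [Algebra A B]
    [Algebra A C] (M : PoissonBracket A B) (e : C ≃ₐ[A] B) : PoissonBracket A C :=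
  M.ofSurjective e.symm.toAlgHom e.symm.surjective (fun x y => e.symm (M.bracket (e x) (e y)))
    fun x y => by simp

lemma PoissonBracket.ofEquiv_bracket {A B C : Type*} [CommRing A] [CommRing B] [CommRing C]
    [Algebra A B] [Algebra A C] (M : PoissonBracket A B) (e : C ≃ₐ[A] B) (x y : C) :
    (M.ofEquiv e).bracket x y = e.symm (M.bracket (e x) (e y)) := rfl

variable {k : Type u} [Field k] {X : Scheme.{u}} {f : X ⟶ Spec (.of k)} (Λ₀ : PoissonStructure f)
  {A : Type u} [CommRing A] [Algebra k A] [IsArtAlgebra k A]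
  {J : Type u} [Preorder J] {b : J → X.Opens}
  (hb : Opens.IsBasis (Set.range b)) (hba : ∀ i, IsAffineOpen (b i))
  (hle : ∀ {i j}, i ≤ j → b i ≤ b j) (hle' : ∀ {i j}, b i ≤ b j → i ≤ j)
  {B : J → Type u} [∀ i, CommRing (B i)] [∀ i, Algebra A (B i)] [∀ i, Module.Flat A (B i)]
  (β : ∀ {i j}, i ≤ j → B j →ₐ[A] B i) (hβid : ∀ i x, β (le_refl i) x = x)
  (hβ : ∀ {i j l} (h : i ≤ j) (h' : j ≤ l) x, β h (β h' x) = β (h.trans h') x)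
  (hβo : ∀ {i j} (h : i ≤ j), IsOpenImmersion (Spec.map (CommRingCat.ofHom (β h).toRingHom)))
  (q : ∀ i, B i →+* Sections f (b i))
  (hq : ∀ i, IsPushout (CommRingCat.ofHom (algebraMap A (B i)))
    (CommRingCat.ofHom (residueMap k A)) (CommRingCat.ofHom (q i))
    (CommRingCat.ofHom (algebraMap k (Sections f (b i)))))
  (hqβ : ∀ {i j} (h : i ≤ j) x, q i (β h x) = Sections.res f (hle h) (q j x))
  (M : ∀ i, PoissonBracket A (B i))
  (hMβ : ∀ {i j} (h : i ≤ j) x y, β h ((M j).bracket x y) = (M i).bracket (β h x) (β h y))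
  (hMq : ∀ i x y, q i ((M i).bracket x y) = (Λ₀.poisson (b i)).bracket (q i x) (q i y))

include hb hba hle hle' hβid hβ hβo hq hqβ hMβ hMq in
/-- Gluing of flat deformations of the members of an affine basis. -/
lemma exists_deformation : ∃ (ξ : Deformation Λ₀ A) (b' : J → ξ.total.Opens)
    (he : ∀ i, ξ.incl ⁻¹ᵁ b' i = b i) (t : ∀ i, Sections ξ.π (b' i) ≃ₐ[A] B i),
    (∀ {i j} (h : i ≤ j) (h' : b' i ≤ b' j) x, t i (Sections.res ξ.π h' x) = β h (t j x)) ∧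
    (∀ i x, ξ.incl.appLE (b' i) (b i) (he i).ge x = q i (t i x)) ∧
    ∀ i x y, t i ((ξ.Λ.poisson (b' i)).bracket x y) = (M i).bracket (t i x) (t i y) := by
  let F : J ⥤ Scheme.{u} :=
    { obj i := Spec (.of (B i))
      map h := Spec.map (CommRingCat.ofHom (β h.le).toRingHom)
      map_id i := by
        rw [← Spec.map_id]
        congr 1
        ext x
        exact hβid i x
      map_comp {i j l} h h' := by
        rw [← Spec.map_comp]
        congr 1
        ext x
        exact (hβ h.le h'.le x).symm }
  have : ∀ {i j : J} (h : i ⟶ j), IsOpenImmersion (F.map h) := fun h => hβo h.le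
  let q' (i) : CommRingCat.of (B i) ⟶ Γ(X, b i) := CommRingCat.ofHom (q i)
  have hP := fun i => isPullback_SpecMap_of_isPushout _ _ _ _ (hq i)
  -- The map is a base change of the closed point of Spec A, a surjective closed immersion.
  have hc : ∀ i, Function.Bijective (Spec.map (q' i)) := by
    intro i
    have h1 : IsClosedImmersion (Spec.map (q' i)) :=
      MorphismProperty.of_isPullback (P := @IsClosedImmersion) (hP i).flip inferInstance
    have h2 : Surjective (Spec.map (q' i)) :=
      MorphismProperty.of_isPullback (P := @Surjective) (hP i).flip inferInstance
    exact ⟨(Spec.map (q' i)).isClosedEmbedding.injective, h2.surj⟩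
  obtain ⟨X', incl, ι, hι, hFι, hincl, hpre, hb', hmono⟩ := exists_thickening hb hba hle hle' F
    (fun i => Spec.map (q' i)) hc (fun i j h => by
      change _ = Spec.map (q' i) ≫ Spec.map (CommRingCat.ofHom (β h.le).toRingHom)
      rw [← Spec.map_comp, ← Spec.map_comp]
      congr 1
      ext x
      exact (hqβ h.le x).symm)
  let ι' (i) : Spec (.of (B i)) ⟶ X' := ι i
  have hι' : ∀ i, IsOpenImmersion (ι' i) := hι
  let b' (i) : X'.Opens := (ι' i).opensRange
  have hb'a : ∀ i, IsAffineOpen (b' i) := fun i => isAffineOpen_opensRange (ι' i)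
  have hpre' : ∀ i, incl ⁻¹ᵁ b' i = b i := hpre
  have hle₁ : ∀ {i j}, i ≤ j → b' i ≤ b' j := fun h =>
    hmono (((hpre' _).trans_le (hle h)).trans_eq (hpre' _).symm)
  have hle₂ : ∀ {i j}, b' i ≤ b' j → i ≤ j := fun {i j} h =>
    hle' ((hpre' i).ge.trans ((incl.preimage_mono h).trans (hpre' j).le))
  choose t ht using fun i => exists_iso_sections (ι' i) (hb'a i) rfl
  have htn : ∀ {i j} (h : i ≤ j), X'.presheaf.map (homOfLE (hle₁ h)).op ≫ (t i).hom =
      (t j).hom ≫ CommRingCat.ofHom (β h).toRingHom := by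
    intro i j h
    apply Spec.map_injective
    rw [← cancel_mono (hb'a j).fromSpec, Spec.map_comp, Spec.map_comp, Category.assoc,
      Category.assoc, (hb'a j).map_fromSpec (hb'a i), ht, ht]
    exact (hFι i j (homOfLE h)).symm
  have htq : ∀ i, incl.appLE (b' i) (b i) (hpre' i).ge = (t i).hom ≫ q' i := by
    intro i
    apply Spec.map_injective
    rw [← cancel_mono (hb'a i).fromSpec, (hb'a i).SpecMap_appLE_fromSpec incl (hba i), Spec.map_comp,
      Category.assoc, ht]
    exact hincl i
  obtain ⟨π, hπ⟩ := exists_glue_fromSpec hb' hb'a hle₁ hle₂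
    (fun i => Spec.map (CommRingCat.ofHom (algebraMap A (B i)) ≫ (t i).inv)) (fun i j h => by
      rw [← Spec.map_comp]
      congr 1
      rw [← cancel_mono (t i).hom, Category.assoc, Category.assoc, Category.assoc, htn,
        Iso.inv_hom_id_assoc, Iso.inv_hom_id, Category.comp_id, ← CommRingCat.ofHom_comp]
      congr 1
      exact (β h).comp_algebraMap)
  have htπ : ∀ i a, (t i).hom (algebraMap A (Sections π (b' i)) a) = algebraMap A (B i) a := by
    intro i
    have h1 := (fromSpec_comp π (hb'a i)).symm.trans (hπ i)
    have h2 := Spec.map_injective h1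
    rw [← cancel_mono (t i).hom, Category.assoc, Category.assoc, Iso.inv_hom_id,
      Category.comp_id] at h2
    intro a
    exact congr(($h2).hom a)
  let τ (i) : Sections π (b' i) ≃ₐ[A] B i :=
    AlgEquiv.ofRingEquiv (f := (t i).commRingCatIsoToRingEquiv) (htπ i)
  have hτn : ∀ {i j} (h : i ≤ j) (h' : b' i ≤ b' j) x,
      τ i (Sections.res π h' x) = β h (τ j x) := fun h h' x => congr(($(htn h)).hom x)
  have hτq : ∀ i x, incl.appLE (b' i) (b i) (hpre' i).ge x = q i (τ i x) :=
    fun i x => congr(($(htq i)).hom x)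
  obtain ⟨Λ, hΛ⟩ := PoissonStructure.exists_of_basis π hb' (fun i => (M i).ofEquiv (τ i))
    (fun i j h x y => (τ i).injective (by
      rw [hτn (hle₂ h) h, PoissonBracket.ofEquiv_bracket, PoissonBracket.ofEquiv_bracket,
        AlgEquiv.apply_symm_apply, AlgEquiv.apply_symm_apply, hMβ, hτn (hle₂ h) h,
        hτn (hle₂ h) h]))
  have hτΛ : ∀ i x y, τ i ((Λ.poisson (b' i)).bracket x y) = (M i).bracket (τ i x) (τ i y) := by
    intro i x y
    have := hΛ i x y
    rw [PoissonBracket.ofEquiv_bracket] at this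
    rw [← AlgEquiv.apply_symm_apply (τ i) ((M i).bracket _ _)]
    exact congrArg (τ i) this
  have hsup : iSup b' = ⊤ :=
    eq_top_iff.2 ((le_iSup_basis hb' ⊤).trans (iSup_le fun i => le_iSup b' i.1))
  have hsup' : iSup b = ⊤ :=
    eq_top_iff.2 ((le_iSup_basis hb ⊤).trans (iSup_le fun i => le_iSup b i.1))
  have hflat : Flat π := by
    have : IsZariskiLocalAtSource @Flat :=
      HasRingHomProperty.instIsZariskiLocalAtSource (Q := RingHom.Flat)
    refine (IsZariskiLocalAtSource.iff_of_openCover (P := @Flat) (fromSpecCover hsup hb'a)).2 fun (i : J) => ?_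
    have e : (fromSpecCover hsup hb'a).f i ≫ π = _ := hπ i
    rw [e, Spec.map_comp]
    have : Flat (Spec.map (CommRingCat.ofHom (algebraMap A (B i)))) :=
      Flat.SpecMap_iff.2 (RingHom.flat_algebraMap_iff.2 inferInstance)
    exact MorphismProperty.comp_mem @Flat _ _
      (Flat.SpecMap_iff.2 (.of_bijective (ConcreteCategory.bijective_of_isIso (t i).inv))) this
  have hw : incl ≫ π = f ≫ Spec.map (CommRingCat.ofHom (residueMap k A)) := by
    refine hom_ext_fromSpec hsup' hba fun i => ?_
    rw [← Category.assoc, hincl, ← Category.assoc, fromSpec_comp, ← Spec.map_comp]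
    have e : ι i ≫ π = Spec.map (CommRingCat.ofHom (algebraMap A (B i))) := by
      have : ι' i ≫ π = Spec.map (CommRingCat.ofHom (algebraMap A (B i))) := by
        rw [← ht, Category.assoc, hπ, ← Spec.map_comp, Category.assoc, Iso.inv_hom_id,
          Category.comp_id]
      exact this
    rw [Category.assoc, e, ← Spec.map_comp]
    congr 1
    exact congrArg (· ≫ (sectionsIso f (b i)).inv) (hq i).w
  have hpb : IsPullback incl f π (Spec.map (CommRingCat.ofHom (residueMap k A))) := by
    refine isPullback_of_isPushout _ hw b' hsup hb'a (fun i => (hpre' i).symm ▸ hba i) fun i => ?_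
    refine isPushout_of_appLE (hpre' i).symm ((q i).comp (τ i : Sections π (b' i) →+* B i))
      (hτq i) ?_
    exact (hq i).of_iso (Iso.refl _) (τ i).symm.toRingEquiv.toCommRingCatIso (Iso.refl _) (Iso.refl _)
      (by ext a; exact (τ i).symm.commutes a) rfl (by
        ext x
        exact congrArg (q i) ((τ i).apply_symm_apply x).symm) rfl
  have hPoisson : IsPoissonMorphism Λ₀ Λ incl := by
    intro V x y
    refine Sections.ext_of_basis f hb fun i hi => ?_
    have hi' : b' i ≤ V := hmono ((hpre' i).trans_le hi)
    have key : ∀ x, Sections.res f hi (Sections.pullback f π incl V x) =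
        q i (τ i (Sections.res π hi' x)) := fun x =>
      (res_pullback_eq_appLE hi hi' (hpre' i).symm x).trans (hτq i _)
    rw [key, Λ.res_bracket, hτΛ, hMq, ← key, ← key, Λ₀.res_bracket]
  exact ⟨⟨X', π, hflat, Λ, incl, hpb, hPoisson⟩, b', hpre', τ, hτn, hτq, hτΛ⟩

end GlueDeformation

/-! ### Trivialisations on charts supplied by rigidity -/

section RigidSections

lemma IsPoissonMorphism.comp {R S T : Type u} [CommRing R] [CommRing S] [CommRing T]
    {X Y Z : Scheme.{u}} {f : X ⟶ Spec (.of R)} {g : Y ⟶ Spec (.of S)} {h : Z ⟶ Spec (.of T)}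
    {ΛX : PoissonStructure f} {ΛY : PoissonStructure g} {ΛZ : PoissonStructure h}
    {φ : X ⟶ Y} {ψ : Y ⟶ Z} (hφ : IsPoissonMorphism ΛX ΛY φ) (hψ : IsPoissonMorphism ΛY ΛZ ψ) :
    IsPoissonMorphism ΛX ΛZ (φ ≫ ψ) := by
  intro V F G
  have key : ∀ F, Sections.pullback f h (φ ≫ ψ) V F =
      Sections.pullback f g φ (ψ ⁻¹ᵁ V) (Sections.pullback g h ψ V F) := fun F =>
    congr(($(Scheme.Hom.comp_app φ ψ V)).hom F)
  rw [key, hψ, hφ, key, key]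
  rfl

variable {k : Type u} [Field k] {X : Scheme.{u}} {f : X ⟶ Spec (.of k)} {Λ₀ : PoissonStructure f}
  {A : Type u} [CommRing A] [Algebra k A] [IsArtAlgebra k A]
  {J : Type u} [Preorder J] {b : J → X.Opens}
  (hb : Opens.IsBasis (Set.range b)) (hba : ∀ i, IsAffineOpen (b i))
  (hle : ∀ {i j}, i ≤ j → b i ≤ b j) (hle' : ∀ {i j}, b i ≤ b j → i ≤ j)
  {B : J → Type u} [∀ i, CommRing (B i)] [∀ i, Algebra A (B i)] [∀ i, Module.Flat A (B i)]
  (β : ∀ {i j}, i ≤ j → B j →ₐ[A] B i) (hβid : ∀ i x, β (le_refl i) x = x)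
  (hβ : ∀ {i j l} (h : i ≤ j) (h' : j ≤ l) x, β h (β h' x) = β (h.trans h') x)
  (hβo : ∀ {i j} (h : i ≤ j), IsOpenImmersion (Spec.map (CommRingCat.ofHom (β h).toRingHom)))
  (q : ∀ i, B i →+* Sections f (b i))
  (hq : ∀ i, IsPushout (CommRingCat.ofHom (algebraMap A (B i)))
    (CommRingCat.ofHom (residueMap k A)) (CommRingCat.ofHom (q i))
    (CommRingCat.ofHom (algebraMap k (Sections f (b i)))))
  (hqβ : ∀ {i j} (h : i ≤ j) x, q i (β h x) = Sections.res f (hle h) (q j x))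
  (M : ∀ i, PoissonBracket A (B i))
  (hMβ : ∀ {i j} (h : i ≤ j) x y, β h ((M j).bracket x y) = (M i).bracket (β h x) (β h y))
  (hMq : ∀ i x y, q i ((M i).bracket x y) = (Λ₀.poisson (b i)).bracket (q i x) (q i y))


include hb hba hle hle' hβid hβ hβo hq hqβ hMβ hMq in
/-- Local Poisson deformations that glue to a deformation of a rigid Poisson scheme are
compatibly trivial. -/
lemma IsRigid.exists_sections (H : IsRigid Λ₀) : ∃ σ : ∀ i, Sections f (b i) →+* B i,
    (∀ i c, σ i (algebraMap k _ c) = algebraMap A _ (algebraMap k A c)) ∧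
    (∀ i x, q i (σ i x) = x) ∧
    (∀ {i j} (h : i ≤ j) x, σ i (Sections.res f (hle h) x) = β h (σ j x)) ∧
    ∀ i x y, σ i ((Λ₀.poisson (b i)).bracket x y) = (M i).bracket (σ i x) (σ i y) := by
  obtain ⟨ξ, b', he, t, htn, htq, htΛ⟩ := exists_deformation Λ₀ hb hba hle hle' β hβid hβ hβo q hq
    hqβ M hMβ hMq
  obtain ⟨η, ⟨r, hrP, hr, hrΛ⟩, e, heπ, hei, heΛ⟩ := H A ξ
  -- The trivialisation followed by the projection of the product is a Poisson retraction onto `X`.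
  -- Its pullback maps, restricted to the charts `b' i`, are the sections sought.
  let ρ := e.hom ≫ r
  have hρ : ξ.incl ≫ ρ = 𝟙 X := by rw [← hr, ← hei, Category.assoc]
  have hρf : ρ ≫ f = ξ.π ≫ Spec.map (CommRingCat.ofHom (algebraMap k A)) := by
    rw [Category.assoc, hrP.w, reassoc_of% heπ]
  have hρΛ : IsPoissonMorphism ξ.Λ Λ₀ ρ := heΛ.comp hrΛ
  have hbρ : ∀ i, b' i ≤ ρ ⁻¹ᵁ b i := by
    intro i
    rw [← ξ.incl_preimage_le_iff, he]
    change b i ≤ (ξ.incl ≫ ρ) ⁻¹ᵁ b i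
    rw [hρ]; exact le_rfl
  have hle₁ : ∀ {i j}, i ≤ j → b' i ≤ b' j := fun h => by
    rw [← ξ.incl_preimage_le_iff, he, he]
    exact hle h
  refine ⟨fun i => (t i : Sections ξ.π (b' i) →+* B i).comp ((Sections.res ξ.π (hbρ i)).toRingHom.comp
    (Sections.pullback ξ.π f ρ (b i))), fun i c => ?_, fun i x => ?_, fun {i j} h x => ?_,
    fun i x y => ?_⟩
  · change t i (Sections.res ξ.π (hbρ i) (Sections.pullback ξ.π f ρ (b i) _)) = _
    rw [Sections.pullback_algebraMap (algebraMap k A) hρf, AlgHom.commutes, AlgEquiv.commutes]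
  · change q i (t i (Sections.res ξ.π (hbρ i) (Sections.pullback ξ.π f ρ (b i) x))) = x
    refine (htq i _).symm.trans ?_
    have h1 : ρ.app (b i) ≫ ξ.total.presheaf.map (homOfLE (hbρ i)).op ≫
        ξ.incl.appLE (b' i) (b i) (he i).ge = 𝟙 _ := by
      rw [Scheme.Hom.app_eq_appLE, Scheme.Hom.map_appLE, Scheme.Hom.appLE_comp_appLE]
      have : ∀ (φ : X ⟶ X) (h : φ = 𝟙 X) (h' : b i ≤ φ ⁻¹ᵁ b i), φ.appLE (b i) (b i) h' = 𝟙 _ := by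
        rintro _ rfl h'
        exact (Category.id_comp _).trans (X.presheaf.map_id _)
      exact this _ hρ _
    exact congr(($h1).hom x)
  · change t i (Sections.res ξ.π (hbρ i) (Sections.pullback ξ.π f ρ (b i) _)) =
      β h (t j (Sections.res ξ.π (hbρ j) (Sections.pullback ξ.π f ρ (b j) x)))
    rw [← htn h (hle₁ h), Sections.pullback_res, Sections.res_res, Sections.res_res]
  · change t i (Sections.res ξ.π (hbρ i) (Sections.pullback ξ.π f ρ (b i) _)) = _
    rw [hρΛ, ξ.Λ.res_bracket, htΛ]
    rfl

end RigidSections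

/-! ### Poisson algebras over the dual numbers -/

section DualNumbers
open TrivSqZeroExt

section Hom

variable {R S T : Type*} [CommRing R] [CommRing S] [CommRing T]

/-- The ring homomorphism `a + ε b ↦ φ a + ε (φ b + δ a)` for a derivation `δ` along `φ`. -/
def dualNumberHom (φ : R →+* S) (δ : R →+ S) (hδ : ∀ x y, δ (x * y) = φ x * δ y + φ y * δ x) :
    DualNumber R →+* DualNumber S where
  toFun x := inl (φ x.fst) + inr (φ x.snd + δ x.fst)
  map_zero' := by ext <;> simp
  map_one' := by
    have h := hδ 1 1
    simp at h
    ext <;> simp [h]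
  map_add' x y := by
    ext
    · simp
    · simp; ring
  map_mul' x y := by
    ext
    · simp
    · simp [hδ]; ring

@[simp] lemma fst_dualNumberHom (φ : R →+* S) (δ hδ) (x : DualNumber R) :
    (dualNumberHom φ δ hδ x).fst = φ x.fst := by simp [dualNumberHom]

@[simp] lemma snd_dualNumberHom (φ : R →+* S) (δ hδ) (x : DualNumber R) :
    (dualNumberHom φ δ hδ x).snd = φ x.snd + δ x.fst := by simp [dualNumberHom]

/-- Functoriality of the dual numbers. -/
def dualNumberMap (φ : R →+* S) : DualNumber R →+* DualNumber S :=
  dualNumberHom φ 0 fun _ _ => by simp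

@[simp] lemma fst_dualNumberMap (φ : R →+* S) (x : DualNumber R) :
    (dualNumberMap φ x).fst = φ x.fst := by simp [dualNumberMap]

@[simp] lemma snd_dualNumberMap (φ : R →+* S) (x : DualNumber R) :
    (dualNumberMap φ x).snd = φ x.snd := by simp [dualNumberMap]

/-- The ring homomorphism out of the dual numbers given by an element of square zero. -/
def dualNumberLift (φ : R →+* S) (e : S) (he : e * e = 0) : DualNumber R →+* S where
  toFun x := φ x.fst + φ x.snd * e
  map_zero' := by simp
  map_one' := by simp
  map_add' x y := by simp; ring
  map_mul' x y := by
    simp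
    linear_combination - (φ x.snd * φ y.snd) * he

lemma dualNumberLift_apply (φ : R →+* S) (e : S) (he : e * e = 0) (x : DualNumber R) :
    dualNumberLift φ e he x = φ x.fst + φ x.snd * e := rfl

lemma eq_inl_add_mul_eps (x : DualNumber R) : x = inl x.fst + inl x.snd * DualNumber.eps := by
  ext <;> simp

/-- The automorphism `1 + ε δ` of the dual numbers. -/
lemma bijective_dualNumberHom (δ : R →+ R)
    (hδ : ∀ x y, δ (x * y) = RingHom.id R x * δ y + RingHom.id R y * δ x) :
    Function.Bijective (dualNumberHom (RingHom.id R) δ hδ) := by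
  refine Function.bijective_iff_has_inverse.2 ⟨dualNumberHom (RingHom.id R) (-δ) fun x y => by
    rw [AddMonoidHom.neg_apply, hδ]; simp; ring, fun x => ?_, fun x => ?_⟩
  · ext <;> simp
  · ext <;> simp

end Hom

/-- A ring map out of `S[ε]` amounts to a ring map on `S` and an element of square zero, the image
of ε. -/
lemma isPushout_dualNumber {R S : Type u} [CommRing R] [CommRing S] (φ : R →+* S) :
    IsPushout (CommRingCat.ofHom φ) (CommRingCat.ofHom (inlHom R R))
      (CommRingCat.ofHom (inlHom S S)) (CommRingCat.ofHom (dualNumberMap φ)) := by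
  refine ⟨⟨?_⟩, ⟨Limits.PushoutCocone.IsColimit.mk _ (fun s => CommRingCat.ofHom
    (dualNumberLift s.inl.hom (s.inr.hom DualNumber.eps) ?_)) (fun s => ?_) (fun s => ?_)
    fun s m h1 h2 => ?_⟩⟩
  · ext x
    · simp
    · simp
  · rw [← map_mul, DualNumber.eps_mul_eps, map_zero]
  · ext x
    simp [dualNumberLift_apply]
  · refine CommRingCat.hom_ext (RingHom.ext fun x => ?_)
    have h : ∀ x, s.inl.hom (φ x) = s.inr.hom (inl x) := fun x => congr(($s.condition).hom x)
    change s.inl.hom (dualNumberMap φ x).fst + s.inl.hom (dualNumberMap φ x).snd *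
      s.inr.hom DualNumber.eps = s.inr.hom x
    rw [fst_dualNumberMap, snd_dualNumberMap, h, h, ← map_mul, ← map_add, ← eq_inl_add_mul_eps]
  · refine CommRingCat.hom_ext (RingHom.ext fun x => ?_)
    change m.hom x = s.inl.hom x.fst + s.inl.hom x.snd * s.inr.hom DualNumber.eps
    have h1' : ∀ x, m.hom (inl x) = s.inl.hom x := fun x => congr(($h1).hom x)
    have h2' : m.hom DualNumber.eps = s.inr.hom DualNumber.eps := by
      rw [← congr(($h2).hom DualNumber.eps)]
      change m.hom _ = m.hom (dualNumberMap φ DualNumber.eps)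
      congr 1
      ext <;> simp
    conv_lhs => rw [eq_inl_add_mul_eps x]
    rw [map_add, map_mul, h1', h1', h2']

section Field

variable {k : Type u} [Field k]

instance : IsArtAlgebra k (DualNumber k) where
  __ : IsArtinianRing (DualNumber k) :=
    have : Module.Finite k (DualNumber k) := inferInstanceAs (Module.Finite k (k × k))
    IsArtinianRing.of_finite k _
  residue_bijective := by
    refine ⟨RingHom.injective _, fun x => ?_⟩
    obtain ⟨x, rfl⟩ := IsLocalRing.residue_surjective x
    refine ⟨x.fst, ?_⟩
    change IsLocalRing.residue (DualNumber k) (inl x.fst) = _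
    rw [← sub_eq_zero, ← map_sub, IsLocalRing.residue_eq_zero_iff, IsLocalRing.mem_maximalIdeal,
      mem_nonunits_iff, isUnit_iff_isUnit_fst]
    simp

lemma residueMap_dualNumber (x : DualNumber k) : residueMap k (DualNumber k) x = x.fst := by
  have h1 : residueMap k (DualNumber k) (inl x.fst) = x.fst := residueMap_algebraMap x.fst
  have h2 : residueMap k (DualNumber k) DualNumber.eps = 0 := by
    rw [← mul_self_eq_zero, ← map_mul, DualNumber.eps_mul_eps, map_zero]
  conv_lhs => rw [eq_inl_add_mul_eps x]
  rw [map_add, map_mul, h1, h2, mul_zero, add_zero]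

variable {R S : Type u} [CommRing R] [Algebra k R] [CommRing S] [Algebra k S]

/-- The `k[ε]`-algebra structure of `R[ε]`. -/
abbrev dualNumberAlgebra : Algebra (DualNumber k) (DualNumber R) :=
  (dualNumberMap (algebraMap k R)).toAlgebra

attribute [local instance] dualNumberAlgebra

lemma algebraMap_dualNumber (c : DualNumber k) :
    algebraMap (DualNumber k) (DualNumber R) c = dualNumberMap (algebraMap k R) c := rfl

@[simp] lemma fst_dualNumber_smul (c : DualNumber k) (x : DualNumber R) :
    (c • x).fst = c.fst • x.fst := by
  rw [Algebra.smul_def, algebraMap_dualNumber]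
  simp [Algebra.smul_def]

@[simp] lemma snd_dualNumber_smul (c : DualNumber k) (x : DualNumber R) :
    (c • x).snd = c.fst • x.snd + c.snd • x.fst := by
  rw [Algebra.smul_def, algebraMap_dualNumber]
  simp [Algebra.smul_def]

/-- Cancellation of pushout squares: the composite k → k[ε] → k is the identity, so the outer square
is trivially a pushout, and the square with `R → R[ε]` is one by the preceding construction. -/
lemma isPushout_fst_dualNumber :
    IsPushout (CommRingCat.ofHom (algebraMap (DualNumber k) (DualNumber R)))
      (CommRingCat.ofHom (residueMap k (DualNumber k)))
      (CommRingCat.ofHom (fstHom R R R).toRingHom) (CommRingCat.ofHom (algebraMap k R)) := by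
  have h1 := isPushout_dualNumber (algebraMap k R)
  have h2 : CommRingCat.ofHom (inlHom k k) ≫ CommRingCat.ofHom (residueMap k (DualNumber k)) =
      𝟙 _ := by
    ext x
    exact residueMap_algebraMap x
  have h3 : CommRingCat.ofHom (inlHom R R) ≫ CommRingCat.ofHom (fstHom R R R).toRingHom = 𝟙 _ := by
    ext x; rfl
  refine IsPushout.of_top (h₁₁ := CommRingCat.ofHom (algebraMap k R))
    (v₁₁ := CommRingCat.ofHom (inlHom k k)) (v₁₂ := CommRingCat.ofHom (inlHom R R)) ?_ ?_ h1
  · rw [h2, h3]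
    exact IsPushout.of_vert_isIso ⟨by simp⟩
  · refine CommRingCat.hom_ext (RingHom.ext fun x => ?_)
    change (algebraMap (DualNumber k) (DualNumber R) x).fst =
      algebraMap k R (residueMap k (DualNumber k) x)
    rw [algebraMap_dualNumber, residueMap_dualNumber, fst_dualNumberMap]

instance : Module.Flat (DualNumber k) (DualNumber R) := by
  have h1 := isPullback_SpecMap_of_isPushout _ _ _ _ (isPushout_dualNumber (algebraMap k R))
  have h2 : Flat (Spec.map (CommRingCat.ofHom (algebraMap k R))) :=
    Flat.SpecMap_iff.2 (RingHom.flat_algebraMap_iff.2 inferInstance)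
  have h3 := MorphismProperty.of_isPullback (P := @Flat) h1 h2
  exact RingHom.flat_algebraMap_iff.1 (Flat.SpecMap_iff.1 h3)

/-- Because `δ` factors as `D ∘ φ`, the map is the base change of `φ` to the dual numbers followed
by the automorphism 1 + ε D. -/
lemma isOpenImmersion_dualNumberHom (φ : R →+* S)
    [IsOpenImmersion (Spec.map (CommRingCat.ofHom φ))] (δ : R →+ S) (hδ) (D : S →+ S)
    (hD : ∀ x y, D (x * y) = x * D y + y * D x) (h : ∀ x, δ x = D (φ x)) :
    IsOpenImmersion (Spec.map (CommRingCat.ofHom (dualNumberHom φ δ hδ))) := by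
  have e : CommRingCat.ofHom (dualNumberHom φ δ hδ) = CommRingCat.ofHom (dualNumberMap φ) ≫
      CommRingCat.ofHom (dualNumberHom (RingHom.id S) D hD) := by
    ext x <;> simp [h]
  have h1 := isPullback_SpecMap_of_isPushout _ _ _ _ (isPushout_dualNumber φ)
  have h2 : IsOpenImmersion (Spec.map (CommRingCat.ofHom (dualNumberMap φ))) :=
    MorphismProperty.of_isPullback (P := @IsOpenImmersion) h1 inferInstance
  have h3 : IsIso (CommRingCat.ofHom (dualNumberHom (RingHom.id S) D hD)) :=
    (ConcreteCategory.isIso_iff_bijective _).2 (bijective_dualNumberHom D hD)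
  rw [e, Spec.map_comp]
  infer_instance

/-- The first-order deformation `{-, -} + ε N` of a Poisson bracket. -/
def PoissonBracket.dualNumber (Λ : PoissonBracket k R) (N : R →ₗ[k] R →ₗ[k] R)
    (hN : ∀ x y, N x y = - N y x) (hNl : ∀ x y z, N (x * y) z = x * N y z + y * N x z)
    (hNj : ∀ x y z, Λ.bracket x (N y z) + Λ.bracket y (N z x) + Λ.bracket z (N x y) +
      N x (Λ.bracket y z) + N y (Λ.bracket z x) + N z (Λ.bracket x y) = 0) :
    PoissonBracket (DualNumber k) (DualNumber R) where
  bracket := LinearMap.mk₂ (DualNumber k) (fun x y => inl (Λ.bracket x.fst y.fst) +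
    inr (Λ.bracket x.fst y.snd + Λ.bracket x.snd y.fst + N x.fst y.fst))
    (fun x y z => by
      ext
      · simp
      · simp; ring)
    (fun c x y => by
      ext
      · simp
      · simp; abel)
    (fun x y z => by
      ext
      · simp
      · simp; ring)
    (fun c x y => by
      ext
      · simp
      · simp; abel)
  skew x y := by
    ext
    · simp [Λ.skew x.fst]
    · simp [Λ.skew x.fst, Λ.skew x.snd, hN x.fst]; ring
  leibniz x y z := by
    ext
    · simp [Λ.leibniz]
    · simp [Λ.leibniz, hNl]; ring
  jacobi x y z := by
    ext
    · simp [Λ.jacobi]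
    · simp
      -- The ε-coefficient is the Jacobi identity of `Λ` with one argument at a time replaced by its
      -- ε-part, plus the closedness of `N` on the constant terms.
      linear_combination Λ.jacobi x.fst y.fst z.snd + Λ.jacobi x.fst y.snd z.fst +
        Λ.jacobi x.snd y.fst z.fst + hNj x.fst y.fst z.fst

lemma PoissonBracket.fst_dualNumber_bracket (Λ : PoissonBracket k R) (N hN hNl hNj)
    (x y : DualNumber R) : ((Λ.dualNumber N hN hNl hNj).bracket x y).fst =
      Λ.bracket x.fst y.fst := by
  simp [PoissonBracket.dualNumber]

lemma PoissonBracket.snd_dualNumber_bracket (Λ : PoissonBracket k R) (N hN hNl hNj)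
    (x y : DualNumber R) : ((Λ.dualNumber N hN hNl hNj).bracket x y).snd =
      Λ.bracket x.fst y.snd + Λ.bracket x.snd y.fst + N x.fst y.fst := by
  simp [PoissonBracket.dualNumber]

end Field

end DualNumbers

/-! ### First-order deformations and primitives of hypercocycles -/

section FirstOrder
open TrivSqZeroExt

variable {k : Type u} [Field k] {X : Scheme.{u}} {f : X ⟶ Spec (.of k)} {Λ₀ : PoissonStructure f}
  {J : Type u} [Preorder J] {b : J → X.Opens}

lemma Sections.res_rfl (f : X ⟶ Spec (.of k)) {V : X.Opens} (x : Sections f V) :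
    Sections.res f (le_refl V) x = x :=
  congr(($(X.presheaf.map_id (op V))).hom x)

attribute [local instance] dualNumberAlgebra in
/-- The first-order deformation glued from the charts `(𝒪 ⊗ k[ε], Λ₀ + ε N)` along `1 + ε D` is
trivial if the Poisson scheme is rigid. -/
lemma IsRigid.exists_primitive (H : IsRigid Λ₀)
    (hb : Opens.IsBasis (Set.range b)) (hba : ∀ i, IsAffineOpen (b i))
    (hle : ∀ {i j}, i ≤ j → b i ≤ b j) (hle' : ∀ {i j}, b i ≤ b j → i ≤ j)
    (D : ∀ {i j}, i ≤ j → Sections f (b i) →ₗ[k] Sections f (b i))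
    (hD : ∀ {i j} (h : i ≤ j) x y, D h (x * y) = x * D h y + y * D h x)
    (hDD : ∀ {i j l} (h : i ≤ j) (h' : j ≤ l) (x : Sections f (b l)),
      D (h.trans h') (Sections.res f (hle (h.trans h')) x) =
        Sections.res f (hle h) (D h' (Sections.res f (hle h') x)) +
          D h (Sections.res f (hle (h.trans h')) x))
    (N : ∀ i, Sections f (b i) →ₗ[k] Sections f (b i) →ₗ[k] Sections f (b i))
    (hN : ∀ i x y, N i x y = - N i y x)
    (hNl : ∀ i x y z, N i (x * y) z = x * N i y z + y * N i x z)
    (hNj : ∀ i x y z, (Λ₀.poisson (b i)).bracket x (N i y z) +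
      (Λ₀.poisson (b i)).bracket y (N i z x) + (Λ₀.poisson (b i)).bracket z (N i x y) +
      N i x ((Λ₀.poisson (b i)).bracket y z) + N i y ((Λ₀.poisson (b i)).bracket z x) +
      N i z ((Λ₀.poisson (b i)).bracket x y) = 0)
    (hDN : ∀ {i j} (h : i ≤ j) (x y : Sections f (b j)),
      Sections.res f (hle h) (N j x y) +
        D h ((Λ₀.poisson (b i)).bracket (Sections.res f (hle h) x) (Sections.res f (hle h) y)) =
      (Λ₀.poisson (b i)).bracket (Sections.res f (hle h) x) (D h (Sections.res f (hle h) y)) +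
        (Λ₀.poisson (b i)).bracket (D h (Sections.res f (hle h) x)) (Sections.res f (hle h) y) +
        N i (Sections.res f (hle h) x) (Sections.res f (hle h) y)) :
    ∃ E : ∀ i, Sections f (b i) →ₗ[k] Sections f (b i),
      (∀ i x y, E i (x * y) = x * E i y + y * E i x) ∧
      (∀ {i j} (h : i ≤ j) (x : Sections f (b j)), E i (Sections.res f (hle h) x) =
        Sections.res f (hle h) (E j x) + D h (Sections.res f (hle h) x)) ∧
      ∀ i x y, E i ((Λ₀.poisson (b i)).bracket x y) =
        (Λ₀.poisson (b i)).bracket x (E i y) + (Λ₀.poisson (b i)).bracket (E i x) y + N i x y := by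
  -- The cocycle rule for i ≤ i ≤ i reads D = D + D; hence the glueing map of a chart with itself is
  -- the identity.
  have hD0 : ∀ i x, D (le_refl i) x = 0 := by
    intro i x
    have := hDD (le_refl i) (le_refl i) x
    rw [Sections.res_rfl, Sections.res_rfl] at this
    exact left_eq_add.1 this
  let δ {i j : J} (h : i ≤ j) : Sections f (b j) →+ Sections f (b i) :=
    (D h).toAddMonoidHom.comp (Sections.res f (hle h)).toAddMonoidHom
  have hδ : ∀ {i j : J} (h : i ≤ j) x y, δ h (x * y) = (Sections.res f (hle h)).toRingHom x * δ h y +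
      (Sections.res f (hle h)).toRingHom y * δ h x := fun h x y => by
    change D h (Sections.res f (hle h) (x * y)) = _
    rw [map_mul, hD]
    rfl
  let β {i j : J} (h : i ≤ j) :
      DualNumber (Sections f (b j)) →ₐ[DualNumber k] DualNumber (Sections f (b i)) :=
    { dualNumberHom (Sections.res f (hle h)).toRingHom (δ h) (hδ h) with
      commutes' := fun c => by
        have h0 : D h (algebraMap k _ c.fst) = 0 := by
          have h1 := hD h 1 1
          rw [one_mul, one_mul] at h1
          rw [Algebra.algebraMap_eq_smul_one, map_smul, left_eq_add.1 h1, smul_zero]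
        ext
        · simp [algebraMap_dualNumber]
        · simp [algebraMap_dualNumber, δ, h0] }
  have hβ1 : ∀ {i j : J} (h : i ≤ j) x, (β h x).fst = Sections.res f (hle h) x.fst :=
    fun h x => fst_dualNumberHom _ _ (hδ h) x
  have hβ2 : ∀ {i j : J} (h : i ≤ j) x, (β h x).snd =
      Sections.res f (hle h) x.snd + D h (Sections.res f (hle h) x.fst) :=
    fun h x => snd_dualNumberHom _ _ (hδ h) x
  let M (i) := (Λ₀.poisson (b i)).dualNumber (N i) (hN i) (hNl i) (hNj i)
  obtain ⟨σ, hσk, hσ, hσn, hσM⟩ := H.exists_sections hb hba hle hle' β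
    (fun i x => by
      ext
      · rw [hβ1, Sections.res_rfl]
      · rw [hβ2, hD0, Sections.res_rfl, add_zero])
    (fun h h' x => by
      ext
      · rw [hβ1, hβ1, hβ1, Sections.res_res]
      · rw [hβ2, hβ2, hβ2, hβ1, map_add, Sections.res_res, Sections.res_res, hDD h h', add_assoc])
    (fun {i j} h => by
      have : IsOpenImmersion (Spec.map (CommRingCat.ofHom (Sections.res f (hle h)).toRingHom)) := by
        have e := (hba j).map_fromSpec (hba i) (homOfLE (hle h)).op
        have : IsOpenImmersion (Spec.map (X.presheaf.map (homOfLE (hle h)).op) ≫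
          (hba j).fromSpec) := e ▸ inferInstance
        exact IsOpenImmersion.of_comp (Spec.map (X.presheaf.map (homOfLE (hle h)).op))
          (hba j).fromSpec
      exact isOpenImmersion_dualNumberHom (Sections.res f (hle h)).toRingHom (δ h) (hδ h)
        (D h).toAddMonoidHom (hD h) fun x => rfl)
    (fun i => (fstHom _ _ _).toRingHom) (fun i => isPushout_fst_dualNumber)
    (fun h x => hβ1 h x) M
    (fun {i j} h x y => by
      ext
      · rw [hβ1, PoissonBracket.fst_dualNumber_bracket, PoissonBracket.fst_dualNumber_bracket, hβ1,
          hβ1, Λ₀.res_bracket]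
      · rw [hβ2, PoissonBracket.fst_dualNumber_bracket, PoissonBracket.snd_dualNumber_bracket,
          PoissonBracket.snd_dualNumber_bracket, hβ1, hβ1, hβ2, hβ2, map_add, map_add,
          Λ₀.res_bracket, Λ₀.res_bracket, Λ₀.res_bracket, map_add, map_add, LinearMap.add_apply]
        linear_combination hDN h x.fst y.fst)
    (fun i x y => PoissonBracket.fst_dualNumber_bracket _ _ (hN i) (hNl i) (hNj i) x y)
  have hσ1 : ∀ i x, (σ i x).fst = x := hσ
  -- Each trivialisation is `σ i = 1 + ε E i`, since its constant part is the identity.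
  -- Multiplicativity, compatibility with the glueing maps and the Poisson property, read on
  -- ε-coefficients, are the three claims about `E`.
  refine ⟨fun i =>
    { toFun := fun x => (σ i x).snd
      map_add' := fun x y => by rw [map_add, snd_add]
      map_smul' := fun c x => by
        have : (algebraMap (DualNumber k) (DualNumber (Sections f (b i)))
            (algebraMap k (DualNumber k) c)) = inl (algebraMap k _ c) := by
          ext
          · simp [algebraMap_dualNumber, algebraMap_eq_inl]
          · simp [algebraMap_dualNumber, algebraMap_eq_inl]
        rw [Algebra.smul_def, map_mul, hσk, this, DualNumber.snd_mul, RingHom.id_apply,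
          Algebra.smul_def, fst_inl, snd_inl, zero_mul, add_zero] },
    fun i x y => ?_, fun {i j} h x => ?_, fun i x y => ?_⟩
  · change (σ i (x * y)).snd = x * (σ i y).snd + y * (σ i x).snd
    rw [map_mul, DualNumber.snd_mul, hσ1, hσ1, mul_comm y]
  · change (σ i _).snd = Sections.res f (hle h) (σ j x).snd + _
    rw [hσn, hβ2, hσ1]
  · change (σ i _).snd = (Λ₀.poisson (b i)).bracket x (σ i y).snd +
      (Λ₀.poisson (b i)).bracket (σ i x).snd y + _
    rw [hσM, PoissonBracket.snd_dualNumber_bracket, hσ1, hσ1]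

end FirstOrder

section OfBivectorForm

variable {k A : Type*} [Field k] [CommRing A] [Algebra k A]

/-- The bilinear map of an alternating map in two arguments. -/
def ofBivectorForm (Q : A [⋀^Fin 2]→ₗ[k] A) : A →ₗ[k] A →ₗ[k] A where
  toFun x := ofVectorForm (Q.curryLeft x)
  map_add' x y := by
    ext z
    simp [ofVectorForm_apply, -AlternatingMap.curryLeft_apply_apply]
  map_smul' c x := by
    ext z
    simp [ofVectorForm_apply, -AlternatingMap.curryLeft_apply_apply]

lemma ofBivectorForm_apply (Q : A [⋀^Fin 2]→ₗ[k] A) (x y : A) :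
    ofBivectorForm Q x y = Q ![x, y] := rfl

lemma ofBivectorForm_skew (Q : A [⋀^Fin 2]→ₗ[k] A) (x y : A) :
    ofBivectorForm Q x y = - ofBivectorForm Q y x := by
  have := Q.map_swap ![y, x] (i := 0) (j := 1) (by simp)
  rw [ofBivectorForm_apply, ofBivectorForm_apply, ← this]
  congr 1
  ext i; fin_cases i <;> rfl

lemma ofBivectorForm_mul {Q : A [⋀^Fin 2]→ₗ[k] A} (hQ : Q ∈ skewDerivations k A 2) (x y z : A) :
    ofBivectorForm Q (x * y) z = x * ofBivectorForm Q y z + y * ofBivectorForm Q x z := by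
  have h : ∀ w : A, Function.update ![(0 : A), z] 0 w = ![w, z] := fun w => by
    ext i; fin_cases i <;> rfl
  simpa only [h, ofBivectorForm_apply] using hQ ![0, z] 0 x y

end OfBivectorForm

/-! ### Rigidity implies vanishing of ℍ¹ -/

section Subsingleton

variable {k : Type u} [Field k] [CharZero k] {X : Scheme.{u}} {f : X ⟶ Spec (.of k)}
  {Λ₀ : PoissonStructure f}

/-- The affine open sets subordinate to the cover serve as charts, each deformed by the bivector of
one chosen member of the cover and glued by the vector field of the two chosen members. -/
lemma IsRigid.isBoundary (H : IsRigid Λ₀) {ι : Type u} {U : ι → X.Opens} (hU : iSup U = ⊤)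
    (c : Hypercocycle (schoutenHom Λ₀ 0) (schoutenHom Λ₀ 1) U) : c.IsBoundary := by
  let D (i j) : polyvectorFields f 1 (U i ⊓ U j) := c.D i j
  let P (i) : polyvectorFields f 2 (U i) := c.P i
  have hclosed : ∀ i (V : X.Opens) (hV : V ≤ U i),
      (Λ₀.poisson V).schouten ((P i).1 ⟨V, hV⟩) = 0 := fun i V hV =>
    congrFun (congrArg Subtype.val (c.closed i)) ⟨V, hV⟩
  have hcompat : ∀ i j (V : X.Opens) (hi : V ≤ U i) (hj : V ≤ U j),
      (Λ₀.poisson V).schouten ((D i j).1 ⟨V, le_inf hi hj⟩) = (P i).1 ⟨V, hi⟩ - (P j).1 ⟨V, hj⟩ :=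
    fun i j V hi hj => congrFun (congrArg Subtype.val (c.compat i j)) ⟨V, le_inf hi hj⟩
  have hcocycle : ∀ i j l (V : X.Opens) (hi : V ≤ U i) (hj : V ≤ U j) (hl : V ≤ U l),
      (D i j).1 ⟨V, le_inf hi hj⟩ + (D j l).1 ⟨V, le_inf hj hl⟩ = (D i l).1 ⟨V, le_inf hi hl⟩ :=
    fun i j l V hi hj hl => congrFun (congrArg Subtype.val (c.cocycle i j l V hi hj hl)) ⟨V, le_rfl⟩
  have hDres : ∀ i j (V W : X.Opens) (hi : V ≤ U i) (hj : V ≤ U j) (h : W ≤ V) x,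
      Sections.res f h (ofVectorForm ((D i j).1 ⟨V, le_inf hi hj⟩) x) =
        ofVectorForm ((D i j).1 ⟨W, le_inf (h.trans hi) (h.trans hj)⟩) (Sections.res f h x) := by
    intro i j V W hi hj h x
    rw [ofVectorForm_apply, polyvectorFields.res_apply, ofVectorForm_apply]
    congr 1
    ext i; fin_cases i; rfl
  have hPres : ∀ i (V W : X.Opens) (hi : V ≤ U i) (h : W ≤ V) x y,
      Sections.res f h (ofBivectorForm ((P i).1 ⟨V, hi⟩) x y) =
        ofBivectorForm ((P i).1 ⟨W, h.trans hi⟩) (Sections.res f h x) (Sections.res f h y) := by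
    intro i V W hi h x y
    rw [ofBivectorForm_apply, polyvectorFields.res_apply, ofBivectorForm_apply]
    congr 1
    ext i; fin_cases i <;> rfl
  let J := {V : X.Opens // IsAffineOpen V ∧ ∃ i, V ≤ U i}
  let b (V : J) : X.Opens := V.1
  have hb : Opens.IsBasis (Set.range b) := by
    rw [Opens.isBasis_iff_nbhd]
    intro V x hx
    obtain ⟨i, hi⟩ := Opens.mem_iSup.1 (hU.ge (Opens.mem_top x))
    obtain ⟨W, hW, hxW, hWV⟩ := Opens.isBasis_iff_nbhd.1 X.isBasis_affineOpens
      (show x ∈ V ⊓ U i from ⟨hx, hi⟩)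
    exact ⟨W, ⟨⟨W, hW, i, hWV.trans inf_le_right⟩, rfl⟩, hxW, hWV.trans inf_le_left⟩
  -- `a V` is the chosen index with `V ≤ U (a V)`; the chart `V` carries `P (a V)`, and `W ≤ V` is
  -- glued by `D (a V) (a W)`.
  choose a ha using fun V : J => V.2.2
  obtain ⟨E, hEm, hEn, hEP⟩ := H.exists_primitive (J := J) (b := b) hb (fun V => V.2.1) (fun h => h)
    (fun h => h)
    (fun {W V} h => ofVectorForm ((D (a V) (a W)).1 ⟨W.1, le_inf (le_trans h (ha V)) (ha W)⟩))
    (fun {W V} h =>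
      ofVectorForm_mul ((D (a V) (a W)).2.1 ⟨W.1, le_inf (le_trans h (ha V)) (ha W)⟩))
    (fun {W V V'} h h' x => by
      have h1 := hDres (a V') (a V) V.1 W.1 (le_trans h' (ha V')) (ha V) h (Sections.res f h' x)
      have h2 := hcocycle (a V') (a V) (a W) W.1 (le_trans h (le_trans h' (ha V')))
        (le_trans h (ha V)) (ha W)
      rw [h1, Sections.res_res]
      exact congr($h2.symm ![_]))
    (fun V => ofBivectorForm ((P (a V)).1 ⟨V.1, ha V⟩))
    (fun V => ofBivectorForm_skew _) (fun V => ofBivectorForm_mul ((P (a V)).2.1 ⟨V.1, ha V⟩))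
    (fun V x y z => by
      have := congr($(hclosed (a V) V.1 (ha V)) ![x, y, z])
      rw [PoissonBracket.schouten_apply_two, AlternatingMap.zero_apply, neg_eq_zero] at this
      exact this)
    (fun {W V} h x y => by
      have h1 := hPres (a V) V.1 W.1 (ha V) h x y
      have h2 := congr($(hcompat (a V) (a W) W.1 (le_trans h (ha V)) (ha W))
        ![Sections.res f h x, Sections.res f h y])
      rw [PoissonBracket.schouten_apply_one, AlternatingMap.sub_apply] at h2
      rw [h1]
      simp only [ofVectorForm_apply, ofBivectorForm_apply]
      linear_combination - h2)
  -- On `V` the primitive satisfies [Λ₀, E] = -P (a V), and passing to `W ≤ V` adds `D (a V) (a W)`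
  -- to it. Subtracting it from `D i (a V)` cancels both effects of the choice of `a`: the result is
  -- compatible with restriction and has Schouten bracket `P i`.
  let G (i) (V : J) (hV : b V ≤ U i) : Sections f (b V) →ₗ[k] Sections f (b V) :=
    ofVectorForm ((D i (a V)).1 ⟨V.1, le_inf hV (ha V)⟩) - E V
  have hG : ∀ i V hV x, G i V hV x =
      ofVectorForm ((D i (a V)).1 ⟨V.1, le_inf hV (ha V)⟩) x - E V x := fun _ _ _ _ => rfl
  have hQ := fun i => polyvectorFields.exists_of_basis f hb (n := 1) (U := U i)
    (fun V hV => vectorForm (G i V hV))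
    (fun V hV => vectorForm_mem fun x y => by
      have := ofVectorForm_mul ((D i (a V)).2.1 ⟨V.1, le_inf hV (ha V)⟩) x y
      rw [hG i V hV, hG i V hV, hG i V hV, hEm, this]
      ring)
    (fun W V hV h v => by
      have h1 := hDres i (a V) V.1 W.1 hV (ha V) h (v 0)
      have h2 := congr($(hcocycle i (a V) (a W) W.1 (le_trans h hV) (le_trans h (ha V)) (ha W))
        ![Sections.res f h (v 0)])
      rw [vectorForm_apply, vectorForm_apply, hG i V hV, map_sub, h1, hG i W (le_trans h hV)]
      have h3 := hEn (i := W) (j := V) h (v 0)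
      rw [Function.comp_apply, h3, sub_add_eq_sub_sub, sub_right_comm]
      congr 1
      exact eq_sub_of_add_eq h2)
  choose Q hQ using hQ
  refine ⟨Q, fun i => polyvectorFields.ext_of_basis f hb
    (P := polyvectorFields.schouten Λ₀ 0 (U i) (Q i)) (Q := P i) fun V hV => ?_,
    fun i j => polyvectorFields.ext_of_basis f hb
      (P := polyvectorFields.restrict f 1 inf_le_left (Q i) -
        polyvectorFields.restrict f 1 inf_le_right (Q j)) (Q := D i j) fun V hV => ?_⟩
  · change (Λ₀.poisson (b V)).schouten ((Q i).1 ⟨b V, hV⟩) = (P i).1 ⟨b V, hV⟩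
    rw [hQ i V hV]
    ext v
    have h1 := congr($(hcompat i (a V) V.1 hV (ha V)) ![v 0, v 1])
    rw [PoissonBracket.schouten_apply_one, AlternatingMap.sub_apply] at h1
    have h2 := hEP V (v 0) (v 1)
    rw [vec_two_eta v, PoissonBracket.schouten_apply_one]
    simp only [vectorForm_apply, Matrix.cons_val_zero, hG, map_sub, LinearMap.sub_apply,
      ofVectorForm_apply]
    rw [ofBivectorForm_apply] at h2
    linear_combination h1 + h2
  · change (Q i).1 ⟨b V, _⟩ - (Q j).1 ⟨b V, _⟩ = (D i j).1 ⟨b V, hV⟩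
    rw [hQ i V (hV.trans inf_le_left), hQ j V (hV.trans inf_le_right)]
    ext v
    have h1 := congr($(hcocycle i j (a V) V.1 (hV.trans inf_le_left) (hV.trans inf_le_right)
      (ha V)) ![v 0])
    rw [AlternatingMap.sub_apply, vectorForm_apply, vectorForm_apply, hG i V (hV.trans inf_le_left),
      hG j V (hV.trans inf_le_right),
      sub_sub_sub_cancel_right, vec_one_eta v]
    exact sub_eq_of_eq_add h1.symm

theorem IsRigid.subsingleton_hypercohomology (H : IsRigid Λ₀) :
    Subsingleton (Hypercohomology (tangentComplex Λ₀) 1) :=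
  subsingleton_hypercohomology_tangentComplex fun _ hU c => H.isBoundary hU c

end Subsingleton

end PoissonDeformation

end

theorem mainTheorem3 {k : Type u} [Field k] [IsAlgClosed k] [CharZero k]
    (X : AlgebraicGeometry.Scheme.{u}) (f : X ⟶ AlgebraicGeometry.Spec (.of k))
    [AlgebraicGeometry.Smooth f] [AlgebraicGeometry.IsSeparated f] 
    [AlgebraicGeometry.QuasiCompact f]
    (Λ₀ : PoissonDeformation.PoissonStructure f) :
    PoissonDeformation.IsRigid Λ₀ ↔
      Subsingleton (PoissonDeformation.Hypercohomology (PoissonDeformation.tangentComplex Λ₀) 1) := by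
  exact ⟨PoissonDeformation.IsRigid.subsingleton_hypercohomology,
    PoissonDeformation.isRigid_of_subsingleton⟩
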